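/- Let $F$ be a Borel probability measure on $\mathbb{T}=(-\pi,\pi]$, let $\mathbb{D}=\{z\in\mathbb{C}:|z|<1\}$, put $s(z,t)=\frac{1}{1-ze^{-it}}$ for $z\in\mathbb{D}$, $t\in\mathbb{T}$, and $$K_F(z,w)=\int_{\mathbb{T}} s(z,t)\,\overline{s(w,t)}\,F(dt)\qquad(z,w\in\mathbb{D}).$$ Let $X=(X(z))_{z\in\mathbb{D}}$ be a Gaussian analytic function on $\mathbb{D}$ with covariance kernel $K_F$, that is, a centered, circularly symmetric complex Gaussian process with almost surely analytic sample paths and $\mathbb{E}[X(z)\overline{X(w)}]=K_F(z,w)$. Let $N(B)=\#\{z\in B: X(z)=0\}$ be the number of zeros of $X$ in a Borel set $B\subseteq\mathbb{D}$. The $n$-point correlation function of the zeros is the function $\rho_n\ge 0$, continuous on the set of $n$-tuples of pairwise distinct points of $\mathbb{D}$, such that $$\mathbb{E}\Big[\prod_{i=1}^n N(B_i)\Big]=\int_{B_1\times\cdots\times B_n}\rho_n(\mathbf{a})\,d\mathbf{a}$$ for all pairwise disjoint Borel sets $B_1,\dots,B_n\subseteq\mathbb{D}$, where $d\mathbf{a}$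 is Lebesgue measure on $\mathbb{C}^n$. For $\mathbf{x}=(x_1,\dots,x_m)$ let $V(\mathbf{x})=\det(x_j^{k-1})_{j,k=1}^m=\prod_{1\le j<k\le m}(x_k-x_j)$. For $\mathbf{a}=(a_1,\dots,a_n)\in\mathbb{D}^n$ and a tuple $\mathbf{t}$ of points of $\mathbb{T}$ let $S(\mathbf{a},\mathbf{t})=\prod_{j}\prod_{k}s(a_j,t_k)$, and in particular $S(z,\mathbf{t})=\prod_k s(z,t_k)$ for a single point $z\in\mathbb{D}$. Define measures on $\mathbb{T}^n$ and $\mathbb{T}^{n+1}$ by $$\mu_{\mathbf{a}}(d\mathbf{t})=\frac{1}{n!}\,|V(e^{-it_1},\dots,e^{-it_n})|^2\,|S(\mathbf{a},\mathbf{t})|^2\,F^{\otimes n}(d\mathbf{t}),$$ $$\tilde\mu_{\mathbf{a}}(d\tilde{\mathbf{t}})=\frac{1}{(n+1)!}\,|V(e^{-it_0},e^{-it_1},\dots,e^{-it_n})|^2\,|S(\mathbf{a},\tilde{\mathbf{t}})|^2\,F^{\otimes(n+1)}(d\tilde{\mathbf{t}}),\qquad \tilde{\mathbf{t}}=(t_0,\dots,t_n),$$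 and let $$K^{(n+1)}_{\mathbf{a}}(z,w)=\mathbb{E}^{(n+1)}_{\mathbf{a}}\big[S(z,\tilde{\mathbf{t}})\,\overline{S(w,\tilde{\mathbf{t}})}\big],$$ where $\mathbb{E}^{(n+1)}_{\mathbf{a}}$ is the expectation with respect to the probability measure $\tilde\mu_{\mathbf{a}}/\tilde\mu_{\mathbf{a}}(\mathbb{T}^{n+1})$ on $\mathbb{T}^{n+1}$. Then, for every $n$, the $n$-point correlation function $\rho_n$ of the zeros of $X$ exists, and for all pairwise distinct $\mathbf{a}=(a_1,\dots,a_n)\in\mathbb{D}^n$, $$\rho_n(\mathbf{a})=\frac{1}{\pi^n}\,|V(\mathbf{a})|^2\,\frac{\tilde\mu_{\mathbf{a}}(\mathbb{T}^{n+1})^n}{\mu_{\mathbf{a}}(\mathbb{T}^n)^{n+1}}\;\operatorname{per}\big(K^{(n+1)}_{\mathbf{a}}(a_p,a_q)\big)_{p,q=1}^n,$$ where $\operatorname{per}A=\sum_{\sigma\in\mathcal{S}_n}\prod_{j=1}^n a_{j\sigma(j)}$. If $F$ is supported on at most $n$ points and $n\ge 1$, then $\tilde\mu_{\mathbf{a}}=0$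 (and possibly $\mu_{\mathbf{a}}=0$), and the right-hand side is read as $0$. -/

import Mathlib

open MeasureTheory ProbabilityTheory
open scoped ENNReal NNReal

noncomputable section

namespace SpectralGAF

/-- The open unit disk `𝔻` in the complex plane. -/
def disk : Set ℂ := {z : ℂ | ‖z‖ < 1}

/-- `𝕋 = (-π, π]`, as a type, with its Borel sigma-algebra. -/
abbrev Torus : Type := Set.Ioc (-Real.pi) Real.pi

/-- The point `e^{-it}` of the unit circle. -/
def expNeg (t : Torus) : ℂ := Complex.exp (-Complex.I * ((t : ℝ) : ℂ))

/-- The Szegő kernel `s(z,t) = 1 / (1 - z e^{-it})`. -/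
def szego (z : ℂ) (t : Torus) : ℂ := 1 / (1 - z * expNeg t)

/-- The covariance kernel `K_F(z,w) = ∫ s(z,t) conj(s(w,t)) F(dt)`. -/
def covKernel (F : Measure Torus) (z w : ℂ) : ℂ :=
  ∫ t, szego z t * (starRingEnd ℂ) (szego w t) ∂F

/-- `X = (X(z))_{z ∈ 𝔻}` is a Gaussian analytic function on the disk with covariance kernel `K`:
almost every sample path is analytic on `𝔻`, and `(X(z))_{z ∈ 𝔻}` is a centered (circularly
symmetric) complex Gaussian process with `E[X(z) conj(X(w))] = K(z,w)`. The process is jointly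
Gaussian over `ℝ`, and circular symmetry is `E[X(z) X(w)] = 0`. Values of `X` off `𝔻` play
no role. -/
structure IsGAF {Ω : Type*} [MeasurableSpace Ω] (P : Measure Ω) (X : ℂ → Ω → ℂ)
    (K : ℂ → ℂ → ℂ) : Prop where
  analytic : ∀ᵐ ω ∂P, DifferentiableOn ℂ (fun z => X z ω) disk
  gaussian : IsGaussianProcess (fun z : disk => X (z : ℂ)) P
  mean_zero : ∀ z ∈ disk, ∫ ω, X z ω ∂P = 0
  covariance : ∀ z ∈ disk, ∀ w ∈ disk, ∫ ω, X z ω * (starRingEnd ℂ) (X w ω) ∂P = K z w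
  pseudoCovariance : ∀ z ∈ disk, ∀ w ∈ disk, ∫ ω, X z ω * X w ω ∂P = 0

/-- The number of zeros in `B ∩ 𝔻` of the sample path `z ↦ X(z)(ω)`, i.e. the mass that the zero
process `∑_{z ∈ 𝔻 : X(z) = 0} δ_z` gives to `B`. -/
def zeroCount {Ω : Type*} (X : ℂ → Ω → ℂ) (B : Set ℂ) (ω : Ω) : ℝ≥0∞ :=
  (({z ∈ B ∩ disk | X z ω = 0}.encard : ℕ∞) : ℝ≥0∞)

/-- The configurations `a = (a_1, …, a_n) ∈ 𝔻^n` of pairwise distinct points. -/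
def distinctTuples (n : ℕ) : Set (Fin n → ℂ) :=
  {a | (∀ i, a i ∈ disk) ∧ Function.Injective a}

/-- `ρ` is the `n`-point correlation function (joint intensity), with respect to Lebesgue measure,
of the zeros of `X` in `𝔻`: the number of zeros in every Borel set is a random variable and
`E[N(B_1) ⋯ N(B_n)] = ∫_{B_1 × ⋯ × B_n} ρ` for all pairwise disjoint Borel sets
`B_1, …, B_n ⊆ 𝔻`. Since this determines `ρ` only up to null sets, `ρ` is required to be continuous
on the configurations of distinct points, which determines it at each of them. -/
structure IsCorrelationFunction {Ω : Type*} [MeasurableSpace Ω] (P : Measure Ω)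
    (X : ℂ → Ω → ℂ) (n : ℕ) (ρ : (Fin n → ℂ) → ℝ≥0) : Prop where
  aemeasurable_zeroCount :
    ∀ B : Set ℂ, MeasurableSet B → B ⊆ disk → AEMeasurable (zeroCount X B) P
  lintegral_prod_zeroCount :
    ∀ B : Fin n → Set ℂ, (∀ i, MeasurableSet (B i)) → (∀ i, B i ⊆ disk) →
      Pairwise (fun i j => Disjoint (B i) (B j)) →
      ∫⁻ ω, ∏ i, zeroCount X (B i) ω ∂P = ∫⁻ a in Set.univ.pi B, (ρ a : ℝ≥0∞)
  continuousOn : ContinuousOn ρ (distinctTuples n)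

/-- The Vandermonde determinant `V(a) = det (a_j^{k-1})`. -/
def vand {m : ℕ} (a : Fin m → ℂ) : ℂ := (Matrix.vandermonde a).det

/-- `S(a, t) = ∏_j ∏_k s(a_j, t_k)`. -/
def szegoProd {n m : ℕ} (a : Fin n → ℂ) (t : Fin m → Torus) : ℂ :=
  ∏ j, ∏ k, szego (a j) (t k)

/-- The measure `(1/m!) |V(e^{-it_1}, …, e^{-it_m})|² |S(a,t)|² F^{⊗m}(dt)` on `𝕋^m`.
For `a = (a_1, …, a_n)` it is `μ_a` when `m = n` and `μ̃_a` when `m = n + 1`. -/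
def vandMeasure (F : Measure Torus) {n : ℕ} (a : Fin n → ℂ) (m : ℕ) :
    Measure (Fin m → Torus) :=
  (Measure.pi fun _ : Fin m => F).withDensity fun t =>
    ENNReal.ofReal
      (1 / (m.factorial : ℝ) * ‖vand fun k => expNeg (t k)‖ ^ 2 * ‖szegoProd a t‖ ^ 2)

/-- The law `ℙ_a^{(m)}` on `𝕋^m`, the normalization of the previous measure to a
probability measure. -/
def pointLaw (F : Measure Torus) {n : ℕ} (a : Fin n → ℂ) (m : ℕ) :
    Measure (Fin m → Torus) :=
  (vandMeasure F a m Set.univ)⁻¹ • vandMeasure F a m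

/-- `K_a^{(m)}(z,w) = 𝔼_a^{(m)}[S(z,t) conj(S(w,t))]`. -/
def tiltedKernel (F : Measure Torus) {n : ℕ} (a : Fin n → ℂ) (m : ℕ) (z w : ℂ) : ℂ :=
  ∫ t, (∏ k, szego z (t k)) * (starRingEnd ℂ) (∏ k, szego w (t k)) ∂(pointLaw F a m)

end SpectralGAF

end

open SpectralGAF

noncomputable section

namespace SpectralGAF

/-! Heuristically, Kac-Rice gives ρ_n(a) = E[∏|X'(a_i)|² | X(a_1) = ⋯ = X(a_n) = 0] / (π^n
det(K_F(a_i,a_j))). Conditioned on these zeros, X is a Gaussian analytic function whose kernel is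
the Schur complement of the covariance matrix, a quotient of an (n+1)×(n+1) determinant by an n×n
one. Andréief's identity turns both into integrals of products of determinants of Szegő kernels, and
Cauchy's formula evaluates these (`det_covMatrix`). The denominator is |V(a)|² μ_a(𝕋^n), and the
conditional kernel is ∏(z - a_j) · conj ∏(w - a_j) · (μ̃_a/μ_a) · K_a^{(n+1)}(z,w), with the masses
written μ_a and μ̃_a (`condKernel_eq`). The zeros are now explicit factors, so the derivatives at
the a_p have covariance given by K_a^{(n+1)}(a_p,a_q) times constants. Wick's formula yields |V(a)|⁴
(μ̃_a/μ_a)^n times the permanent (`integral_prod_norm_deriv_sq`), and division gives the formula.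

Kac-Rice is proved without conditioning on null events. Regression on the values at a fixed w writes
X = Y + ∑ η_j h_j with standard Gaussian η independent of Y, and Y vanishing at w
(`IsGAF.exists_regression`). For frozen Y, the tuples of zeros near w form the fibre over η of a
holomorphic map z ↦ u(z), so the area formula gives their exact mean number
(`lintegral_prod_encard_zeros`). Averaging over Y gives a correlation density continuous near w; at
the centre w it is explicit, because u(w) = 0. Doing this at every w and comparing continuous
densities on small boxes identifies the density everywhere
(`IsGAF.isCorrelationFunction_zeroDensity`). A dyadic decomposition passes from small boxes to all
boxes with disjoint sides (`lintegral_prod_zeroCount_of_local`).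

If μ_a = 0, regression on n points is impossible. This depends only on F, and a smaller order k is
still nondegenerate with ρ_k = 0. Hence k disjoint sets almost surely do not all contain zeros, and
ρ_n = 0 as well (`IsGAF.isCorrelationFunction_zero`). -/

/-! ### Dyadic squares -/

/-- The index of the half-open dyadic square of side `2⁻ᵏ` that contains `z`. -/
def dyadicIndex (k : ℕ) (z : ℂ) : ℤ × ℤ := (⌊2 ^ k * z.re⌋, ⌊2 ^ k * z.im⌋)

lemma measurable_dyadicIndex (k : ℕ) : Measurable (dyadicIndex k) :=
  ((Complex.measurable_re.const_mul _).floor).prodMk ((Complex.measurable_im.const_mul _).floor)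

lemma floor_eq_of_floor_two_mul_eq {x y : ℝ} (h : ⌊2 * x⌋ = ⌊2 * y⌋) : ⌊x⌋ = ⌊y⌋ := by
  have key : ∀ t : ℝ, ⌊t⌋ = ⌊2 * t⌋ / 2 := fun t => by
    have h1 := Int.floor_le t
    have h2 := Int.lt_floor_add_one t
    have h3 : 2 * ⌊t⌋ ≤ ⌊2 * t⌋ := Int.le_floor.2 (by push_cast; linarith)
    have h4 : ⌊2 * t⌋ < 2 * ⌊t⌋ + 2 := Int.floor_lt.2 (by push_cast; linarith)
    omega
  rw [key x, key y, h]

lemma dyadicIndex_eq_of_succ {k : ℕ} {z w : ℂ} (h : dyadicIndex (k + 1) z = dyadicIndex (k + 1) w) :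
    dyadicIndex k z = dyadicIndex k w := by
  simp only [dyadicIndex, Prod.mk.injEq, pow_succ', mul_assoc] at h ⊢
  exact ⟨floor_eq_of_floor_two_mul_eq h.1, floor_eq_of_floor_two_mul_eq h.2⟩

lemma dyadicIndex_eq_of_le {k l : ℕ} (hkl : k ≤ l) {z w : ℂ}
    (h : dyadicIndex l z = dyadicIndex l w) : dyadicIndex k z = dyadicIndex k w := by
  induction l, hkl using Nat.le_induction with
  | base => exact h
  | succ l _ ih => exact ih (dyadicIndex_eq_of_succ h)

lemma dist_le_of_dyadicIndex_eq {k : ℕ} {z w : ℂ} (h : dyadicIndex k z = dyadicIndex k w) :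
    dist z w ≤ 2 * (1 / 2) ^ k := by
  simp only [dyadicIndex, Prod.mk.injEq] at h
  have hp : (0 : ℝ) < 2 ^ k := by positivity
  have key : ∀ x y : ℝ, ⌊2 ^ k * x⌋ = ⌊2 ^ k * y⌋ → |x - y| ≤ (1 / 2) ^ k := fun x y hxy => by
    have := (Int.abs_sub_lt_one_of_floor_eq_floor hxy).le
    rw [← mul_sub, abs_mul, abs_of_pos hp] at this
    rw [one_div_pow]
    exact (le_div_iff₀' hp).2 this
  rw [Complex.dist_eq]
  calc ‖z - w‖ ≤ |(z - w).re| + |(z - w).im| := Complex.norm_le_abs_re_add_abs_im _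
    _ ≤ (1 / 2) ^ k + (1 / 2) ^ k := add_le_add (by simpa using key _ _ h.1)
        (by simpa using key _ _ h.2)
    _ = _ := by ring

lemma eventually_two_mul_half_pow_lt {ε : ℝ} (hε : 0 < ε) : ∃ k : ℕ, 2 * (1 / 2 : ℝ) ^ k < ε := by
  obtain ⟨k, hk⟩ := exists_pow_lt_of_lt_one (half_pos hε) (by norm_num : (1 / 2 : ℝ) < 1)
  exact ⟨k, by linarith⟩

/-- A finite set has a positive minimal distance, so small enough squares separate its points;
finite subsets then handle infinite sets. Counting zeros thereby reduces to countably many events of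
the form "this square contains a zero". -/
lemma encard_eq_iSup_image_dyadicIndex (S : Set ℂ) :
    S.encard = ⨆ k, (dyadicIndex k '' S).encard := by
  apply le_antisymm
  · refine ENat.forall_natCast_le_iff_le.1 fun m hm => ?_
    obtain ⟨T, hTS, hT⟩ := Set.exists_subset_encard_eq hm
    have hTf : T.Finite := Set.finite_of_encard_eq_coe hT
    obtain ⟨ε, hε, hsep⟩ : ∃ ε > 0, ∀ x ∈ T, ∀ y ∈ T, x ≠ y → ε ≤ dist x y := by
      rcases (T ×ˢ T \ {p | p.1 = p.2}).eq_empty_or_nonempty with h | h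
      · refine ⟨1, one_pos, fun x hx y hy hxy => ?_⟩
        have : (x, y) ∈ T ×ˢ T \ {p : ℂ × ℂ | p.1 = p.2} := ⟨⟨hx, hy⟩, hxy⟩
        simp [h] at this
      · obtain ⟨p, hp, hmin⟩ := Set.exists_min_image _ (fun p : ℂ × ℂ => dist p.1 p.2)
          ((hTf.prod hTf).subset Set.sdiff_subset) h
        exact ⟨dist p.1 p.2, dist_pos.2 hp.2, fun x hx y hy hxy => hmin (x, y) ⟨⟨hx, hy⟩, hxy⟩⟩
    obtain ⟨k, hk⟩ := eventually_two_mul_half_pow_lt hε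
    have hinj : Set.InjOn (dyadicIndex k) T := fun x hx y hy hxy => by
      by_contra hne
      exact absurd (hsep x hx y hy hne) (not_le.2 ((dist_le_of_dyadicIndex_eq hxy).trans_lt hk))
    calc (m : ℕ∞) = (dyadicIndex k '' T).encard := by rw [hinj.encard_image, hT]
      _ ≤ (dyadicIndex k '' S).encard := Set.encard_le_encard (Set.image_mono hTS)
      _ ≤ _ := le_iSup (fun k => (dyadicIndex k '' S).encard) k
  · exact iSup_le fun k => Set.encard_image_le _ _

lemma encard_toENNReal_eq_tsum_indicator {α : Type*} (S : Set α) :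
    ((S.encard : ℕ∞) : ℝ≥0∞) = ∑' a, S.indicator (fun _ => (1 : ℝ≥0∞)) a := by
  let _ : MeasurableSpace α := ⊤
  rw [← Measure.count_apply (MeasurableSpace.measurableSet_top)]
  rw [← lintegral_indicator_one (MeasurableSpace.measurableSet_top), lintegral_count]
  rfl

/-- A half-open square is the intersection of a closed set and an open set, and an open set in the
plane is a countable union of closed sets. -/
lemma isClosed_inter_dyadic_isSigmaCompact {C : Set ℂ} (hC : IsCompact C) (k : ℕ) (q : ℤ × ℤ) :
    IsSigmaCompact (C ∩ dyadicIndex k ⁻¹' {q}) := by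
  let U : Set ℂ := {z | 2 ^ k * z.re < q.1 + 1} ∩ {z | 2 ^ k * z.im < q.2 + 1}
  let D : Set ℂ := {z | (q.1 : ℝ) ≤ 2 ^ k * z.re} ∩ {z | (q.2 : ℝ) ≤ 2 ^ k * z.im}
  have hU : IsOpen U := (isOpen_lt (by fun_prop) (by fun_prop)).inter
    (isOpen_lt (by fun_prop) (by fun_prop))
  have hD : IsClosed D := (isClosed_le (by fun_prop) (by fun_prop)).inter
    (isClosed_le (by fun_prop) (by fun_prop))
  obtain ⟨G, hG, -, hGU, -⟩ := hU.exists_iUnion_isClosed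
  have : C ∩ dyadicIndex k ⁻¹' {q} = ⋃ n, C ∩ (D ∩ G n) := by
    rw [← Set.inter_iUnion, ← Set.inter_iUnion, hGU]
    congr 1
    ext z
    simp only [dyadicIndex, Set.mem_preimage, Set.mem_singleton_iff, Prod.ext_iff, Int.floor_eq_iff,
      U, D, Set.mem_inter_iff, Set.mem_ofPred_eq]
    tauto
  rw [this]
  exact isSigmaCompact_iUnion_of_isCompact _ fun n => hC.inter_right (hD.inter (hG n))

/-! ### Measurability of the zero counts -/

section Measurability

variable {Ω : Type*} [MeasurableSpace Ω] {f : ℂ → Ω → ℂ}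

lemma isOpen_disk : IsOpen disk := isOpen_lt continuous_norm continuous_const

lemma disk_eq_ball : disk = Metric.ball 0 1 := by ext z; simp [disk]

lemma convex_disk : Convex ℝ disk := disk_eq_ball ▸ convex_ball _ _

/-- The modulus attains its minimum on a compact set, so a zero exists exactly when arbitrarily
small values occur on a countable dense subset. -/
lemma measurableSet_exists_zero_of_isCompact (hm : ∀ z ∈ disk, Measurable (f z))
    (hc : ∀ ω, ContinuousOn (fun z => f z ω) disk) {C : Set ℂ} (hC : IsCompact C)
    (hCd : C ⊆ disk) : MeasurableSet {ω | ∃ z ∈ C, f z ω = 0} := by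
  obtain ⟨D, hDc, hD⟩ := TopologicalSpace.exists_countable_dense C
  have : {ω | ∃ z ∈ C, f z ω = 0} =
      ⋂ m : ℕ, ⋃ z ∈ D, {ω | ‖f z ω‖ < 1 / ((m : ℝ) + 1)} := by
    ext ω
    have hcont : Continuous fun z : C => ‖f z ω‖ :=
      (continuousOn_iff_continuous_domRestrict.1 ((hc ω).mono hCd)).norm
    simp only [Set.mem_ofPred_eq, Set.mem_iInter, Set.mem_iUnion, exists_prop]
    constructor
    · rintro ⟨z, hz, h0⟩ m
      have hop : IsOpen {x : C | ‖f x ω‖ < 1 / ((m : ℝ) + 1)} := isOpen_lt hcont continuous_const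
      obtain ⟨x, hx, hxD⟩ := hD.exists_mem_open hop ⟨⟨z, hz⟩, by simp [h0]; positivity⟩
      exact ⟨x, hx, hxD⟩
    · intro h
      have hne : C.Nonempty := by
        obtain ⟨x, -, -⟩ := h 0
        exact ⟨x, x.2⟩
      obtain ⟨z, hz, hmin⟩ := hC.exists_isMinOn hne ((hc ω).mono hCd).norm
      refine ⟨z, hz, norm_eq_zero.1 (le_antisymm (le_of_forall_pos_lt_add fun ε hε => ?_)
        (norm_nonneg _))⟩
      obtain ⟨m, hm⟩ := exists_nat_one_div_lt hε
      obtain ⟨x, -, hxm⟩ := h m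
      have := hmin x.2
      simp only [Set.mem_ofPred_eq] at this
      linarith
  rw [this]
  refine MeasurableSet.iInter fun m => MeasurableSet.biUnion hDc fun z _ => ?_
  exact measurableSet_lt (hm z (hCd z.2)).norm measurable_const

lemma measurableSet_exists_zero_of_isSigmaCompact (hm : ∀ z ∈ disk, Measurable (f z))
    (hc : ∀ ω, ContinuousOn (fun z => f z ω) disk) {C : Set ℂ} (hC : IsSigmaCompact C)
    (hCd : C ⊆ disk) : MeasurableSet {ω | ∃ z ∈ C, f z ω = 0} := by
  obtain ⟨K, hK, rfl⟩ := hC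
  have : {ω | ∃ z ∈ ⋃ n, K n, f z ω = 0} = ⋃ n, {ω | ∃ z ∈ K n, f z ω = 0} := by
    ext ω; simp only [Set.mem_ofPred_eq, Set.mem_iUnion]; tauto
  rw [this]
  exact MeasurableSet.iUnion fun n => measurableSet_exists_zero_of_isCompact hm hc (hK n)
    ((Set.subset_iUnion K n).trans hCd)

lemma measurable_zeroCount_of_isCompact (hm : ∀ z ∈ disk, Measurable (f z))
    (hc : ∀ ω, ContinuousOn (fun z => f z ω) disk) {C : Set ℂ} (hC : IsCompact C)
    (hCd : C ⊆ disk) : Measurable (zeroCount f C) := by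
  have : zeroCount f C = fun ω => ⨆ k, ∑' q : ℤ × ℤ,
      {ω | ∃ z ∈ C ∩ dyadicIndex k ⁻¹' {q}, f z ω = 0}.indicator (fun _ => (1 : ℝ≥0∞)) ω := by
    ext ω
    rw [zeroCount, encard_eq_iSup_image_dyadicIndex, ENat.toENNReal_iSup]
    refine iSup_congr fun k => ?_
    rw [encard_toENNReal_eq_tsum_indicator]
    refine tsum_congr fun q => ?_
    classical
    rw [Set.indicator_apply, Set.indicator_apply]
    refine if_congr ?_ rfl rfl
    simp only [Set.mem_image, Set.mem_ofPred_eq, Set.mem_inter_iff, Set.mem_preimage,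
      Set.mem_singleton_iff]
    exact ⟨fun ⟨x, ⟨⟨h1, h2⟩, h3⟩, h4⟩ => ⟨x, ⟨h1, h4⟩, h3⟩,
      fun ⟨x, ⟨h1, h4⟩, h3⟩ => ⟨x, ⟨⟨h1, hCd h1⟩, h3⟩, h4⟩⟩
  rw [this]
  refine Measurable.iSup fun k => Measurable.tsum fun q => ?_
  exact measurable_const.indicator (measurableSet_exists_zero_of_isSigmaCompact hm hc
    (isClosed_inter_dyadic_isSigmaCompact hC k q) (Set.inter_subset_left.trans hCd))

lemma finite_zeros_of_isCompact {g : ℂ → ℂ} (hg : DifferentiableOn ℂ g disk)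
    (h0 : ∃ z ∈ disk, g z ≠ 0) {C : Set ℂ} (hC : IsCompact C) (hCd : C ⊆ disk) :
    {z ∈ C | g z = 0}.Finite := by
  by_contra hinf
  obtain ⟨z, hzC, hz⟩ := Set.Infinite.exists_accPt_of_subset_isCompact hinf hC (Set.sep_subset _ _)
  obtain ⟨w, hw, hgw⟩ := h0
  have hfreq : ∃ᶠ x in nhdsWithin z {z}ᶜ, g x = 0 :=
    (accPt_iff_frequently_nhdsNE.1 hz).mono fun x hx => hx.2
  exact hgw ((hg.analyticOnNhd isOpen_disk).eqOn_zero_of_preconnected_of_frequently_eq_zero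
    convex_disk.isPreconnected (hCd hzC) hfreq hw)

lemma closedBall_subset_disk {r : ℝ} (hr : r < 1) : Metric.closedBall (0 : ℂ) r ⊆ disk :=
  fun z hz => lt_of_le_of_lt (by simpa using hz) hr

lemma measurable_zeroCount_inter_closedBall (hm : ∀ z ∈ disk, Measurable (f z))
    (ha : ∀ ω, DifferentiableOn ℂ (fun z => f z ω) disk)
    (h0 : ∀ ω, ∃ z ∈ disk, f z ω ≠ 0) {r : ℝ} (hr : r < 1) {B : Set ℂ} (hB : MeasurableSet B) :
    Measurable (zeroCount f (B ∩ Metric.closedBall 0 r)) := by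
  have hc : ∀ ω, ContinuousOn (fun z => f z ω) disk := fun ω => (ha ω).continuousOn
  have hcb := isCompact_closedBall (0 : ℂ) r
  let Z : Ω → Set ℂ := fun ω => {z ∈ Metric.closedBall (0 : ℂ) r | f z ω = 0}
  have hZ : ∀ ω, (Z ω).Finite := fun ω =>
    finite_zeros_of_isCompact (ha ω) (h0 ω) hcb (closedBall_subset_disk hr)
  let μ : Ω → Measure ℂ := fun ω => Measure.count.restrict (Z ω)
  have hμ : ∀ ω, IsFiniteMeasure (μ ω) := fun ω =>
    ⟨by simpa [μ] using Measure.count_apply_lt_top.2 (hZ ω)⟩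
  have hμB : ∀ A, MeasurableSet A → (fun ω => μ ω A) =
      zeroCount f (A ∩ Metric.closedBall 0 r) := fun A hA => by
    ext ω
    simp only [μ, zeroCount]
    rw [Measure.restrict_apply hA, Measure.count_apply (hA.inter (hZ ω).measurableSet)]
    congr 2
    ext z
    simp only [Z, Set.mem_inter_iff, Set.mem_ofPred_eq]
    have := @closedBall_subset_disk r hr z
    tauto
  have hmeas : Measurable μ := by
    -- Closed sets form a π-system generating the Borel sets. The extension to all Borel sets needs
    -- finite measures, hence the restriction to a closed ball inside the disk and to paths that do
    -- not vanish identically.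
    refine Measurable.measure_of_isPiSystem (S := {s | IsClosed s})
      ((BorelSpace.measurable_eq (α := ℂ)).trans borel_eq_generateFrom_isClosed)
      isPiSystem_isClosed (fun s hs => ?_) ?_
    · rw [hμB s (IsClosed.measurableSet hs)]
      exact measurable_zeroCount_of_isCompact hm hc (hcb.inter_left hs)
        (Set.inter_subset_right.trans (closedBall_subset_disk hr))
    · rw [hμB _ MeasurableSet.univ, Set.univ_inter]
      exact measurable_zeroCount_of_isCompact hm hc hcb (closedBall_subset_disk hr)
  rw [← hμB B hB]
  exact (Measure.measurable_coe hB).comp hmeas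

/-- The number of zeros of a random analytic function in a Borel set is measurable. -/
theorem measurable_zeroCount (hm : ∀ z ∈ disk, Measurable (f z))
    (ha : ∀ ω, DifferentiableOn ℂ (fun z => f z ω) disk) {B : Set ℂ} (hB : MeasurableSet B) :
    Measurable (zeroCount f B) := by
  classical
  have hc : ∀ ω, ContinuousOn (fun z => f z ω) disk := fun ω => (ha ω).continuousOn
  -- On `A` the zeros fill the disk. There the path is replaced by the constant 1, and the true
  -- count `(B ∩ disk).encard` is restored at the end.
  let A : Set Ω := {ω | ∀ z ∈ disk, f z ω = 0}
  have hA : MeasurableSet A := by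
    obtain ⟨D, hDc, hD⟩ := TopologicalSpace.exists_countable_dense disk
    have : A = ⋂ z ∈ D, {ω | f z ω = 0} := by
      ext ω
      simp only [A, Set.mem_ofPred_eq, Set.mem_iInter]
      refine ⟨fun h z _ => h z z.2, fun h z hz => ?_⟩
      have hcont : Continuous fun z : disk => f z ω :=
        continuousOn_iff_continuous_domRestrict.1 (hc ω)
      exact congrFun (hcont.ext_on hD continuous_const fun x hx => h x hx) ⟨z, hz⟩
    rw [this]
    exact MeasurableSet.biInter hDc fun z _ => (hm z z.2) (measurableSet_singleton 0)
  let g : ℂ → Ω → ℂ := fun z => A.piecewise (fun _ => 1) (f z)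
  have hg : ∀ z ∈ disk, Measurable (g z) := fun z hz =>
    Measurable.piecewise hA measurable_const (hm z hz)
  have hgA : ∀ ω ∈ A, ∀ z, g z ω = 1 := fun ω hω z => Set.piecewise_eq_of_mem _ _ _ hω
  have hgA' : ∀ ω ∉ A, ∀ z, g z ω = f z ω := fun ω hω z => Set.piecewise_eq_of_notMem _ _ _ hω
  have hga : ∀ ω, DifferentiableOn ℂ (fun z => g z ω) disk := fun ω => by
    by_cases hω : ω ∈ A
    · simp only [hgA ω hω]; exact differentiableOn_const _
    · simp only [hgA' ω hω]; exact ha ω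
  have hg0 : ∀ ω, ∃ z ∈ disk, g z ω ≠ 0 := fun ω => by
    by_cases hω : ω ∈ A
    · exact ⟨0, by simp [disk], by simp [hgA ω hω]⟩
    · have : ∃ z ∈ disk, f z ω ≠ 0 := by simpa [A] using hω
      simpa only [hgA' ω hω] using this
  have hmono : Monotone fun m : ℕ => B ∩ Metric.closedBall (0 : ℂ) (1 - 1 / ((m : ℝ) + 1)) :=
    fun m n hmn => Set.inter_subset_inter_right _ (Metric.closedBall_subset_closedBall
      (sub_le_sub_left (Nat.one_div_le_one_div hmn) _))
  have hr : ∀ m : ℕ, 1 - 1 / ((m : ℝ) + 1) < 1 := fun m => by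
    have : (0 : ℝ) < 1 / ((m : ℝ) + 1) := by positivity
    linarith
  have hgB : zeroCount g B = fun ω => ⨆ m : ℕ,
      zeroCount g (B ∩ Metric.closedBall 0 (1 - 1 / ((m : ℝ) + 1))) ω := by
    ext ω
    let ν : Measure ℂ := Measure.count.restrict {z ∈ disk | g z ω = 0}
    have hcount : {z ∈ disk | g z ω = 0}.Countable := by
      have : {z ∈ disk | g z ω = 0} = ⋃ m : ℕ,
          {z ∈ Metric.closedBall (0 : ℂ) (1 - 1 / ((m : ℝ) + 1)) | g z ω = 0} := by
        ext z
        simp only [Set.mem_ofPred_eq, Set.mem_iUnion]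
        constructor
        · rintro ⟨hz, hgz⟩
          obtain ⟨m, hm⟩ := exists_nat_one_div_lt (sub_pos.2 (show ‖z‖ < 1 from hz))
          exact ⟨m, by simp only [Metric.mem_closedBall, dist_zero_right]; linarith, hgz⟩
        · rintro ⟨m, hz, hgz⟩
          exact ⟨closedBall_subset_disk (hr m) hz, hgz⟩
      rw [this]
      exact Set.countable_iUnion fun m => (finite_zeros_of_isCompact (hga ω) (hg0 ω)
        (isCompact_closedBall _ _) (closedBall_subset_disk (hr m))).countable
    have hν : ∀ S, MeasurableSet S → ν S = zeroCount g S ω := fun S hS => by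
      simp only [ν, zeroCount]
      rw [Measure.restrict_apply hS, Measure.count_apply (hS.inter hcount.measurableSet)]
      congr 2
      ext z; simp only [Set.mem_inter_iff, Set.mem_ofPred_eq]; tauto
    have hBm : ∀ m : ℕ, MeasurableSet (B ∩ Metric.closedBall (0 : ℂ) (1 - 1 / ((m : ℝ) + 1))) :=
      fun m => hB.inter measurableSet_closedBall
    calc zeroCount g B ω = zeroCount g (⋃ m : ℕ,
          B ∩ Metric.closedBall 0 (1 - 1 / ((m : ℝ) + 1))) ω := by
          simp only [zeroCount]
          congr 2
          ext z
          simp only [Set.mem_ofPred_eq, Set.mem_inter_iff, Set.mem_iUnion]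
          constructor
          · rintro ⟨⟨hzB, hz⟩, hgz⟩
            obtain ⟨m, hm⟩ := exists_nat_one_div_lt (sub_pos.2 (show ‖z‖ < 1 from hz))
            exact ⟨⟨⟨m, hzB, by simp only [Metric.mem_closedBall, dist_zero_right]; linarith⟩, hz⟩,
              hgz⟩
          · rintro ⟨⟨⟨m, hzB, -⟩, hz⟩, hgz⟩
            exact ⟨⟨hzB, hz⟩, hgz⟩
      _ = _ := by
          rw [← hν _ (MeasurableSet.iUnion hBm), hmono.directed_le.measure_iUnion]
          exact iSup_congr fun m => hν _ (hBm m)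
  have hgm : Measurable (zeroCount g B) := by
    rw [hgB]
    exact Measurable.iSup fun m => measurable_zeroCount_inter_closedBall hg hga hg0 (hr m) hB
  have : zeroCount f B = A.piecewise (fun _ => (((B ∩ disk).encard : ℕ∞) : ℝ≥0∞))
      (zeroCount g B) := by
    ext ω
    by_cases hω : ω ∈ A
    · rw [Set.piecewise_eq_of_mem _ _ _ hω, zeroCount]
      congr 2
      ext z
      exact ⟨fun h => h.1, fun h => ⟨h, hω z h.2⟩⟩
    · rw [Set.piecewise_eq_of_notMem _ _ _ hω, zeroCount, zeroCount]
      simp only [hgA' ω hω]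
  rw [this]
  exact Measurable.piecewise hA measurable_const hgm

end Measurability

/-! ### From small boxes to all boxes -/

/-- For the discrete sigma-algebra cardinality is counting measure, so this is continuity from
below. -/
lemma encard_iUnion_of_monotone {α : Type*} {S : ℕ → Set α} (hS : Monotone S) :
    (((⋃ k, S k).encard : ℕ∞) : ℝ≥0∞) = ⨆ k, (((S k).encard : ℕ∞) : ℝ≥0∞) := by
  let _ : MeasurableSpace α := ⊤
  have h : ∀ T : Set α, ((T.encard : ℕ∞) : ℝ≥0∞) = Measure.count T := fun T =>
    (Measure.count_apply MeasurableSpace.measurableSet_top).symm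
  simp only [h]
  exact hS.directed_le.measure_iUnion

lemma encard_eq_tsum_fiber {α β : Type*} [Countable β] (S : Set α) (φ : α → β) :
    ((S.encard : ℕ∞) : ℝ≥0∞) = ∑' q, (((S ∩ φ ⁻¹' {q}).encard : ℕ∞) : ℝ≥0∞) := by
  let _ : MeasurableSpace α := ⊤
  have h : ∀ T : Set α, ((T.encard : ℕ∞) : ℝ≥0∞) = Measure.count T := fun T =>
    (Measure.count_apply MeasurableSpace.measurableSet_top).symm
  simp only [h]
  rw [← measure_iUnion _ fun _ => MeasurableSpace.measurableSet_top]
  · congr 1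
    ext x; simp
  · intro p q hpq
    exact Set.disjoint_left.2 fun x hx hy => hpq (hx.2.symm.trans hy.2)

section Boxes

variable {Ω : Type*} {n : ℕ}

/-- As the cardinality of a set of tuples in the box, the product of counts is additive when the box
is cut into pieces. -/
lemma prod_zeroCount_eq_encard (f : ℂ → Ω → ℂ) (B : Fin n → Set ℂ) (ω : Ω) :
    ∏ i, zeroCount f (B i) ω =
      (((Set.univ.pi B ∩ {z | ∀ i, z i ∈ disk ∧ f (z i) ω = 0}).encard : ℕ∞) : ℝ≥0∞) := by
  have : Set.univ.pi B ∩ {z | ∀ i, z i ∈ disk ∧ f (z i) ω = 0} =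
      Set.univ.pi fun i => {z ∈ B i ∩ disk | f z ω = 0} := by
    ext z
    simp only [Set.mem_inter_iff, Set.mem_univ_pi, Set.mem_ofPred_eq]
    exact ⟨fun h i => ⟨⟨h.1 i, (h.2 i).1⟩, (h.2 i).2⟩,
      fun h => ⟨fun i => (h i).1.1, fun i => ⟨(h i).1.2, (h i).2⟩⟩⟩
  rw [this, Set.encard_pi_eq_prod_encard]
  simp only [zeroCount]
  exact (map_prod ENat.toENNRealRingHom _ _).symm

variable [MeasurableSpace Ω]

/-- If `E[N(B₁) ⋯ N(Bₙ)] = ∫_{B₁ × ⋯ × Bₙ} ρ` holds for all small boxes near each point of an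
open set, then it holds for all boxes in that set. -/
theorem lintegral_prod_zeroCount_of_local (P : Measure Ω) {f : ℂ → Ω → ℂ}
    (hN : ∀ B : Set ℂ, MeasurableSet B → Measurable (zeroCount f B))
    (ρ : (Fin n → ℂ) → ℝ≥0∞) {U : Set (Fin n → ℂ)}
    (hloc : ∀ w ∈ U, ∃ r > 0, ∀ B : Fin n → Set ℂ, (∀ i, MeasurableSet (B i)) →
      (∀ i, B i ⊆ Metric.ball (w i) r) →
      ∫⁻ ω, ∏ i, zeroCount f (B i) ω ∂P = ∫⁻ a in Set.univ.pi B, ρ a)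
    (B : Fin n → Set ℂ) (hB : ∀ i, MeasurableSet (B i)) (hBU : Set.univ.pi B ⊆ U) :
    ∫⁻ ω, ∏ i, zeroCount f (B i) ω ∂P = ∫⁻ a in Set.univ.pi B, ρ a := by
  classical
  let idx : ℕ → (Fin n → ℂ) → Fin n → ℤ × ℤ := fun k z i => dyadicIndex k (z i)
  -- A dyadic cube is good if the identity holds for all of its sub-boxes. This passes to smaller
  -- cubes, so the unions `T k` of good cubes increase; by the local hypothesis they exhaust `U`. On
  -- each `T k` the identity is summed over disjoint cubes.
  let good : ℕ → (Fin n → ℤ × ℤ) → Prop := fun k q =>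
    ∀ A : Fin n → Set ℂ, (∀ i, MeasurableSet (A i)) → (∀ i, A i ⊆ dyadicIndex k ⁻¹' {q i}) →
      ∫⁻ ω, ∏ i, zeroCount f (A i) ω ∂P = ∫⁻ a in Set.univ.pi A, ρ a
  let T : ℕ → Set (Fin n → ℂ) := fun k => {z | good k (idx k z)}
  have hidx : ∀ k, Measurable (idx k) := fun k =>
    measurable_pi_lambda _ fun i => (measurable_dyadicIndex k).comp (measurable_pi_apply i)
  have hTm : ∀ k, MeasurableSet (T k) := fun k =>
    (hidx k) (MeasurableSet.of_discrete (s := {q | good k q}))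
  have hTmono : Monotone T := fun k l hkl z hz A hA hAq => hz A hA fun i x hx =>
    dyadicIndex_eq_of_le hkl (hAq i hx)
  have hTU : U ⊆ ⋃ k, T k := fun w hw => by
    obtain ⟨r, hr, h⟩ := hloc w hw
    obtain ⟨k, hk⟩ := eventually_two_mul_half_pow_lt hr
    exact Set.mem_iUnion.2 ⟨k, fun A hA hAq => h A hA fun i x hx =>
      (dist_le_of_dyadicIndex_eq (hAq i hx)).trans_lt hk⟩
  let box : ℕ → (Fin n → ℤ × ℤ) → Fin n → Set ℂ := fun k q i => B i ∩ dyadicIndex k ⁻¹' {q i}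
  have hboxm : ∀ k q i, MeasurableSet (box k q i) := fun k q i =>
    (hB i).inter (measurable_dyadicIndex k (measurableSet_singleton _))
  have hbox : ∀ k q, Set.univ.pi B ∩ idx k ⁻¹' {q} = Set.univ.pi (box k q) := fun k q => by
    ext z
    simp only [Set.mem_inter_iff, Set.mem_univ_pi, Set.mem_preimage, Set.mem_singleton_iff,
      funext_iff, idx, box]
    exact forall_and.symm
  have hpiB : MeasurableSet (Set.univ.pi B) := MeasurableSet.univ_pi hB
  have hcover : Set.univ.pi B = ⋃ k, Set.univ.pi B ∩ T k := by
    rw [← Set.inter_iUnion, Set.inter_eq_left.2 (hBU.trans hTU)]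
  have hmonoB : Monotone fun k => Set.univ.pi B ∩ T k := fun k l hkl =>
    Set.inter_subset_inter_right _ (hTmono hkl)
  let m : Measure (Fin n → ℂ) := volume.withDensity ρ
  have hm : ∀ S, MeasurableSet S → m S = ∫⁻ a in S, ρ a := fun S hS => withDensity_apply _ hS
  -- the number of tuples of zeros in the good part
  let c : ℕ → Ω → ℝ≥0∞ := fun k ω => ∑' q, if good k q then ∏ i, zeroCount f (box k q i) ω else 0
  have hsplit : ∀ k q, (Set.univ.pi B ∩ T k) ∩ idx k ⁻¹' {q} =
      if good k q then Set.univ.pi (box k q) else ∅ := fun k q => by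
    rw [Set.inter_right_comm, hbox]
    split_ifs with h
    · refine Set.inter_eq_left.2 fun z hz => ?_
      have : idx k z = q := ((hbox k q).symm ▸ hz : z ∈ Set.univ.pi B ∩ idx k ⁻¹' {q}).2
      simpa only [T, Set.mem_ofPred_eq, this] using h
    · refine Set.eq_empty_of_forall_notMem fun z hz => h ?_
      have : idx k z = q := ((hbox k q).symm ▸ hz.1 : z ∈ Set.univ.pi B ∩ idx k ⁻¹' {q}).2
      simpa only [T, Set.mem_ofPred_eq, this] using hz.2
  have hc : ∀ k ω, c k ω = ((((Set.univ.pi B ∩ T k) ∩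
      {z | ∀ i, z i ∈ disk ∧ f (z i) ω = 0}).encard : ℕ∞) : ℝ≥0∞) := fun k ω => by
    rw [encard_eq_tsum_fiber _ (idx k)]
    refine tsum_congr fun q => ?_
    rw [Set.inter_right_comm, hsplit]
    split_ifs with h
    · rw [prod_zeroCount_eq_encard]
    · simp
  have hcm : ∀ k, Measurable (c k) := fun k => Measurable.tsum fun q => by
    split_ifs
    · exact Finset.measurable_fun_prod _ fun i _ => hN _ (hboxm k q i)
    · exact measurable_const
  have hcmono : Monotone c := fun k l hkl ω => by
    simp only [hc]
    exact ENat.toENNReal_mono (Set.encard_le_encard (Set.inter_subset_inter_left _ (hmonoB hkl)))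
  have hsup : ∀ ω, ∏ i, zeroCount f (B i) ω = ⨆ k, c k ω := fun ω => by
    rw [prod_zeroCount_eq_encard]
    simp only [hc]
    rw [← encard_iUnion_of_monotone, ← Set.iUnion_inter, ← hcover]
    exact fun k l hkl => Set.inter_subset_inter_left _ (hmonoB hkl)
  calc ∫⁻ ω, ∏ i, zeroCount f (B i) ω ∂P = ⨆ k, ∫⁻ ω, c k ω ∂P := by
        simp only [hsup]
        exact lintegral_iSup hcm hcmono
    _ = ⨆ k, m (Set.univ.pi B ∩ T k) := by
        refine iSup_congr fun k => ?_
        have h1 : m (Set.univ.pi B ∩ T k) = ∑' q, m ((Set.univ.pi B ∩ T k) ∩ idx k ⁻¹' {q}) := by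
          rw [← measure_iUnion]
          · congr 1; ext x; simp
          · intro p q hpq
            exact Set.disjoint_left.2 fun x hx hy => hpq (hx.2.symm.trans hy.2)
          · exact fun q => (hpiB.inter (hTm k)).inter (hidx k (measurableSet_singleton q))
        rw [h1, lintegral_tsum]
        · refine tsum_congr fun q => ?_
          rw [hsplit]
          split_ifs with h
          · rw [hm _ (MeasurableSet.univ_pi (hboxm k q))]
            exact h _ (hboxm k q) fun i => Set.inter_subset_right
          · simp
        · intro q
          split_ifs
          · exact (Finset.measurable_fun_prod _ fun i _ => hN _ (hboxm k q i)).aemeasurable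
          · exact aemeasurable_const
    _ = m (Set.univ.pi B) := by
        conv_rhs => rw [hcover]
        exact hmonoB.directed_le.measure_iUnion.symm
    _ = _ := hm _ hpiB

/-- Two densities that are continuous at `a`, finite there, and have the same integrals over small
balls around `a` agree at `a`. -/
lemma density_le_of_setLIntegral_ball_le {ρ₁ ρ₂ : (Fin n → ℂ) → ℝ≥0∞} {a : Fin n → ℂ}
    (h₁ : ContinuousAt ρ₁ a) (h₂ : ContinuousAt ρ₂ a) {δ : ℝ} (hδ : 0 < δ)
    (h : ∀ r, 0 < r → r < δ → ∫⁻ x in Metric.ball a r, ρ₁ x ≤ ∫⁻ x in Metric.ball a r, ρ₂ x) :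
    ρ₁ a ≤ ρ₂ a := by
  by_contra! hlt
  obtain ⟨c, hc₂, hc₁⟩ := exists_between hlt
  obtain ⟨d, hd₂, hd₁⟩ := exists_between hc₁
  have hev : ∀ᶠ x in nhds a, d < ρ₁ x ∧ ρ₂ x < c :=
    (h₁.eventually (lt_mem_nhds hd₁)).and (h₂.eventually (gt_mem_nhds hc₂))
  obtain ⟨ε, hε, hball⟩ := Metric.eventually_nhds_iff_ball.1 hev
  have hr : 0 < min ε δ / 2 := by positivity
  have hrε : min ε δ / 2 < ε := by
    have := min_le_left ε δ; linarith [lt_min hε hδ]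
  have hrδ : min ε δ / 2 < δ := by
    have := min_le_right ε δ; linarith [lt_min hε hδ]
  have hsub := Metric.ball_subset_ball (x := a) hrε.le
  have hv0 : volume (Metric.ball a (min ε δ / 2)) ≠ 0 := (Metric.measure_ball_pos _ _ hr).ne'
  have hvt : volume (Metric.ball a (min ε δ / 2)) ≠ ∞ := measure_ball_lt_top.ne
  have h3 := h _ hr hrδ
  have h4 : d * volume (Metric.ball a (min ε δ / 2)) ≤
      c * volume (Metric.ball a (min ε δ / 2)) := by
    rw [← setLIntegral_const, ← setLIntegral_const]
    calc _ ≤ ∫⁻ x in Metric.ball a (min ε δ / 2), ρ₁ x :=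
          setLIntegral_mono' measurableSet_ball fun x hx => (hball x (hsub hx)).1.le
      _ ≤ ∫⁻ x in Metric.ball a (min ε δ / 2), ρ₂ x := h3
      _ ≤ _ := setLIntegral_mono' measurableSet_ball fun x hx => (hball x (hsub hx)).2.le
  rw [ENNReal.mul_le_mul_iff_left hv0 hvt] at h4
  exact absurd h4 (not_le.2 hd₂)

lemma density_eq_of_setLIntegral_ball_eq {ρ₁ ρ₂ : (Fin n → ℂ) → ℝ≥0∞} {a : Fin n → ℂ}
    (h₁ : ContinuousAt ρ₁ a) (h₂ : ContinuousAt ρ₂ a) {δ : ℝ} (hδ : 0 < δ)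
    (h : ∀ r, 0 < r → r < δ → ∫⁻ x in Metric.ball a r, ρ₁ x = ∫⁻ x in Metric.ball a r, ρ₂ x) :
    ρ₁ a = ρ₂ a :=
  le_antisymm (density_le_of_setLIntegral_ball_le h₁ h₂ hδ fun r h1 h2 => (h r h1 h2).le)
    (density_le_of_setLIntegral_ball_le h₂ h₁ hδ fun r h1 h2 => (h r h1 h2).ge)

lemma ball_pi_eq {a : Fin n → ℂ} {r : ℝ} (hr : 0 < r) :
    Metric.ball a r = Set.univ.pi fun i => Metric.ball (a i) r := ball_pi a hr

lemma isOpen_distinctTuples : IsOpen (distinctTuples n) := by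
  have : distinctTuples n = (⋂ i, {a | a i ∈ disk}) ∩
      ⋂ i, ⋂ j, {a : Fin n → ℂ | i = j ∨ a i ≠ a j} := by
    ext a
    simp only [distinctTuples, Set.mem_inter_iff, Set.mem_iInter, Set.mem_ofPred_eq,
      Function.Injective]
    refine and_congr_right fun _ => forall₂_congr fun i j => ?_
    tauto
  rw [this]
  refine (isOpen_iInter_of_finite fun i => isOpen_disk.preimage (continuous_apply i)).inter
    (isOpen_iInter_of_finite fun i => isOpen_iInter_of_finite fun j => ?_)
  by_cases hij : i = j
  · simp [hij]
  · simpa only [hij, false_or] using isOpen_ne_fun (continuous_apply i) (continuous_apply j)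

/-- Near a configuration of distinct points there is a ball, which is a box with disjoint sides. -/
lemma exists_ball_subset_distinctTuples {a : Fin n → ℂ} (ha : a ∈ distinctTuples n) :
    ∃ δ > 0, Metric.ball a δ ⊆ distinctTuples n ∧ ∀ r, 0 < r → r ≤ δ →
      (∀ i, Metric.ball (a i) r ⊆ disk) ∧
      Pairwise fun i j => Disjoint (Metric.ball (a i) r) (Metric.ball (a j) r) := by
  obtain ⟨δ, hδ, hsub⟩ := Metric.isOpen_iff.1 isOpen_distinctTuples a ha
  refine ⟨δ, hδ, hsub, fun r hr hrδ => ?_⟩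
  have hsub' : (Set.univ.pi fun i => Metric.ball (a i) r) ⊆ distinctTuples n :=
    ball_pi_eq hr ▸ (Metric.ball_subset_ball hrδ).trans hsub
  have hupd : ∀ i x, x ∈ Metric.ball (a i) r → ∀ j, j ≠ i → ∀ y ∈ Metric.ball (a j) r,
      Function.update (Function.update a i x) j y ∈ distinctTuples n := fun i x hx j hj y hy => by
    refine hsub' fun l _ => ?_
    by_cases hl : l = j
    · subst hl; simpa using hy
    · rw [Function.update_of_ne hl]
      by_cases hl' : l = i
      · subst hl'; simpa using hx
      · rw [Function.update_of_ne hl']; exact Metric.mem_ball_self hr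
  constructor
  · intro i x hx
    have : Function.update a i x ∈ distinctTuples n := hsub' fun l _ => by
      by_cases hl' : l = i
      · subst hl'; simpa using hx
      · rw [Function.update_of_ne hl']; exact Metric.mem_ball_self hr
    simpa using this.1 i
  · intro i j hij
    refine Set.disjoint_left.2 fun x hx hy => ?_
    have := (hupd i x hx j hij.symm x hy).2
    exact hij (this (by simp [hij]))

/-- Small sup-norm balls around a tuple of distinct points are boxes with disjoint sides, so the
defining identity fixes the integrals over them, and continuity then fixes the value at the centre.
-/
lemma IsCorrelationFunction.eqOn {P : Measure Ω} {X : ℂ → Ω → ℂ} {ρ₁ ρ₂ : (Fin n → ℂ) → ℝ≥0}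
    (h₁ : IsCorrelationFunction P X n ρ₁) (h₂ : IsCorrelationFunction P X n ρ₂) :
    Set.EqOn ρ₁ ρ₂ (distinctTuples n) := fun a ha => by
  have hcont : ∀ ρ : (Fin n → ℂ) → ℝ≥0, ContinuousOn ρ (distinctTuples n) →
      ContinuousAt (fun x => (ρ x : ℝ≥0∞)) a := fun ρ hρ =>
    ENNReal.continuous_coe.continuousAt.comp
      (hρ.continuousAt (isOpen_distinctTuples.mem_nhds ha))
  obtain ⟨δ, hδ, -, hball⟩ := exists_ball_subset_distinctTuples ha
  refine ENNReal.coe_injective (density_eq_of_setLIntegral_ball_eq (hcont _ h₁.continuousOn)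
    (hcont _ h₂.continuousOn) hδ fun r hr hrδ => ?_)
  obtain ⟨hd, hdisj⟩ := hball r hr hrδ.le
  rw [ball_pi_eq hr, ← h₁.lintegral_prod_zeroCount _ (fun i => measurableSet_ball) hd hdisj,
    ← h₂.lintegral_prod_zeroCount _ (fun i => measurableSet_ball) hd hdisj]

end Boxes

/-! ### The area formula with multiplicities -/

section Area

variable {E : Type*} [NormedAddCommGroup E] [NormedSpace ℝ E] [FiniteDimensional ℝ E]

lemma exists_injOn_of_det_fderiv_ne_zero {f : E → E} {x : E}
    (hf : HasStrictFDerivAt f (fderiv ℝ f x) x) (hx : (fderiv ℝ f x).det ≠ 0) :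
    ∃ U, IsOpen U ∧ x ∈ U ∧ Set.InjOn f U := by
  have hf' : HasStrictFDerivAt f
      (((fderiv ℝ f x).toContinuousLinearEquivOfDetNeZero hx : E ≃L[ℝ] E) : E →L[ℝ] E) x := by
    simpa using hf
  refine ⟨(hf'.toOpenPartialHomeomorph f).source, (hf'.toOpenPartialHomeomorph f).open_source,
    hf'.mem_toOpenPartialHomeomorph_source, ?_⟩
  exact (hf'.toOpenPartialHomeomorph f).injOn

variable [MeasurableSpace E] [BorelSpace E] (μ : Measure E) [μ.IsAddHaarMeasure]

/-- The inverse function theorem and the Lindelöf property split `s` into countably many disjoint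
pieces on which `f` is injective. The fibre count is the sum of the indicators of their images, and
the change of variables formula applies to each piece. -/
lemma lintegral_encard_fiber_mul_of_det_ne_zero {f : E → E} {s : Set E} (hs : MeasurableSet s)
    (hf : ∀ x ∈ s, HasStrictFDerivAt f (fderiv ℝ f x) x) (hdet : ∀ x ∈ s, (fderiv ℝ f x).det ≠ 0)
    {g : E → ℝ≥0∞} (hg : Measurable g) :
    ∫⁻ y, (({x ∈ s | f x = y}.encard : ℕ∞) : ℝ≥0∞) * g y ∂μ =
      ∫⁻ x in s, ENNReal.ofReal |(fderiv ℝ f x).det| * g (f x) ∂μ := by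
  rcases s.eq_empty_or_nonempty with rfl | hne
  · simp
  choose! U hUo hUx hUi using fun x hx => exists_injOn_of_det_fderiv_ne_zero (hf x hx) (hdet x hx)
  obtain ⟨t, hts, htc, hcov⟩ := TopologicalSpace.countable_cover_nhdsWithin
    (s := s) (f := U) fun x hx => mem_nhdsWithin_of_mem_nhds ((hUo x hx).mem_nhds (hUx x hx))
  have htne : t.Nonempty := by
    obtain ⟨x, hx⟩ := hne
    obtain ⟨y, hy, -⟩ := Set.mem_iUnion₂.1 (hcov hx)
    exact ⟨y, hy⟩
  obtain ⟨e, rfl⟩ := htc.exists_eq_range htne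
  let D : ℕ → Set E := fun k => s ∩ disjointed (fun k => U (e k)) k
  have hes : ∀ k, e k ∈ s := fun k => hts ⟨k, rfl⟩
  have hDs : ∀ k, D k ⊆ s := fun k => Set.inter_subset_left
  have hDm : ∀ k, MeasurableSet (D k) := fun k =>
    hs.inter (MeasurableSet.disjointed (fun k => (hUo _ (hes k)).measurableSet) k)
  have hDi : ∀ k, Set.InjOn f (D k) := fun k =>
    (hUi _ (hes k)).mono (Set.inter_subset_right.trans (disjointed_subset _ _))
  have hDd : Pairwise fun i j => Disjoint (D i) (D j) := fun i j hij =>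
    (disjoint_disjointed (fun k => U (e k)) hij).mono Set.inter_subset_right Set.inter_subset_right
  have hDU : ⋃ k, D k = s := by
    rw [← Set.inter_iUnion, iUnion_disjointed]
    exact Set.inter_eq_left.2 (by simpa [Set.biUnion_range] using hcov)
  have hder : ∀ k, ∀ x ∈ D k, HasFDerivWithinAt f (fderiv ℝ f x) (D k) x := fun k x hx =>
    (hf x (hDs k hx)).hasFDerivAt.hasFDerivWithinAt
  have him : ∀ k, MeasurableSet (f '' D k) := fun k =>
    measurable_image_of_fderivWithin (hDm k) (hder k) (hDi k)
  have hcount : ∀ y, (({x ∈ s | f x = y}.encard : ℕ∞) : ℝ≥0∞) * g y =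
      ∑' k, (f '' D k).indicator g y := fun y => by
    let _ : MeasurableSpace E := ⊤
    have hE : ∀ T : Set E, ((T.encard : ℕ∞) : ℝ≥0∞) = Measure.count T := fun T =>
      (Measure.count_apply MeasurableSpace.measurableSet_top).symm
    have hU : {x ∈ s | f x = y} = ⋃ k, {x ∈ D k | f x = y} := by
      ext x
      simp only [Set.mem_ofPred_eq, Set.mem_iUnion, ← hDU]
      exact ⟨fun ⟨⟨k, h1⟩, h2⟩ => ⟨k, h1, h2⟩, fun ⟨k, h1, h2⟩ => ⟨⟨k, h1⟩, h2⟩⟩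
    rw [hE, hU, measure_iUnion, ← ENNReal.tsum_mul_right]
    · refine tsum_congr fun k => ?_
      rw [← hE]
      by_cases hy : y ∈ f '' D k
      · obtain ⟨x, hx, rfl⟩ := hy
        have : {z ∈ D k | f z = f x} = {x} := by
          ext z
          exact ⟨fun h => hDi k h.1 hx h.2, fun h => by
            rw [Set.mem_singleton_iff.1 h]; exact ⟨hx, rfl⟩⟩
        rw [this, Set.indicator_of_mem (Set.mem_image_of_mem f hx)]
        simp
      · have : {z ∈ D k | f z = y} = ∅ :=
          Set.eq_empty_of_forall_notMem fun z hz => hy ⟨z, hz.1, hz.2⟩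
        rw [this, Set.indicator_of_notMem hy]
        simp
    · exact fun i j hij => (hDd hij).mono (Set.sep_subset _ _) (Set.sep_subset _ _)
    · exact fun _ => MeasurableSpace.measurableSet_top
  calc _ = ∫⁻ y, ∑' k, (f '' D k).indicator g y ∂μ := lintegral_congr hcount
    _ = ∑' k, ∫⁻ y, (f '' D k).indicator g y ∂μ :=
        lintegral_tsum fun k => (hg.indicator (him k)).aemeasurable
    _ = ∑' k, ∫⁻ x in D k, ENNReal.ofReal |(fderiv ℝ f x).det| * g (f x) ∂μ := by
        refine tsum_congr fun k => ?_
        rw [lintegral_indicator (him k)]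
        exact lintegral_image_eq_lintegral_abs_det_fderiv_mul μ (hDm k) (hder k) (hDi k) g
    _ = _ := by rw [← lintegral_iUnion hDm hDd, hDU]

/-- **Area formula** for a map that is strictly differentiable at the points of `s`. -/
theorem lintegral_encard_fiber_mul {f : E → E} {s : Set E} (hs : MeasurableSet s)
    (hf : ∀ x ∈ s, HasStrictFDerivAt f (fderiv ℝ f x) x) {g : E → ℝ≥0∞} (hg : Measurable g) :
    ∫⁻ y, (({x ∈ s | f x = y}.encard : ℕ∞) : ℝ≥0∞) * g y ∂μ =
      ∫⁻ x in s, ENNReal.ofReal |(fderiv ℝ f x).det| * g (f x) ∂μ := by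
  let A : Set E := {x | (fderiv ℝ f x).det = 0}
  have hA : MeasurableSet A :=
    (ContinuousLinearMap.continuous_det.measurable.comp (measurable_fderiv ℝ f))
      (measurableSet_singleton 0)
  -- Sard: critical points have a null image, so they do not affect the left side; on the right the
  -- Jacobian factor vanishes on them.
  have hnull : μ (f '' (s ∩ A)) = 0 :=
    addHaar_image_eq_zero_of_det_fderivWithin_eq_zero μ
      (fun x hx => (hf x hx.1).hasFDerivAt.hasFDerivWithinAt) fun x hx => hx.2
  have h1 : ∫⁻ y, (({x ∈ s | f x = y}.encard : ℕ∞) : ℝ≥0∞) * g y ∂μ =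
      ∫⁻ y, (({x ∈ s \ A | f x = y}.encard : ℕ∞) : ℝ≥0∞) * g y ∂μ := by
    refine lintegral_congr_ae ?_
    filter_upwards [compl_mem_ae_iff.2 hnull] with y hy
    congr 3
    ext x
    exact ⟨fun h => ⟨⟨h.1, fun hxA => hy ⟨x, ⟨h.1, hxA⟩, h.2⟩⟩, h.2⟩, fun h => ⟨h.1.1, h.2⟩⟩
  have h2 : ∫⁻ x in s ∩ A, ENNReal.ofReal |(fderiv ℝ f x).det| * g (f x) ∂μ = 0 := by
    rw [setLIntegral_congr_fun (g := fun _ => 0) (hs.inter hA)]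
    · simp
    · intro x hx
      simp [show (fderiv ℝ f x).det = 0 from hx.2]
  rw [h1, lintegral_encard_fiber_mul_of_det_ne_zero μ (hs.diff hA) (fun x hx => hf x hx.1)
    (fun x hx => hx.2) hg, ← lintegral_inter_add_sdiff _ s hA, h2, zero_add]

end Area

section ComplexArea

variable {n : ℕ}

/-- The real determinant of a complex-linear map is the field norm from `ℂ` to `ℝ` of its complex
determinant. -/
lemma det_restrictScalars_complex (L : (Fin n → ℂ) →L[ℂ] (Fin n → ℂ)) :
    (L.restrictScalars ℝ).det = ‖L.det‖ ^ 2 := by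
  have : (L.restrictScalars ℝ).det =
      ((L : (Fin n → ℂ) →ₗ[ℂ] (Fin n → ℂ)).restrictScalars ℝ).det := rfl
  rw [this, LinearMap.det_restrictScalars, Algebra.norm_complex_eq]
  exact Complex.normSq_eq_norm_sq _

/-- **Area formula** for a holomorphic map of `ℂⁿ`. -/
theorem lintegral_encard_fiber_mul_complex {f : (Fin n → ℂ) → (Fin n → ℂ)} {s : Set (Fin n → ℂ)}
    (hs : MeasurableSet s) (hf : ∀ x ∈ s, ContDiffAt ℂ 1 f x)
    {g : (Fin n → ℂ) → ℝ≥0∞} (hg : Measurable g) :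
    ∫⁻ y, (({x ∈ s | f x = y}.encard : ℕ∞) : ℝ≥0∞) * g y =
      ∫⁻ x in s, ENNReal.ofReal (‖(fderiv ℂ f x).det‖ ^ 2) * g (f x) := by
  have hd : ∀ x ∈ s, fderiv ℝ f x = (fderiv ℂ f x).restrictScalars ℝ := fun x hx =>
    ((hf x hx).differentiableAt one_ne_zero).fderiv_restrictScalars ℝ
  rw [lintegral_encard_fiber_mul volume hs _ hg]
  · refine setLIntegral_congr_fun hs fun x hx => ?_
    rw [hd x hx, det_restrictScalars_complex, abs_of_nonneg (by positivity)]
  · intro x hx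
    rw [hd x hx]
    exact ((hf x hx).hasStrictFDerivAt one_ne_zero).restrictScalars ℝ

/-! ### The Kac-Rice formula for a holomorphic function plus a linear combination -/

/-- The matrix `(h_j(z_i))`. -/
def evalMatrix (h : Fin n → ℂ → ℂ) (z : Fin n → ℂ) : Matrix (Fin n) (Fin n) ℂ :=
  Matrix.of fun i j => h j (z i)

/-- The coefficients `u` for which `y + ∑ u_j h_j` vanishes at `z_1, …, z_n`. -/
def zeroCoeff (h : Fin n → ℂ → ℂ) (y : ℂ → ℂ) (z : Fin n → ℂ) : Fin n → ℂ :=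
  -((evalMatrix h z)⁻¹.mulVec fun i => y (z i))

/-- Vanishing at all the `z i` is a linear system for `u`. Hence the fibre of `zeroCoeff h y` over
`u` consists of the zero tuples of y + ∑ u_j h_j, and the area formula can count them. -/
lemma eq_zeroCoeff_iff {h : Fin n → ℂ → ℂ} {y : ℂ → ℂ} {z : Fin n → ℂ}
    (hz : (evalMatrix h z).det ≠ 0) (u : Fin n → ℂ) :
    zeroCoeff h y z = u ↔ ∀ i, y (z i) + ∑ j, u j * h j (z i) = 0 := by
  have hu : IsUnit (evalMatrix h z).det := hz.isUnit
  have hmul : ∀ i, ∑ j, u j * h j (z i) = (evalMatrix h z).mulVec u i := fun i => by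
    simp only [Matrix.mulVec, dotProduct, evalMatrix, Matrix.of_apply, mul_comm]
  simp only [hmul]
  constructor
  · rintro rfl i
    rw [zeroCoeff, Matrix.mulVec_neg, Matrix.mulVec_mulVec, Matrix.mul_nonsing_inv _ hu]
    simp
  · intro H
    have : (fun i => y (z i)) = -(evalMatrix h z).mulVec u := funext fun i => by
      simpa using eq_neg_of_add_eq_zero_left (H i)
    rw [zeroCoeff, this, Matrix.mulVec_neg, neg_neg, Matrix.mulVec_mulVec,
      Matrix.nonsing_inv_mul _ hu, Matrix.one_mulVec]

lemma contDiffAt_det {E : Type*} [NormedAddCommGroup E] [NormedSpace ℂ E]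
    {A : E → Matrix (Fin n) (Fin n) ℂ} {x : E}
    (hA : ∀ i j, ContDiffAt ℂ 1 (fun x => A x i j) x) : ContDiffAt ℂ 1 (fun x => (A x).det) x := by
  simp only [Matrix.det_apply]
  exact ContDiffAt.sum fun σ _ => (contDiffAt_prod fun i _ => hA _ _).const_smul _

lemma contDiffAt_comp_apply {y : ℂ → ℂ} {z : Fin n → ℂ} (i : Fin n)
    (hy : AnalyticAt ℂ y (z i)) : ContDiffAt ℂ 1 (fun z : Fin n → ℂ => y (z i)) z :=
  ContDiffAt.comp z (g := y) hy.contDiffAt (contDiff_apply ℂ ℂ i).contDiffAt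

lemma contDiffAt_zeroCoeff {h : Fin n → ℂ → ℂ} {y : ℂ → ℂ} {z : Fin n → ℂ}
    (hz : (evalMatrix h z).det ≠ 0) (hy : ∀ i, AnalyticAt ℂ y (z i))
    (hh : ∀ i j, AnalyticAt ℂ (h j) (z i)) : ContDiffAt ℂ 1 (zeroCoeff h y) z := by
  have hM : ∀ i j, ContDiffAt ℂ 1 (fun z => evalMatrix h z i j) z := fun i j =>
    contDiffAt_comp_apply i (hh i j)
  have hadj : ∀ i j, ContDiffAt ℂ 1 (fun z => (evalMatrix h z).adjugate i j) z := fun i j => by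
    simp only [Matrix.adjugate_apply]
    refine contDiffAt_det fun k l => ?_
    simp only [Matrix.updateRow_apply]
    split_ifs
    · exact contDiffAt_const
    · exact hM k l
  refine contDiffAt_pi.2 fun i => ?_
  simp only [zeroCoeff, Pi.neg_apply, Matrix.mulVec, dotProduct, Matrix.inv_def, Matrix.smul_apply,
    Ring.inverse_eq_inv', smul_eq_mul]
  exact (ContDiffAt.sum fun j _ => (((contDiffAt_det hM).inv hz).mul (hadj i j)).mul
    (contDiffAt_comp_apply j (hy j))).neg

/-- The derivative of the solution `z ↦ u(z)` of `y(z_i) + ∑ u_j h_j(z_i) = 0`. -/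
lemma det_fderiv_zeroCoeff {h : Fin n → ℂ → ℂ} {y : ℂ → ℂ} {z : Fin n → ℂ}
    (hz : (evalMatrix h z).det ≠ 0) (hy : ∀ i, AnalyticAt ℂ y (z i))
    (hh : ∀ i j, AnalyticAt ℂ (h j) (z i)) :
    ‖(fderiv ℂ (zeroCoeff h y) z).det‖ ^ 2 =
      (∏ i, ‖deriv y (z i) + ∑ j, deriv (h j) (z i) * zeroCoeff h y z j‖ ^ 2) /
        ‖(evalMatrix h z).det‖ ^ 2 := by
  have hM : ∀ i j, ContDiffAt ℂ 1 (fun z => evalMatrix h z i j) z := fun i j =>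
    contDiffAt_comp_apply i (hh i j)
  have hΦ := ((contDiffAt_zeroCoeff hz hy hh).differentiableAt one_ne_zero).hasFDerivAt
  set D := fderiv ℂ (zeroCoeff h y) z
  have hΦj : ∀ j, HasFDerivAt (fun x => zeroCoeff h y x j)
      ((ContinuousLinearMap.proj j).comp D) z := fun j => (hasFDerivAt_pi'.1 hΦ) j
  have hcomp : ∀ {f : ℂ → ℂ} (i : Fin n), AnalyticAt ℂ f (z i) →
      HasFDerivAt (fun x : Fin n → ℂ => f (x i))
        (deriv f (z i) • (ContinuousLinearMap.proj i : (Fin n → ℂ) →L[ℂ] ℂ)) z := fun i hf =>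
    hf.differentiableAt.hasDerivAt.comp_hasFDerivAt z
      (ContinuousLinearMap.proj (R := ℂ) (φ := fun _ : Fin n => ℂ) i).hasFDerivAt
  have hev : ∀ᶠ x in nhds z, (evalMatrix h x).det ≠ 0 :=
    (contDiffAt_det hM).continuousAt.eventually_ne hz
  have hder : ∀ i, HasFDerivAt (fun x => y (x i) + ∑ j, zeroCoeff h y x j * h j (x i))
      (0 : (Fin n → ℂ) →L[ℂ] ℂ) z := fun i => by
    refine (hasFDerivAt_const (0 : ℂ) z).congr_of_eventuallyEq ?_
    filter_upwards [hev] with x hx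
    exact (eq_zeroCoeff_iff hx _).1 rfl i
  let c : Fin n → ℂ := fun i => deriv y (z i) + ∑ j, deriv (h j) (z i) * zeroCoeff h y z j
  -- Implicit differentiation of y(x_i) + ∑ u_j(x) h_j(x_i) = 0. The i-th equation depends on x_i
  -- alone apart from u, so the derivative of u is -M⁻¹ times a diagonal matrix, where M =
  -- `evalMatrix h z`.
  have hD : ∀ v i, (evalMatrix h z).mulVec (D v) i = -(c i * v i) := fun v i => by
    have h1 := (hcomp i (hy i)).add (HasFDerivAt.fun_sum (u := Finset.univ) fun j _ =>
      (hΦj j).mul (hcomp i (hh i j)))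
    have h2 := congrArg (fun L => L v) (h1.unique (hder i))
    simp only [add_apply, smul_apply,
      ContinuousLinearMap.proj_apply, sum_apply, ContinuousLinearMap.comp_apply,
      zero_apply, smul_eq_mul, Finset.sum_add_distrib] at h2
    simp only [Matrix.mulVec, dotProduct, evalMatrix, Matrix.of_apply, c, add_mul, Finset.sum_mul]
    rw [← sub_eq_zero, ← h2]
    rw [sub_neg_eq_add, add_comm, add_assoc]
    congr 2
    exact Finset.sum_congr rfl fun j _ => by ring
  have hmat : evalMatrix h z * LinearMap.toMatrix' (D : (Fin n → ℂ) →ₗ[ℂ] (Fin n → ℂ)) =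
      -Matrix.diagonal c := by
    refine Matrix.toLin'.injective (LinearMap.ext fun v => funext fun i => ?_)
    rw [Matrix.toLin'_mul, LinearMap.comp_apply, Matrix.toLin'_toMatrix', Matrix.toLin'_apply,
      Matrix.toLin'_apply]
    refine (hD v i).trans ?_
    simp [Matrix.mulVec_diagonal]
  have hdet := congrArg (fun A : Matrix (Fin n) (Fin n) ℂ => ‖A.det‖ ^ 2) hmat
  simp only [Matrix.det_mul, Matrix.det_neg, Matrix.det_diagonal, LinearMap.det_toMatrix',
    norm_mul, norm_pow, norm_neg, norm_one, one_pow, one_mul, norm_prod, mul_pow] at hdet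
  rw [eq_div_iff (by positivity), mul_comm, Finset.prod_pow]
  exact hdet

/-- The integrand of the Kac-Rice formula. -/
def kacRiceDensity (h : Fin n → ℂ → ℂ) (p : (Fin n → ℂ) → ℝ) (y : ℂ → ℂ) (z : Fin n → ℂ) : ℝ :=
  p (zeroCoeff h y z) *
    ((∏ i, ‖deriv y (z i) + ∑ j, deriv (h j) (z i) * zeroCoeff h y z j‖ ^ 2) /
      ‖(evalMatrix h z).det‖ ^ 2)

/-- The exact Kac-Rice formula: averaging the number of zero tuples of `y + ∑ u_j h_j` over the
coefficients `u`. -/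
theorem lintegral_prod_encard_zeros {h : Fin n → ℂ → ℂ} {y : ℂ → ℂ}
    (hy : DifferentiableOn ℂ y disk) (hh : ∀ j, DifferentiableOn ℂ (h j) disk)
    {p : (Fin n → ℂ) → ℝ} (hp : Measurable p) {B : Fin n → Set ℂ}
    (hB : ∀ i, MeasurableSet (B i)) (hBd : ∀ i, B i ⊆ disk)
    (hdet : ∀ z ∈ Set.univ.pi B, (evalMatrix h z).det ≠ 0) :
    ∫⁻ u, ENNReal.ofReal (p u) *
      ∏ i, (({z ∈ B i ∩ disk | y z + ∑ j, u j * h j z = 0}.encard : ℕ∞) : ℝ≥0∞) =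
      ∫⁻ z in Set.univ.pi B, ENNReal.ofReal (kacRiceDensity h p y z) := by
  have hya : ∀ z ∈ Set.univ.pi B, ∀ i, AnalyticAt ℂ y (z i) := fun z hz i =>
    (hy.analyticOnNhd isOpen_disk) _ (hBd i (hz i trivial))
  have hha : ∀ z ∈ Set.univ.pi B, ∀ i j, AnalyticAt ℂ (h j) (z i) := fun z hz i j =>
    ((hh j).analyticOnNhd isOpen_disk) _ (hBd i (hz i trivial))
  have hBm : MeasurableSet (Set.univ.pi B) := MeasurableSet.univ_pi hB
  have harea := lintegral_encard_fiber_mul_complex (f := zeroCoeff h y) hBm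
    (fun z hz => contDiffAt_zeroCoeff (hdet z hz) (hya z hz) (hha z hz))
    (g := fun u => ENNReal.ofReal (p u)) hp.ennreal_ofReal
  have hL : ∀ u, ENNReal.ofReal (p u) *
      ∏ i, (({z ∈ B i ∩ disk | y z + ∑ j, u j * h j z = 0}.encard : ℕ∞) : ℝ≥0∞) =
      (({x ∈ Set.univ.pi B | zeroCoeff h y x = u}.encard : ℕ∞) : ℝ≥0∞) *
        ENNReal.ofReal (p u) := fun u => by
    rw [mul_comm]
    congr 1
    have : {x ∈ Set.univ.pi B | zeroCoeff h y x = u} =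
        Set.univ.pi fun i => {z ∈ B i ∩ disk | y z + ∑ j, u j * h j z = 0} := by
      ext x
      constructor
      · intro hx i _
        exact ⟨⟨hx.1 i trivial, hBd i (hx.1 i trivial)⟩,
          (eq_zeroCoeff_iff (hdet x hx.1) u).1 hx.2 i⟩
      · intro hx
        have hxB : x ∈ Set.univ.pi B := fun i _ => (hx i trivial).1.1
        exact ⟨hxB, (eq_zeroCoeff_iff (hdet x hxB) u).2 fun i => (hx i trivial).2⟩
    rw [this, Set.encard_pi_eq_prod_encard]
    exact (map_prod ENat.toENNRealRingHom _ _).symm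
  rw [lintegral_congr hL, harea]
  refine setLIntegral_congr_fun hBm fun z hz => ?_
  rw [det_fderiv_zeroCoeff (hdet z hz) (hya z hz) (hha z hz), ← ENNReal.ofReal_mul (by positivity),
    kacRiceDensity, mul_comm]

end ComplexArea

/-! ### The standard complex Gaussian law -/

/-- The density `e^{-|z|²} / π`. -/
def stdDensity (z : ℂ) : ℝ := Real.exp (-‖z‖ ^ 2) / Real.pi

/-- The standard complex Gaussian law on `ℂ`. -/
def stdComplexGaussian : Measure ℂ := volume.withDensity fun z => ENNReal.ofReal (stdDensity z)

lemma stdDensity_nonneg (z : ℂ) : 0 ≤ stdDensity z := by unfold stdDensity; positivity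

lemma continuous_stdDensity : Continuous stdDensity := by unfold stdDensity; fun_prop

/-- Real and imaginary parts are independent with variance 1/2, so that E|z|² = 1. This
factorization is the source of the `IsGaussian` instance. -/
lemma stdComplexGaussian_eq_map :
    stdComplexGaussian = ((gaussianReal 0 (1 / 2)).prod (gaussianReal 0 (1 / 2))).map
      Complex.measurableEquivRealProd.symm := by
  have hv : (1 / 2 : ℝ≥0) ≠ 0 := by norm_num
  rw [gaussianReal_of_var_ne_zero 0 hv, prod_withDensity (measurable_gaussianPDF _ _)
    (measurable_gaussianPDF _ _), ← Measure.volume_eq_prod,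
    ← Complex.volume_preserving_equiv_real_prod.map_eq]
  ext s hs
  have hg : Measurable fun a : ℝ × ℝ => gaussianPDF 0 (1 / 2) a.1 * gaussianPDF 0 (1 / 2) a.2 :=
    ((measurable_gaussianPDF _ _).comp measurable_fst).mul
      ((measurable_gaussianPDF _ _).comp measurable_snd)
  have hm : Measurable Complex.measurableEquivRealProd := Complex.measurableEquivRealProd.measurable
  rw [Measure.map_apply Complex.measurableEquivRealProd.symm.measurable hs,
    withDensity_apply _ (Complex.measurableEquivRealProd.symm.measurable hs),
    setLIntegral_map (Complex.measurableEquivRealProd.symm.measurable hs) hg hm,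
    stdComplexGaussian, withDensity_apply _ hs]
  have hpre : Complex.measurableEquivRealProd ⁻¹'
      (Complex.measurableEquivRealProd.symm ⁻¹' s) = s := by
    rw [← Set.preimage_comp]; simp
  rw [hpre]
  refine lintegral_congr fun z => ?_
  simp only [gaussianPDF, Complex.measurableEquivRealProd_apply]
  rw [← ENNReal.ofReal_mul (gaussianPDFReal_nonneg _ _ _)]
  congr 1
  simp only [gaussianPDFReal, stdDensity, ← Complex.normSq_eq_norm_sq, Complex.normSq_apply]
  have h1 : 2 * Real.pi * ((1 / 2 : ℝ≥0) : ℝ) = Real.pi := by push_cast; ring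
  have h2 : 2 * ((1 / 2 : ℝ≥0) : ℝ) = 1 := by push_cast; ring
  rw [h1, h2, mul_mul_mul_comm, ← Real.exp_add, ← mul_inv, Real.mul_self_sqrt Real.pi_pos.le]
  rw [div_eq_inv_mul]
  congr 2
  ring

instance : IsGaussian stdComplexGaussian := by
  have h1 : HasGaussianLaw (fun p : ℝ × ℝ => (p.1, p.2))
      ((gaussianReal 0 (1 / 2)).prod (gaussianReal 0 (1 / 2))) := by
    refine IndepFun.hasGaussianLaw ⟨?_⟩ ⟨?_⟩ (indepFun_prod measurable_id measurable_id)
    · rw [Measure.map_fst_prod, measure_univ, one_smul]; infer_instance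
    · rw [Measure.map_snd_prod, measure_univ, one_smul]; infer_instance
  have h2 := h1.map (Complex.equivRealProdCLM.symm : ℝ × ℝ →L[ℝ] ℂ)
  rw [stdComplexGaussian_eq_map]
  exact h2.isGaussian_map

lemma integral_stdComplexGaussian (g : ℂ → ℂ) :
    ∫ z, g z ∂stdComplexGaussian = ∫ z, stdDensity z • g z := by
  rw [stdComplexGaussian, integral_withDensity_eq_integral_toReal_smul
    continuous_stdDensity.measurable.ennreal_ofReal (by simp)]
  simp only [ENNReal.toReal_ofReal (stdDensity_nonneg _)]

lemma integrable_pow_mul_conj_pow (a b : ℕ) :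
    Integrable (fun z : ℂ => z ^ a * (starRingEnd ℂ) z ^ b) stdComplexGaussian := by
  rcases Nat.eq_zero_or_pos (a + b) with h | h
  · obtain ⟨rfl, rfl⟩ : a = 0 ∧ b = 0 := by omega
    simp
  · have := (IsGaussian.memLp_id stdComplexGaussian ((a + b : ℕ) : ℝ≥0∞)
      (ENNReal.natCast_ne_top _)).integrable_norm_pow h.ne'
    refine this.mono' (by fun_prop) (Filter.Eventually.of_forall fun z => ?_)
    simp [pow_add]

/-- The integrand is radial, and the integral reduces to Γ(a + 1). -/
lemma integral_pow_mul_conj_pow_self (a : ℕ) :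
    ∫ z, z ^ a * (starRingEnd ℂ) z ^ a ∂stdComplexGaussian = (a.factorial : ℂ) := by
  have h := Complex.integral_rpow_mul_exp_neg_rpow (p := 2) (q := 2 * a) (by norm_num)
    (by have : (0 : ℝ) ≤ a := a.cast_nonneg
        linarith)
  rw [integral_stdComplexGaussian]
  have h2 : ∀ z : ℂ, stdDensity z • (z ^ a * (starRingEnd ℂ) z ^ a) =
      ((Real.pi⁻¹ * (‖z‖ ^ (2 * (a : ℝ)) * Real.exp (-‖z‖ ^ (2 : ℝ))) : ℝ) : ℂ) := fun z => by
    rw [← mul_pow, Complex.mul_conj, Complex.normSq_eq_norm_sq, stdDensity, Complex.real_smul]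
    rw [show (2 * (a : ℝ)) = ((2 * a : ℕ) : ℝ) by push_cast; ring, Real.rpow_natCast,
      show (2 : ℝ) = ((2 : ℕ) : ℝ) by norm_num, Real.rpow_natCast]
    push_cast
    rw [pow_mul]
    ring
  simp only [h2]
  rw [integral_complex_ofReal, integral_const_mul, h]
  have : (2 * (a : ℝ) + 2) / 2 = a + 1 := by ring
  rw [this, Real.Gamma_nat_eq_factorial]
  have hpi := Real.pi_ne_zero
  push_cast
  field_simp

/-- Rotation by the angle π/(a - b) preserves the Gaussian law and changes the sign of the
integrand. -/
lemma integral_pow_mul_conj_pow_of_ne {a b : ℕ} (hab : a ≠ b) :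
    ∫ z, z ^ a * (starRingEnd ℂ) z ^ b ∂stdComplexGaussian = 0 := by
  have hne : (a : ℝ) - b ≠ 0 := sub_ne_zero.2 (Nat.cast_injective.ne hab)
  let c : Circle := Circle.exp (Real.pi / ((a : ℝ) - b))
  have hc : (c : ℂ) ^ a * (starRingEnd ℂ) (c : ℂ) ^ b = -1 := by
    simp only [c, Circle.coe_exp, ← Complex.exp_conj, ← Complex.exp_nat_mul, ← Complex.exp_add]
    rw [← Complex.exp_pi_mul_I]
    congr 1
    simp only [map_mul, Complex.conj_ofReal, Complex.conj_I]
    have : ((a : ℂ) - b) ≠ 0 := by exact_mod_cast hne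
    push_cast
    field_simp
    ring
  rw [integral_stdComplexGaussian]
  set I := ∫ z, stdDensity z • (z ^ a * (starRingEnd ℂ) z ^ b) with hI
  have h := (rotation c).measurePreserving.integral_comp
    (rotation c).toHomeomorph.measurableEmbedding
    (fun z : ℂ => stdDensity z • (z ^ a * (starRingEnd ℂ) z ^ b))
  have h2 : ∀ z : ℂ, stdDensity (rotation c z) •
      (rotation c z ^ a * (starRingEnd ℂ) (rotation c z) ^ b) =
      -(stdDensity z • (z ^ a * (starRingEnd ℂ) z ^ b)) := fun z => by
    have : stdDensity (rotation c z) = stdDensity z := by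
      simp only [stdDensity, LinearIsometryEquiv.norm_map]
    rw [this, rotation_apply, map_mul, mul_pow, mul_pow, mul_mul_mul_comm, hc, neg_one_mul,
      smul_neg]
  simp only [h2, integral_neg, ← hI] at h
  exact self_eq_neg.1 h.symm

lemma integral_pow_mul_conj_pow (a b : ℕ) :
    ∫ z, z ^ a * (starRingEnd ℂ) z ^ b ∂stdComplexGaussian =
      if a = b then (a.factorial : ℂ) else 0 := by
  split_ifs with h
  · subst h; exact integral_pow_mul_conj_pow_self a
  · exact integral_pow_mul_conj_pow_of_ne h

/-- The law of `m` independent standard complex Gaussian variables. -/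
abbrev stdComplexGaussianPi (m : ℕ) : Measure (Fin m → ℂ) := Measure.pi fun _ => stdComplexGaussian

/-- The density `∏ e^{-|u_j|²} / π`. -/
def stdDensityPi {m : ℕ} (u : Fin m → ℂ) : ℝ := ∏ j, stdDensity (u j)

lemma stdDensityPi_nonneg {m : ℕ} (u : Fin m → ℂ) : 0 ≤ stdDensityPi u :=
  Finset.prod_nonneg fun _ _ => stdDensity_nonneg _

lemma continuous_stdDensityPi {m : ℕ} : Continuous (stdDensityPi : (Fin m → ℂ) → ℝ) :=
  continuous_finsetProd _ fun j _ => continuous_stdDensity.comp (continuous_apply j)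

lemma integrable_stdDensity : Integrable stdDensity := by
  refine ⟨continuous_stdDensity.aestronglyMeasurable, ?_⟩
  have h : stdComplexGaussian Set.univ = 1 := measure_univ
  rw [stdComplexGaussian, withDensity_apply _ MeasurableSet.univ, Measure.restrict_univ] at h
  rw [HasFiniteIntegral]
  calc ∫⁻ z, ‖stdDensity z‖ₑ = ∫⁻ z, ENNReal.ofReal (stdDensity z) :=
        lintegral_congr fun z => Real.enorm_of_nonneg (stdDensity_nonneg z)
    _ < ∞ := by rw [h]; exact ENNReal.one_lt_top

lemma stdComplexGaussianPi_eq_withDensity (m : ℕ) :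
    stdComplexGaussianPi m = volume.withDensity fun u => ENNReal.ofReal (stdDensityPi u) := by
  refine Measure.pi_eq fun s hs => ?_
  rw [withDensity_apply _ (MeasurableSet.univ_pi hs),
    ← lintegral_indicator (MeasurableSet.univ_pi hs)]
  have hind : ∀ u : Fin m → ℂ, (Set.univ.pi s).indicator
      (fun u => ENNReal.ofReal (stdDensityPi u)) u =
      ENNReal.ofReal (∏ j, (s j).indicator stdDensity (u j)) := fun u => by
    by_cases hu : u ∈ Set.univ.pi s
    · rw [Set.indicator_of_mem hu, stdDensityPi]
      congr 1
      exact Finset.prod_congr rfl fun j _ => (Set.indicator_of_mem (hu j trivial) _).symm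
    · rw [Set.indicator_of_notMem hu]
      obtain ⟨j, hj⟩ : ∃ j, u j ∉ s j := by simpa using hu
      rw [Finset.prod_eq_zero (Finset.mem_univ j) (Set.indicator_of_notMem hj _),
        ENNReal.ofReal_zero]
  have hint : ∀ j, Integrable ((s j).indicator stdDensity) := fun j =>
    integrable_stdDensity.indicator (hs j)
  have hnn : ∀ j x, 0 ≤ (s j).indicator stdDensity x := fun j x =>
    Set.indicator_nonneg (fun x _ => stdDensity_nonneg x) x
  rw [lintegral_congr hind, volume_pi, ← ofReal_integral_eq_lintegral_ofReal
    (Integrable.fintype_prod (f := fun j => (s j).indicator stdDensity) hint)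
    (Filter.Eventually.of_forall fun u => Finset.prod_nonneg fun j _ => hnn j _)]
  have h3 := integral_fintype_prod_eq_prod (𝕜 := ℝ) (fun j => (s j).indicator stdDensity)
    (μ := fun _ => (volume : Measure ℂ))
  rw [h3, ENNReal.ofReal_prod_of_nonneg fun j _ => integral_nonneg (hnn j)]
  refine Finset.prod_congr rfl fun j _ => ?_
  rw [ofReal_integral_eq_lintegral_ofReal (hint j) (Filter.Eventually.of_forall (hnn j)),
    stdComplexGaussian, withDensity_apply _ (hs j), ← lintegral_indicator (hs j)]
  refine lintegral_congr fun x => ?_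
  by_cases hx : x ∈ s j <;> simp [hx]

/-! ### Mixed moments of independent standard complex Gaussians -/

section Moments

variable {n m : ℕ}

/-- These permutations form a coset of the stabilizer of `k`, a product of symmetric groups of the
fibres; the coset is nonempty exactly when the fibres of `j` and `k` have equal sizes. -/
lemma card_perm_comp_eq (j k : Fin n → Fin m) :
    (Fintype.card {σ : Equiv.Perm (Fin n) // k ∘ σ = j}) =
      if ∀ l, Fintype.card {i // j i = l} = Fintype.card {i // k i = l}
      then ∏ l, (Fintype.card {i // k i = l}).factorial else 0 := by
  split_ifs with h
  · have e : ∀ l, {i // j i = l} ≃ {i // k i = l} := fun l => Fintype.equivOfCardEq (h l)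
    let σ₀ : Equiv.Perm (Fin n) := Equiv.ofFiberEquiv e
    have hσ₀ : k ∘ σ₀ = j := funext fun i => Equiv.ofFiberEquiv_map e i
    rw [← DomMulAct.stabilizer_card k]
    refine Fintype.card_congr ((Equiv.mulRight σ₀⁻¹).subtypeEquiv fun σ => ?_)
    simp only [Equiv.coe_mulRight, Equiv.Perm.coe_mul]
    constructor
    · rintro hσ
      rw [← Function.comp_assoc, hσ, ← hσ₀, Function.comp_assoc, ← Equiv.Perm.coe_mul]
      simp
    · intro hσ
      rw [← hσ₀]
      nth_rewrite 2 [← hσ]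
      rw [Function.comp_assoc, Function.comp_assoc, ← Equiv.Perm.coe_mul]
      simp
  · rw [Fintype.card_eq_zero_iff]
    refine ⟨fun ⟨σ, hσ⟩ => h fun l => Fintype.card_congr (σ.subtypeEquiv fun i => ?_)⟩
    rw [← hσ]; rfl

lemma prod_apply_eq_prod_pow {M : Type*} [CommMonoid M] (x : Fin m → M) (j : Fin n → Fin m) :
    ∏ i, x (j i) = ∏ l, x l ^ Fintype.card {i // j i = l} := by
  rw [← Finset.prod_fiberwise Finset.univ j]
  refine Finset.prod_congr rfl fun l _ => ?_
  rw [Fintype.card_subtype, ← Finset.prod_const]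
  exact Finset.prod_congr rfl fun i hi => by rw [(Finset.mem_filter.1 hi).2]

lemma prod_monomial_eq (j k : Fin n → Fin m) (x : Fin m → ℂ) :
    ∏ i, (x (j i) * (starRingEnd ℂ) (x (k i))) =
      ∏ l, (x l ^ Fintype.card {i // j i = l} *
        (starRingEnd ℂ) (x l) ^ Fintype.card {i // k i = l}) := by
  rw [Finset.prod_mul_distrib, Finset.prod_mul_distrib, prod_apply_eq_prod_pow,
    prod_apply_eq_prod_pow (fun l => (starRingEnd ℂ) (x l))]

lemma integrable_prod_monomial (j k : Fin n → Fin m) :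
    Integrable (fun x : Fin m → ℂ => ∏ i, (x (j i) * (starRingEnd ℂ) (x (k i))))
      (stdComplexGaussianPi m) := by
  simp only [prod_monomial_eq]
  exact Integrable.fintype_prod (f := fun l (z : ℂ) => z ^ Fintype.card {i // j i = l} *
        (starRingEnd ℂ) z ^ Fintype.card {i // k i = l})
    fun l => integrable_pow_mul_conj_pow _ _

/-- By independence the moment is a product of factorials, or zero when some multiplicities differ.
Rewriting it as a number of permutations is what produces a permanent in Wick's formula. -/
lemma integral_prod_monomial (j k : Fin n → Fin m) :
    ∫ x : Fin m → ℂ, ∏ i, (x (j i) * (starRingEnd ℂ) (x (k i))) ∂(stdComplexGaussianPi m) =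
      (Fintype.card {σ : Equiv.Perm (Fin n) // k ∘ σ = j} : ℂ) := by
  simp only [prod_monomial_eq]
  rw [integral_fintype_prod_eq_prod (𝕜 := ℂ) (fun l (z : ℂ) => z ^ Fintype.card {i // j i = l} *
        (starRingEnd ℂ) z ^ Fintype.card {i // k i = l}), card_perm_comp_eq]
  simp only [integral_pow_mul_conj_pow]
  split_ifs with h
  · push_cast
    exact Finset.prod_congr rfl fun l _ => by rw [if_pos (h l), h l]
  · push Not at h
    obtain ⟨l, hl⟩ := h
    rw [Finset.prod_eq_zero (Finset.mem_univ l) (if_neg hl), Nat.cast_zero]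

/-- Wick's formula for linear combinations of independent standard complex Gaussians. -/
lemma integral_prod_mulVec_mul_conj (L : Matrix (Fin n) (Fin m) ℂ) :
    ∫ x : Fin m → ℂ, ∏ i, (L.mulVec x i * (starRingEnd ℂ) (L.mulVec x i))
      ∂(stdComplexGaussianPi m) = (L * L.conjTranspose).permanent := by
  have hexp : ∀ x : Fin m → ℂ, ∏ i, (L.mulVec x i * (starRingEnd ℂ) (L.mulVec x i)) =
      ∑ j : Fin n → Fin m, ∑ k : Fin n → Fin m,
        ((∏ i, L i (j i)) * ∏ i, (starRingEnd ℂ) (L i (k i))) *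
          ∏ i, (x (j i) * (starRingEnd ℂ) (x (k i))) := fun x => by
    have h1 : ∏ i, L.mulVec x i = ∑ j : Fin n → Fin m, ∏ i, (L i (j i) * x (j i)) := by
      simp only [Matrix.mulVec, dotProduct]
      rw [Finset.prod_univ_sum, Fintype.piFinset_univ]
    rw [Finset.prod_mul_distrib, ← map_prod, h1, map_sum, Finset.sum_mul_sum]
    refine Finset.sum_congr rfl fun j _ => Finset.sum_congr rfl fun k _ => ?_
    simp only [map_prod, map_mul, Finset.prod_mul_distrib]
    ring
  simp only [hexp]
  rw [integral_finsetSum _ fun j _ => integrable_finsetSum _ fun k _ =>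
    (integrable_prod_monomial j k).const_mul _]
  simp only [integral_finsetSum _ fun k _ => (integrable_prod_monomial _ k).const_mul _,
    integral_const_mul, integral_prod_monomial]
  have hcard : ∀ j k : Fin n → Fin m,
      (Fintype.card {σ : Equiv.Perm (Fin n) // k ∘ σ = j} : ℂ) =
        ∑ σ : Equiv.Perm (Fin n), if k ∘ σ = j then 1 else 0 := fun j k => by
    rw [Fintype.card_subtype, Finset.sum_boole]
  simp only [hcard, Finset.mul_sum, mul_ite, mul_one, mul_zero]
  rw [Finset.sum_comm]
  -- The constraint determines j = k ∘ σ. The remaining sum over `k` factors over the indices into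
  -- entries of L Lᴴ.
  have hswap : ∀ k : Fin n → Fin m, ∑ j : Fin n → Fin m, ∑ σ : Equiv.Perm (Fin n),
      (if k ∘ σ = j then (∏ i, L i (j i)) * ∏ i, (starRingEnd ℂ) (L i (k i)) else 0) =
      ∑ σ : Equiv.Perm (Fin n), ∏ i, (L (σ⁻¹ i) (k i) * (starRingEnd ℂ) (L i (k i))) := fun k => by
    rw [Finset.sum_comm]
    refine Finset.sum_congr rfl fun σ _ => ?_
    rw [Finset.sum_ite_eq, if_pos (Finset.mem_univ _), Finset.prod_mul_distrib]
    congr 1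
    refine Fintype.prod_equiv σ _ _ fun i => ?_
    simp
  simp only [hswap]
  rw [Finset.sum_comm, Matrix.permanent]
  refine Fintype.sum_equiv (Equiv.inv _) _ _ fun σ => ?_
  simp only [Matrix.mul_apply, Matrix.conjTranspose_apply]
  rw [Finset.prod_univ_sum, Fintype.piFinset_univ]
  rfl

end Moments

/-! ### Circularly symmetric Gaussian vectors -/

/-- `G` is a centered circularly symmetric complex Gaussian vector with covariance matrix `Γ`. -/
structure IsCircularGaussian {Ω : Type*} [MeasurableSpace Ω] (P : Measure Ω) {n : ℕ}
    (G : Fin n → Ω → ℂ) (Γ : Matrix (Fin n) (Fin n) ℂ) : Prop where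
  gaussian : HasGaussianLaw (fun ω i => G i ω) P
  mean_zero : ∀ i, ∫ ω, G i ω ∂P = 0
  covariance : ∀ i j, ∫ ω, G i ω * (starRingEnd ℂ) (G j ω) ∂P = Γ i j
  pseudoCovariance : ∀ i j, ∫ ω, G i ω * G j ω ∂P = 0

namespace IsCircularGaussian

variable {Ω : Type*} [MeasurableSpace Ω] {P : Measure Ω} {n m : ℕ} {G : Fin n → Ω → ℂ}
  {Γ : Matrix (Fin n) (Fin n) ℂ}

lemma memLp (hG : IsCircularGaussian P G Γ) (i : Fin n) : MemLp (G i) 2 P :=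
  (hG.gaussian.eval i).memLp_two

lemma integrable (hG : IsCircularGaussian P G Γ) (i : Fin n) : Integrable (G i) P :=
  (hG.gaussian.eval i).integrable

lemma integrable_mul (hG : IsCircularGaussian P G Γ) (i j : Fin n) :
    Integrable (fun ω => G i ω * G j ω) P :=
  (hG.memLp i).integrable_mul (hG.memLp j)

lemma integrable_mul_conj (hG : IsCircularGaussian P G Γ) (i j : Fin n) :
    Integrable (fun ω => G i ω * (starRingEnd ℂ) (G j ω)) P :=
  (hG.memLp i).integrable_mul (hG.memLp j).star

lemma integral_sum_mul_sum (hG : IsCircularGaussian P G Γ) (b c : Fin n → ℂ) :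
    ∫ ω, (∑ i, b i * G i ω) * (∑ j, c j * G j ω) ∂P = 0 := by
  have h : ∀ ω, (∑ i, b i * G i ω) * (∑ j, c j * G j ω) =
      ∑ i, ∑ j, b i * c j * (G i ω * G j ω) := fun ω => by
    rw [Finset.sum_mul_sum]
    exact Finset.sum_congr rfl fun i _ => Finset.sum_congr rfl fun j _ => by ring
  simp only [h]
  rw [integral_finsetSum _ fun i _ => integrable_finsetSum _ fun j _ =>
    (hG.integrable_mul i j).const_mul _]
  simp only [integral_finsetSum _ fun j _ => (hG.integrable_mul _ j).const_mul _,
    integral_const_mul, hG.pseudoCovariance, mul_zero, Finset.sum_const_zero]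

lemma integral_sum_mul_conj_sum (hG : IsCircularGaussian P G Γ) (b c : Fin n → ℂ) :
    ∫ ω, (∑ i, b i * G i ω) * (starRingEnd ℂ) (∑ j, c j * G j ω) ∂P =
      ∑ i, ∑ j, b i * (starRingEnd ℂ) (c j) * Γ i j := by
  have h : ∀ ω, (∑ i, b i * G i ω) * (starRingEnd ℂ) (∑ j, c j * G j ω) =
      ∑ i, ∑ j, b i * (starRingEnd ℂ) (c j) * (G i ω * (starRingEnd ℂ) (G j ω)) := fun ω => by
    rw [map_sum, Finset.sum_mul_sum]
    exact Finset.sum_congr rfl fun i _ => Finset.sum_congr rfl fun j _ => by rw [map_mul]; ring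
  simp only [h]
  rw [integral_finsetSum _ fun i _ => integrable_finsetSum _ fun j _ =>
    (hG.integrable_mul_conj i j).const_mul _]
  simp only [integral_finsetSum _ fun j _ => (hG.integrable_mul_conj _ j).const_mul _,
    integral_const_mul, hG.covariance]

/-- A complex linear image of a circular Gaussian vector is circular Gaussian. -/
lemma mulVec (hG : IsCircularGaussian P G Γ) (A : Matrix (Fin m) (Fin n) ℂ) :
    IsCircularGaussian P (fun k ω => A.mulVec (fun i => G i ω) k) (A * Γ * A.conjTranspose) where
  gaussian := hG.gaussian.map_fun
    ((LinearMap.toContinuousLinearMap (Matrix.mulVecLin A)).restrictScalars ℝ)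
  mean_zero k := by
    simp only [Matrix.mulVec, dotProduct]
    rw [integral_finsetSum _ fun i _ => (hG.integrable i).const_mul _]
    simp only [integral_const_mul, hG.mean_zero, mul_zero, Finset.sum_const_zero]
  covariance k l := by
    simp only [Matrix.mulVec, dotProduct]
    rw [hG.integral_sum_mul_conj_sum]
    simp only [Matrix.mul_apply, Matrix.conjTranspose_apply, Finset.sum_mul]
    rw [Finset.sum_comm]
    exact Finset.sum_congr rfl fun i _ => Finset.sum_congr rfl fun j _ => by
      rw [starRingEnd_apply]; ring
  pseudoCovariance k l := by
    simp only [Matrix.mulVec, dotProduct]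
    exact hG.integral_sum_mul_sum _ _

/-- A real functional is the real part of s = ∑ b_i x_i, and (Re s)² = (Re s² + |s|²)/2. The
pseudo-covariance kills the first term, so only Γ enters, and with it the whole law is determined.
-/
lemma variance_dual (hG : IsCircularGaussian P G Γ) (L : StrongDual ℝ (Fin n → ℂ)) :
    ∫ ω, L (fun i => G i ω) ∂P = 0 ∧
    Var[fun ω => L (fun i => G i ω); P] =
      (∑ i, ∑ j, (L (Pi.single i 1) - L (Pi.single i Complex.I) * Complex.I) *
        (starRingEnd ℂ) (L (Pi.single j 1) - L (Pi.single j Complex.I) * Complex.I) *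
          Γ i j).re / 2 := by
  set b : Fin n → ℂ := fun i => L (Pi.single i 1) - L (Pi.single i Complex.I) * Complex.I with hb
  have hL : ∀ x : Fin n → ℂ, L x = (∑ i, b i * x i).re := fun x => by
    have hx : x = ∑ i, ((x i).re • (Pi.single i 1 : Fin n → ℂ) +
        (x i).im • (Pi.single i Complex.I : Fin n → ℂ)) := by
      funext k
      rw [Finset.sum_apply, Finset.sum_eq_single k]
      · simp [Complex.re_add_im]
      · intro j _ hj
        simp [Pi.single_eq_of_ne hj.symm]
      · simp
    conv_lhs => rw [hx]
    rw [map_sum, Complex.re_sum]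
    refine Finset.sum_congr rfl fun i _ => ?_
    simp [hb]
    ring
  have hmean : ∫ ω, L (fun i => G i ω) ∂P = 0 := by
    simp only [hL]
    have hint : Integrable (fun ω => ∑ i, b i * G i ω) P :=
      integrable_finsetSum _ fun i _ => (hG.integrable i).const_mul _
    have := integral_re hint
    simp only [RCLike.re_eq_complex_re] at this
    rw [this, integral_finsetSum _ fun i _ => (hG.integrable i).const_mul _]
    simp [integral_const_mul, hG.mean_zero]
  refine ⟨hmean, ?_⟩
  have haem : AEMeasurable (fun ω => L (fun i => G i ω)) P :=
    L.continuous.measurable.comp_aemeasurable hG.gaussian.aemeasurable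
  rw [variance_of_integral_eq_zero haem hmean]
  have hsq : ∀ ω, L (fun i => G i ω) ^ 2 =
      (((∑ i, b i * G i ω) * (∑ j, b j * G j ω)).re +
        ((∑ i, b i * G i ω) * (starRingEnd ℂ) (∑ j, b j * G j ω)).re) / 2 := fun ω => by
    rw [hL, Complex.mul_conj, Complex.ofReal_re, Complex.normSq_apply, Complex.mul_re]
    ring
  have hsum : MemLp (fun ω => ∑ i, b i * G i ω) 2 P :=
    memLp_finsetSum _ fun i _ => (hG.memLp i).const_mul _
  have hi1 : Integrable (fun ω => (∑ i, b i * G i ω) * (∑ j, b j * G j ω)) P :=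
    hsum.integrable_mul hsum
  have hi2 : Integrable (fun ω => (∑ i, b i * G i ω) * (starRingEnd ℂ) (∑ j, b j * G j ω)) P :=
    hsum.integrable_mul hsum.star
  have e1 := integral_re hi1
  have e2 := integral_re hi2
  simp only [RCLike.re_eq_complex_re] at e1 e2
  simp only [hsq]
  have r1 : Integrable (fun ω => ((∑ i, b i * G i ω) * (∑ j, b j * G j ω)).re) P := hi1.re
  have r2 : Integrable (fun ω =>
    ((∑ i, b i * G i ω) * (starRingEnd ℂ) (∑ j, b j * G j ω)).re) P := hi2.re
  rw [integral_div, integral_add r1 r2, e1, e2, hG.integral_sum_mul_sum,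
    hG.integral_sum_mul_conj_sum, Complex.zero_re, zero_add]

/-- The law of a circular Gaussian vector is determined by its covariance matrix. -/
theorem map_eq {Ω' : Type*} [MeasurableSpace Ω'] {P' : Measure Ω'} {G' : Fin n → Ω' → ℂ}
    (hG : IsCircularGaussian P G Γ) (hG' : IsCircularGaussian P' G' Γ) :
    P.map (fun ω i => G i ω) = P'.map (fun ω i => G' i ω) := by
  have h1 := hG.gaussian.isGaussian_map
  have h2 := hG'.gaussian.isGaussian_map
  refine Measure.ext_of_charFunDual ?_
  ext L
  rw [hG.gaussian.charFunDual_map_eq_fun, hG'.gaussian.charFunDual_map_eq_fun,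
    (hG.variance_dual L).1, (hG'.variance_dual L).1, (hG.variance_dual L).2,
    (hG'.variance_dual L).2]

open scoped ComplexOrder in
lemma posSemidef (hG : IsCircularGaussian P G Γ) : Γ.PosSemidef := by
  refine Matrix.PosSemidef.of_dotProduct_mulVec_nonneg ?_ fun x => ?_
  · ext i j
    rw [Matrix.conjTranspose_apply, ← hG.covariance, ← hG.covariance, ← starRingEnd_apply,
      ← integral_conj]
    refine integral_congr_ae (Filter.Eventually.of_forall fun ω => ?_)
    simp [mul_comm]
  · have h := hG.integral_sum_mul_conj_sum (star x) (star x)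
    have h2 : star x ⬝ᵥ Γ.mulVec x =
        ∑ i, ∑ j, (star x) i * (starRingEnd ℂ) ((star x) j) * Γ i j := by
      simp only [dotProduct, Matrix.mulVec, Finset.mul_sum]
      refine Finset.sum_congr rfl fun i _ => Finset.sum_congr rfl fun j _ => ?_
      simp only [Pi.star_apply, starRingEnd_apply, star_star]
      ring
    rw [h2, ← h]
    simp only [Complex.mul_conj]
    rw [integral_complex_ofReal]
    exact_mod_cast integral_nonneg fun ω => Complex.normSq_nonneg _

/-- A square root of the positive semidefinite Γ. It realizes the law as a linear image of standard
variables even when Γ is singular, which reduces Wick's formula to the independent case. -/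
lemma exists_eq_mul_conjTranspose (hG : IsCircularGaussian P G Γ) :
    ∃ L : Matrix (Fin n) (Fin n) ℂ, Γ = L * L.conjTranspose := by
  open scoped MatrixOrder ComplexOrder in
  obtain ⟨B, hB⟩ := CStarAlgebra.nonneg_iff_eq_star_mul_self.mp hG.posSemidef.nonneg
  exact ⟨B.conjTranspose, by rw [Matrix.conjTranspose_conjTranspose]; exact hB⟩

end IsCircularGaussian

lemma integral_id_stdComplexGaussian : ∫ z, z ∂stdComplexGaussian = 0 := by
  simpa using integral_pow_mul_conj_pow 1 0

/-- Independent standard complex Gaussians form a circular Gaussian vector. -/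
lemma isCircularGaussian_stdComplexGaussianPi (m : ℕ) :
    IsCircularGaussian (stdComplexGaussianPi m) (fun i x => x i) 1 where
  gaussian := by
    have h : iIndepFun (fun i (x : Fin m → ℂ) => x i) (stdComplexGaussianPi m) :=
      iIndepFun_pi (μ := fun _ : Fin m => stdComplexGaussian) (𝓧 := fun _ => ℂ) (X := fun _ z => z)
        fun _ => (measurable_id (α := ℂ)).aemeasurable
    refine iIndepFun.hasGaussianLaw (X := fun i (x : Fin m → ℂ) => x i) (fun i => ⟨?_⟩) h
    have := (measurePreserving_eval (fun _ : Fin m => stdComplexGaussian) i).map_eq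
    change Measure.map (fun x : Fin m → ℂ => x i) _ = _ at this
    rw [this]; infer_instance
  mean_zero i := by
    have h := (measurePreserving_eval (fun _ : Fin m => stdComplexGaussian) i).map_eq
    have h2 := integral_map (μ := stdComplexGaussianPi m) (φ := fun x : Fin m → ℂ => x i)
      (measurable_pi_apply i).aemeasurable (f := fun z : ℂ => z) (by fun_prop)
    change Measure.map (fun x : Fin m → ℂ => x i) _ = _ at h
    rw [← h2, h, integral_id_stdComplexGaussian]
  covariance i j := by
    have h := integral_prod_monomial (fun _ : Fin 1 => i) (fun _ : Fin 1 => j)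
    simp only [Finset.univ_unique, Finset.prod_singleton] at h
    rw [h]
    by_cases hij : i = j
    · subst hij
      simp [Function.comp_def]
    · rw [Matrix.one_apply_ne hij]
      norm_cast
      rw [Fintype.card_eq_zero_iff]
      exact ⟨fun ⟨σ, hσ⟩ => hij (congrFun hσ 0).symm⟩
  pseudoCovariance i j := by
    have h : ∀ x : Fin m → ℂ, x i * x j =
        ∏ l, ((x l) ^ ((if l = i then 1 else 0) + (if l = j then 1 else 0)) *
          (starRingEnd ℂ) (x l) ^ 0) := fun x => by
      simp only [pow_zero, mul_one, pow_add, Finset.prod_mul_distrib, pow_ite, pow_one,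
        Finset.prod_ite_eq', Finset.mem_univ, if_true]
    simp only [h]
    rw [integral_fintype_prod_eq_prod (𝕜 := ℂ) (fun l (z : ℂ) =>
      z ^ ((if l = i then 1 else 0) + (if l = j then 1 else 0)) * (starRingEnd ℂ) z ^ 0)]
    refine Finset.prod_eq_zero (Finset.mem_univ i) ?_
    rw [integral_pow_mul_conj_pow, if_neg]
    rw [if_pos rfl]; omega

/-- **Wick's formula** for circular Gaussian vectors. -/
theorem IsCircularGaussian.integral_prod_mul_conj {Ω : Type*} [MeasurableSpace Ω] {P : Measure Ω}
    {n : ℕ} {G : Fin n → Ω → ℂ} {Γ : Matrix (Fin n) (Fin n) ℂ} (hG : IsCircularGaussian P G Γ) :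
    ∫ ω, ∏ i, (G i ω * (starRingEnd ℂ) (G i ω)) ∂P = Γ.permanent := by
  obtain ⟨L, rfl⟩ := hG.exists_eq_mul_conjTranspose
  have hL := (isCircularGaussian_stdComplexGaussianPi n).mulVec L
  rw [Matrix.mul_one] at hL
  have hm : AEStronglyMeasurable (fun x : Fin n → ℂ => ∏ i, (x i * (starRingEnd ℂ) (x i)))
      (P.map fun ω i => G i ω) :=
    (Continuous.measurable (by fun_prop)).aestronglyMeasurable
  calc ∫ ω, ∏ i, (G i ω * (starRingEnd ℂ) (G i ω)) ∂P =
        ∫ x : Fin n → ℂ, ∏ i, (x i * (starRingEnd ℂ) (x i)) ∂(P.map fun ω i => G i ω) :=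
        (integral_map hG.gaussian.aemeasurable hm).symm
    _ = ∫ x : Fin n → ℂ, ∏ i, (L.mulVec x i * (starRingEnd ℂ) (L.mulVec x i))
        ∂(stdComplexGaussianPi n) := by
        rw [hG.map_eq hL] at hm ⊢
        exact integral_map hL.gaussian.aemeasurable hm
    _ = _ := integral_prod_mulVec_mul_conj L

/-- **Wick's formula** for the squared moduli. -/
lemma IsCircularGaussian.integral_prod_norm_sq {Ω : Type*} [MeasurableSpace Ω] {P : Measure Ω}
    {n : ℕ} {G : Fin n → Ω → ℂ} {Γ : Matrix (Fin n) (Fin n) ℂ} (hG : IsCircularGaussian P G Γ) :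
    ((∫ ω, ∏ i, ‖G i ω‖ ^ 2 ∂P : ℝ) : ℂ) = Γ.permanent := by
  rw [← hG.integral_prod_mul_conj, ← integral_complex_ofReal]
  refine integral_congr_ae (Filter.Eventually.of_forall fun ω => ?_)
  simp only [Complex.mul_conj, Complex.normSq_eq_norm_sq]
  push_cast
  rfl

/-! ### Determinants: Cauchy, Andréief, Schur -/

lemma vand_succ {n : ℕ} (v : Fin (n + 1) → ℂ) :
    vand v = (∏ j : Fin n, (v j.succ - v 0)) * vand fun j : Fin n => v j.succ := by
  simp only [vand, Matrix.det_vandermonde]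
  rw [Fin.prod_univ_succ]
  congr 1
  · exact Fin.prod_Ioi_zero _
  · exact Finset.prod_congr rfl fun i _ => Fin.prod_Ioi_succ _ _

lemma vand_ne_zero_iff {n : ℕ} {v : Fin n → ℂ} : vand v ≠ 0 ↔ Function.Injective v :=
  Matrix.det_vandermonde_ne_zero_iff

/-- One elimination step for Cauchy's matrix: subtracting from the row of `a` the multiple of the
row of `a₀` that clears the column of `x₀` leaves Cauchy entries rescaled by a row factor and a
column factor. -/
lemma cauchy_residual {a a₀ x x₀ : ℂ} (h1 : 1 - a * x ≠ 0) (h2 : 1 - a * x₀ ≠ 0)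
    (h3 : 1 - a₀ * x ≠ 0) : 1 / (1 - a * x) =
      (a - a₀) / (1 - a * x₀) * ((x - x₀) / (1 - a₀ * x) * (1 / (1 - a * x))) +
        (1 - a₀ * x₀) / (1 - a * x₀) * (1 / (1 - a₀ * x)) := by
  rw [div_mul_div_comm, div_mul_div_comm, div_mul_div_comm,
    div_add_div _ _ (mul_ne_zero h2 (mul_ne_zero h3 h1)) (mul_ne_zero h2 h3),
    div_eq_div_iff h1 (mul_ne_zero (mul_ne_zero h2 (mul_ne_zero h3 h1)) (mul_ne_zero h2 h3))]
  ring

/-- **Cauchy's determinant.** -/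
lemma det_cauchy {n : ℕ} (a x : Fin n → ℂ) (h : ∀ i j, 1 - a i * x j ≠ 0) :
    (Matrix.of fun i j => 1 / (1 - a i * x j)).det =
      vand a * vand x * ∏ i, ∏ j, 1 / (1 - a i * x j) := by
  induction n with
  | zero => simp [vand]
  | succ n ih =>
    let B : Matrix (Fin (n + 1)) (Fin (n + 1)) ℂ := Matrix.of fun i j =>
      Fin.cases (1 / (1 - a 0 * x j)) (fun i => ((a i.succ - a 0) / (1 - a i.succ * x 0)) *
        ((x j - x 0) / (1 - a 0 * x j) * (1 / (1 - a i.succ * x j)))) i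
    have hB : (Matrix.of fun i j => 1 / (1 - a i * x j)).det = B.det := by
      refine Matrix.det_eq_of_forall_row_eq_smul_add_const
        (Fin.cases 0 fun i => (1 - a 0 * x 0) / (1 - a i.succ * x 0)) 0 rfl fun i j => ?_
      cases i using Fin.cases with
      | zero => simp [B]
      | succ i =>
        have h1 := h i.succ j
        have h2 := h i.succ 0
        have h3 := h 0 j
        exact cauchy_residual h1 h2 h3
    have hB0 : B.det = 1 / (1 - a 0 * x 0) * (B.submatrix Fin.succ Fin.succ).det := by
      rw [Matrix.det_succ_column_zero, Finset.sum_eq_single 0]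
      · simp [B]
      · intro i _ hi
        obtain ⟨i, rfl⟩ := Fin.exists_succ_eq.2 hi
        simp [B]
      · simp
    have hsub : (B.submatrix Fin.succ Fin.succ).det =
        (∏ i : Fin n, (a i.succ - a 0) / (1 - a i.succ * x 0)) *
          ((∏ j : Fin n, (x j.succ - x 0) / (1 - a 0 * x j.succ)) *
            (Matrix.of fun i j : Fin n => 1 / (1 - a i.succ * x j.succ)).det) := by
      rw [← Matrix.det_mul_row, ← Matrix.det_mul_column]
      rfl
    rw [hB, hB0, hsub, ih (fun i => a i.succ) (fun j => x j.succ) fun i j => h _ _, vand_succ a,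
      vand_succ x, Fin.prod_univ_succ, Fin.prod_univ_succ]
    simp only [Fin.prod_univ_succ (n := n) (M := ℂ), Finset.prod_mul_distrib,
      Finset.prod_div_distrib, Finset.prod_const_one]
    ring

section Andreief

variable {α : Type*} [MeasurableSpace α] (μ : Measure α) [SigmaFinite μ]

/-- **Andréief's identity.** -/
theorem integral_det_mul_det {m : ℕ} (f g : Fin m → α → ℂ)
    (hint : ∀ i j, Integrable (fun t => f i t * g j t) μ) :
    ∫ t : Fin m → α, (Matrix.of fun i j => f i (t j)).det * (Matrix.of fun i j => g i (t j)).det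
      ∂(Measure.pi fun _ => μ) =
      (m.factorial : ℂ) * (Matrix.of fun i j => ∫ t, f i t * g j t ∂μ).det := by
  have hexp : ∀ t : Fin m → α,
      (Matrix.of fun i j => f i (t j)).det * (Matrix.of fun i j => g i (t j)).det =
      ∑ σ : Equiv.Perm (Fin m), ∑ τ : Equiv.Perm (Fin m),
        ((Equiv.Perm.sign σ : ℤ) : ℂ) * ((Equiv.Perm.sign τ : ℤ) : ℂ) *
          ∏ j, (f (σ j) (t j) * g (τ j) (t j)) := fun t => by
    rw [Matrix.det_apply', Matrix.det_apply', Finset.sum_mul_sum]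
    refine Finset.sum_congr rfl fun σ _ => Finset.sum_congr rfl fun τ _ => ?_
    simp only [Matrix.of_apply, Finset.prod_mul_distrib]
    ring
  have hi : ∀ σ τ : Equiv.Perm (Fin m),
      Integrable (fun t : Fin m → α => ∏ j, (f (σ j) (t j) * g (τ j) (t j)))
        (Measure.pi fun _ => μ) := fun σ τ =>
    Integrable.fintype_prod (f := fun j t => f (σ j) t * g (τ j) t) fun j => hint _ _
  have hval : ∀ σ τ : Equiv.Perm (Fin m),
      ∫ t : Fin m → α, ∏ j, (f (σ j) (t j) * g (τ j) (t j)) ∂(Measure.pi fun _ => μ) =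
        ∏ j, ∫ t, f (σ j) t * g (τ j) t ∂μ := fun σ τ =>
    integral_fintype_prod_eq_prod (𝕜 := ℂ) fun j t => f (σ j) t * g (τ j) t
  simp only [hexp]
  rw [integral_finsetSum _ fun σ _ => integrable_finsetSum _ fun τ _ => (hi σ τ).const_mul _]
  simp only [integral_finsetSum _ fun τ _ => (hi _ τ).const_mul _, integral_const_mul, hval]
  set A : Matrix (Fin m) (Fin m) ℂ := Matrix.of fun i j => ∫ t, f i t * g j t ∂μ with hA
  -- For fixed σ the sum over τ is sign(σ) times the determinant of `A` with rows permuted by σ,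
  -- thus det `A` itself; summing over σ gives the factor m!.
  have hσ : ∀ σ : Equiv.Perm (Fin m), ∑ τ : Equiv.Perm (Fin m),
      ((Equiv.Perm.sign σ : ℤ) : ℂ) * ((Equiv.Perm.sign τ : ℤ) : ℂ) *
        ∏ j, ∫ t, f (σ j) t * g (τ j) t ∂μ = A.det := fun σ => by
    have h1 := Matrix.det_permute σ A
    have h2 : ((Equiv.Perm.sign σ : ℤ) : ℂ) * ((Equiv.Perm.sign σ : ℤ) : ℂ) = 1 := by
      norm_cast
      rw [Int.units_mul_self]
      simp
    rw [← one_mul A.det, ← h2, mul_assoc, ← h1, ← Matrix.det_transpose, Matrix.det_apply',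
      Finset.mul_sum]
    refine Finset.sum_congr rfl fun τ _ => ?_
    rw [mul_assoc]
    rfl
  simp only [hσ, Finset.sum_const, Finset.card_univ, Fintype.card_perm, Fintype.card_fin,
    nsmul_eq_mul]

end Andreief

section Schur

variable {n : ℕ}

/-- The determinant of a bordered matrix. -/
lemma det_bordered (k : ℂ → ℂ → ℂ) (a : Fin n → ℂ) (z w : ℂ)
    (h : (Matrix.of fun i j => k (a i) (a j)).det ≠ 0) :
    (Matrix.of fun i j => k ((Fin.cons z a : Fin (n + 1) → ℂ) i)
        ((Fin.cons w a : Fin (n + 1) → ℂ) j)).det =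
      (Matrix.of fun i j => k (a i) (a j)).det *
        (k z w - ∑ l, ∑ m, k z (a l) * (Matrix.of fun i j => k (a i) (a j))⁻¹ l m * k (a m) w) := by
  set Γ : Matrix (Fin n) (Fin n) ℂ := Matrix.of fun i j => k (a i) (a j) with hΓ
  -- Moves the border, index 0, into the last block. Rows and columns are permuted alike, so the
  -- determinant is unchanged and the Schur complement formula applies.
  let e : Fin n ⊕ PUnit.{1} ≃ Fin (n + 1) :=
    (Equiv.optionEquivSumPUnit (Fin n)).symm.trans (finSuccEquiv n).symm
  have := Matrix.invertibleOfIsUnitDet Γ h.isUnit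
  rw [← Matrix.det_submatrix_equiv_self e]
  have hblock : (Matrix.of fun i j => k ((Fin.cons z a : Fin (n + 1) → ℂ) i)
        ((Fin.cons w a : Fin (n + 1) → ℂ) j)).submatrix e e =
      Matrix.fromBlocks Γ (Matrix.of fun i _ => k (a i) w) (Matrix.of fun _ j => k z (a j))
        (Matrix.of fun _ _ => k z w) := by
    ext i j
    rcases i with i | i <;> rcases j with j | j <;> simp [e, hΓ]
  rw [hblock, Matrix.det_fromBlocks₁₁, Matrix.invOf_eq_nonsing_inv]
  congr 1
  rw [Matrix.det_unique]
  simp only [Matrix.sub_apply, Matrix.of_apply, Matrix.mul_apply, Finset.sum_mul]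
  rw [Finset.sum_comm]

end Schur

/-! ### The Szegő kernel and the tilted measures -/

section Szego

variable (F : Measure Torus) [IsProbabilityMeasure F]

lemma norm_expNeg (t : Torus) : ‖expNeg t‖ = 1 := by
  rw [expNeg, neg_mul, ← mul_neg, mul_comm, ← Complex.ofReal_neg]
  exact Complex.norm_exp_ofReal_mul_I _

lemma continuous_expNeg : Continuous expNeg := by unfold expNeg; fun_prop

lemma one_sub_norm_le (z : ℂ) (t : Torus) : 1 - ‖z‖ ≤ ‖1 - z * expNeg t‖ := by
  have := norm_sub_norm_le (1 : ℂ) (z * expNeg t)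
  rwa [norm_one, norm_mul, norm_expNeg, mul_one] at this

lemma one_sub_mul_expNeg_ne_zero {z : ℂ} (hz : z ∈ disk) (t : Torus) : 1 - z * expNeg t ≠ 0 := by
  have h1 := one_sub_norm_le z t
  have h2 : ‖z‖ < 1 := hz
  exact norm_pos_iff.1 (by linarith)

lemma szego_ne_zero {z : ℂ} (hz : z ∈ disk) (t : Torus) : szego z t ≠ 0 :=
  one_div_ne_zero (one_sub_mul_expNeg_ne_zero hz t)

lemma norm_szego_le {z : ℂ} (hz : z ∈ disk) (t : Torus) : ‖szego z t‖ ≤ (1 - ‖z‖)⁻¹ := by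
  have h2 : 0 < 1 - ‖z‖ := sub_pos.2 hz
  rw [szego, norm_div, norm_one, one_div]
  exact inv_anti₀ h2 (one_sub_norm_le z t)

lemma continuous_szego {z : ℂ} (hz : z ∈ disk) : Continuous (szego z) :=
  continuous_const.div (continuous_const.sub (continuous_const.mul continuous_expNeg))
    (one_sub_mul_expNeg_ne_zero hz)

lemma integrable_szego_mul_conj {z w : ℂ} (hz : z ∈ disk) (hw : w ∈ disk) :
    Integrable (fun t => szego z t * (starRingEnd ℂ) (szego w t)) F := by
  refine Integrable.of_bound (C := (1 - ‖z‖)⁻¹ * (1 - ‖w‖)⁻¹)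
    ((continuous_szego hz).mul (Complex.continuous_conj.comp
      (continuous_szego hw))).aestronglyMeasurable (Filter.Eventually.of_forall fun t => ?_)
  rw [norm_mul, RCLike.norm_conj]
  exact mul_le_mul (norm_szego_le hz t) (norm_szego_le hw t) (norm_nonneg _)
    ((norm_nonneg _).trans (norm_szego_le hz t))

lemma norm_covKernel_le {z w : ℂ} (hz : z ∈ disk) (hw : w ∈ disk) :
    ‖covKernel F z w‖ ≤ (1 - ‖z‖)⁻¹ * (1 - ‖w‖)⁻¹ := by
  have := norm_integral_le_of_norm_le_const (μ := F)
    (f := fun t => szego z t * (starRingEnd ℂ) (szego w t)) (C := (1 - ‖z‖)⁻¹ * (1 - ‖w‖)⁻¹)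
    (Filter.Eventually.of_forall fun t => by
      rw [norm_mul, RCLike.norm_conj]
      exact mul_le_mul (norm_szego_le hz t) (norm_szego_le hw t) (norm_nonneg _)
        ((norm_nonneg _).trans (norm_szego_le hz t)))
  simpa [covKernel] using this

variable {n m : ℕ}

/-- The covariance matrix between `X(a_1), …, X(a_m)` and `X(b_1), …, X(b_m)`. -/
def covMatrix (a b : Fin m → ℂ) : Matrix (Fin m) (Fin m) ℂ :=
  Matrix.of fun i j => covKernel F (a i) (b j)

lemma det_szego {a : Fin m → ℂ} (ha : ∀ i, a i ∈ disk) (t : Fin m → Torus) :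
    (Matrix.of fun i j => szego (a i) (t j)).det =
      vand a * vand (fun k => expNeg (t k)) * szegoProd a t :=
  det_cauchy a (fun k => expNeg (t k)) fun i j => one_sub_mul_expNeg_ne_zero (ha i) (t j)

/-- The entries are integrals of products, so Andréief's identity makes the determinant an integral
of two determinants of Szegő kernels, each of them a Cauchy determinant in the points e^{-it_k}. -/
lemma det_covMatrix {a b : Fin m → ℂ} (ha : ∀ i, a i ∈ disk) (hb : ∀ i, b i ∈ disk) :
    (covMatrix F a b).det = vand a * (starRingEnd ℂ) (vand b) *
      ∫ t, ((1 / (m.factorial : ℝ) * ‖vand fun k => expNeg (t k)‖ ^ 2 : ℝ) : ℂ) *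
        (szegoProd a t * (starRingEnd ℂ) (szegoProd b t)) ∂(Measure.pi fun _ : Fin m => F) := by
  have h := integral_det_mul_det F (fun i => szego (a i))
    (fun j t => (starRingEnd ℂ) (szego (b j) t)) fun i j =>
      integrable_szego_mul_conj F (ha i) (hb j)
  have hfac : (m.factorial : ℂ) ≠ 0 := Nat.cast_ne_zero.2 m.factorial_ne_zero
  change _ = (m.factorial : ℂ) * (covMatrix F a b).det at h
  rw [← mul_right_inj' hfac, ← h, ← integral_const_mul, ← integral_const_mul]
  refine integral_congr_ae (Filter.Eventually.of_forall fun t => ?_)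
  have h1 := det_szego hb t
  have h2 : (Matrix.of fun i j => (starRingEnd ℂ) (szego (b i) (t j))).det =
      (starRingEnd ℂ) ((Matrix.of fun i j => szego (b i) (t j)).det) := by
    rw [RingHom.map_det]; rfl
  simp only
  rw [h2, h1, det_szego ha]
  simp only [map_mul]
  push_cast
  rw [← Complex.mul_conj']
  field_simp

lemma continuous_szegoProd {a : Fin n → ℂ} (ha : ∀ i, a i ∈ disk) :
    Continuous (szegoProd a : (Fin m → Torus) → ℂ) :=
  continuous_finsetProd _ fun j _ => continuous_finsetProd _ fun k _ =>
    (continuous_szego (ha j)).comp (continuous_apply k)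

lemma continuous_vand_expNeg : Continuous fun t : Fin m → Torus => vand fun k => expNeg (t k) := by
  unfold vand
  refine Continuous.matrix_det (continuous_matrix fun i j => ?_)
  simp only [Matrix.vandermonde_apply]
  exact (continuous_expNeg.comp (continuous_apply i)).pow _

/-- The density of `vandMeasure`. -/
def vandDensity (a : Fin n → ℂ) (t : Fin m → Torus) : ℝ :=
  1 / (m.factorial : ℝ) * ‖vand fun k => expNeg (t k)‖ ^ 2 * ‖szegoProd a t‖ ^ 2

lemma vandDensity_nonneg (a : Fin n → ℂ) (t : Fin m → Torus) : 0 ≤ vandDensity a t := by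
  unfold vandDensity; positivity

lemma continuous_vandDensity {a : Fin n → ℂ} (ha : ∀ i, a i ∈ disk) :
    Continuous (vandDensity a : (Fin m → Torus) → ℝ) :=
  (continuous_const.mul (continuous_vand_expNeg.norm.pow 2)).mul
    ((continuous_szegoProd ha).norm.pow 2)

lemma norm_prod_szego_le {z : ℂ} (hz : z ∈ disk) (t : Fin m → Torus) :
    ‖∏ k, szego z (t k)‖ ≤ (1 - ‖z‖)⁻¹ ^ m := by
  rw [norm_prod]
  calc ∏ k, ‖szego z (t k)‖ ≤ ∏ _k : Fin m, (1 - ‖z‖)⁻¹ :=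
        Finset.prod_le_prod (fun _ _ => norm_nonneg _) fun k _ => norm_szego_le hz (t k)
    _ = _ := by simp

lemma norm_vand_expNeg_le (t : Fin m → Torus) : ‖vand fun k => expNeg (t k)‖ ≤ m.factorial := by
  rw [vand, Matrix.det_apply']
  refine (norm_sum_le _ _).trans ?_
  have : ∀ σ : Equiv.Perm (Fin m), ‖((Equiv.Perm.sign σ : ℤ) : ℂ) *
      ∏ i, Matrix.vandermonde (fun k => expNeg (t k)) (σ i) i‖ ≤ 1 := fun σ => by
    rw [norm_mul, norm_prod]
    have h1 : ‖((Equiv.Perm.sign σ : ℤ) : ℂ)‖ = 1 := by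
      rcases Int.units_eq_one_or (Equiv.Perm.sign σ) with h | h <;> simp [h]
    rw [h1, one_mul]
    simp [norm_expNeg]
  refine (Finset.sum_le_sum fun σ _ => this σ).trans ?_
  simp [Fintype.card_perm]

lemma vandDensity_le {a : Fin n → ℂ} (ha : ∀ i, a i ∈ disk) (t : Fin m → Torus) :
    vandDensity a t ≤
      1 / (m.factorial : ℝ) * (m.factorial : ℝ) ^ 2 * (∏ j, (1 - ‖a j‖)⁻¹ ^ m) ^ 2 := by
  have h : ‖szegoProd a t‖ ≤ ∏ j, (1 - ‖a j‖)⁻¹ ^ m := by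
    rw [szegoProd, norm_prod]
    exact Finset.prod_le_prod (fun _ _ => norm_nonneg _) fun j _ => norm_prod_szego_le (ha j) t
  have h2 := norm_vand_expNeg_le t
  unfold vandDensity
  gcongr

lemma integrable_vandDensity {a : Fin n → ℂ} (ha : ∀ i, a i ∈ disk) :
    Integrable (vandDensity a : (Fin m → Torus) → ℝ) (Measure.pi fun _ => F) := by
  refine Integrable.of_bound
    (C := 1 / (m.factorial : ℝ) * (m.factorial : ℝ) ^ 2 * (∏ j, (1 - ‖a j‖)⁻¹ ^ m) ^ 2)
    (continuous_vandDensity ha).aestronglyMeasurable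
    (Filter.Eventually.of_forall fun t => ?_)
  rw [Real.norm_of_nonneg (vandDensity_nonneg _ _)]
  exact vandDensity_le ha t

lemma vandMeasure_univ {a : Fin n → ℂ} (ha : ∀ i, a i ∈ disk) :
    vandMeasure F a m Set.univ =
      ENNReal.ofReal (∫ t, vandDensity a t ∂(Measure.pi fun _ : Fin m => F)) := by
  rw [ofReal_integral_eq_lintegral_ofReal (integrable_vandDensity F ha)
    (Filter.Eventually.of_forall fun t => vandDensity_nonneg a t), vandMeasure,
    withDensity_apply _ MeasurableSet.univ, Measure.restrict_univ]
  rfl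

lemma vandMeasure_real_univ {a : Fin n → ℂ} (ha : ∀ i, a i ∈ disk) :
    (vandMeasure F a m).real Set.univ = ∫ t, vandDensity a t ∂(Measure.pi fun _ : Fin m => F) := by
  rw [measureReal_def, vandMeasure_univ F ha, ENNReal.toReal_ofReal]
  exact integral_nonneg fun t => vandDensity_nonneg a t

lemma isFiniteMeasure_vandMeasure {a : Fin n → ℂ} (ha : ∀ i, a i ∈ disk) :
    IsFiniteMeasure (vandMeasure F a m) :=
  ⟨by rw [vandMeasure_univ F ha]; exact ENNReal.ofReal_lt_top⟩

lemma integral_vandMeasure (ν : Measure Torus) {a : Fin n → ℂ} (ha : ∀ i, a i ∈ disk)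
    (g : (Fin m → Torus) → ℂ) :
    ∫ t, g t ∂(vandMeasure ν a m) =
      ∫ t, ((vandDensity a t : ℝ) : ℂ) * g t ∂(Measure.pi fun _ : Fin m => ν) := by
  rw [vandMeasure]
  change ∫ t, g t ∂((Measure.pi fun _ : Fin m => ν).withDensity fun t =>
    ENNReal.ofReal (vandDensity a t)) = _
  rw [integral_withDensity_eq_integral_toReal_smul
    (continuous_vandDensity ha).measurable.ennreal_ofReal (by simp)]
  simp only [ENNReal.toReal_ofReal (vandDensity_nonneg _ _), Complex.real_smul]

/-- With the normalization cleared, the identity also holds when the measure is zero, where both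
sides vanish. -/
lemma mul_tiltedKernel {a : Fin n → ℂ} (ha : ∀ i, a i ∈ disk) (z w : ℂ) :
    (((vandMeasure F a m).real Set.univ : ℝ) : ℂ) * tiltedKernel F a m z w =
      ∫ t, ((vandDensity a t : ℝ) : ℂ) * ((∏ k, szego z (t k)) *
        (starRingEnd ℂ) (∏ k, szego w (t k))) ∂(Measure.pi fun _ : Fin m => F) := by
  have := isFiniteMeasure_vandMeasure F (m := m) ha
  rw [← integral_vandMeasure F ha, tiltedKernel, pointLaw, integral_smul_measure,
    ENNReal.toReal_inv, ← measureReal_def, Complex.real_smul, ← mul_assoc]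
  by_cases h0 : (vandMeasure F a m).real Set.univ = 0
  · rw [h0]
    have : vandMeasure F a m = 0 := by
      rwa [measureReal_eq_zero_iff, Measure.measure_univ_eq_zero] at h0
    rw [this]
    simp
  · rw [← Complex.ofReal_mul, mul_inv_cancel₀ h0, Complex.ofReal_one, one_mul]

lemma det_covMatrix_self {a : Fin n → ℂ} (ha : ∀ i, a i ∈ disk) :
    (covMatrix F a a).det =
      ((‖vand a‖ ^ 2 * (vandMeasure F a n).real Set.univ : ℝ) : ℂ) := by
  rw [det_covMatrix F ha ha, vandMeasure_real_univ F ha, Complex.mul_conj']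
  push_cast
  rw [← integral_complex_ofReal]
  congr 1
  refine integral_congr_ae (Filter.Eventually.of_forall fun t => ?_)
  simp only [vandDensity, Complex.mul_conj']
  push_cast
  ring

lemma cons_mem_disk {a : Fin n → ℂ} (ha : ∀ i, a i ∈ disk) {z : ℂ} (hz : z ∈ disk)
    (i : Fin (n + 1)) : (Fin.cons z a : Fin (n + 1) → ℂ) i ∈ disk := by
  cases i using Fin.cases with
  | zero => simpa using hz
  | succ i => simpa using ha i

lemma szegoProd_cons (a : Fin n → ℂ) (z : ℂ) (t : Fin m → Torus) :
    szegoProd (Fin.cons z a : Fin (n + 1) → ℂ) t = (∏ k, szego z (t k)) * szegoProd a t := by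
  simp only [szegoProd, Fin.prod_univ_succ, Fin.cons_zero, Fin.cons_succ]

lemma vand_cons (a : Fin n → ℂ) (z : ℂ) :
    vand (Fin.cons z a : Fin (n + 1) → ℂ) = (∏ j, (a j - z)) * vand a := by
  rw [vand_succ]
  simp only [Fin.cons_zero, Fin.cons_succ]

/-- Adjoining z to a multiplies V(a) by ∏(a_j - z) and S(a,t) by S(z,t). The part depending on a
alone is the density of μ̃_a, so the integral is an unnormalized K_a^{(n+1)}(z,w). The signs from z
and from w cancel. -/
lemma det_covMatrix_cons {a : Fin n → ℂ} (ha : ∀ i, a i ∈ disk) {z w : ℂ} (hz : z ∈ disk)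
    (hw : w ∈ disk) :
    (covMatrix F (Fin.cons z a : Fin (n + 1) → ℂ) (Fin.cons w a)).det =
      ((‖vand a‖ ^ 2 : ℝ) : ℂ) * ((∏ j, (z - a j)) * (starRingEnd ℂ) (∏ j, (w - a j))) *
        ((((vandMeasure F a (n + 1)).real Set.univ : ℝ) : ℂ) * tiltedKernel F a (n + 1) z w) := by
  rw [det_covMatrix F (cons_mem_disk ha hz) (cons_mem_disk ha hw), mul_tiltedKernel F ha,
    vand_cons, vand_cons]
  have hsgn : ∀ x : ℂ, ∏ j, (a j - x) = (-1) ^ n * ∏ j, (x - a j) := fun x => by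
    rw [← Fin.prod_const, ← Finset.prod_mul_distrib]
    exact Finset.prod_congr rfl fun j _ => by ring
  have hone : ((-1 : ℂ) ^ n) * (-1) ^ n = 1 := by rw [← mul_pow]; simp
  congr 1
  · rw [hsgn, hsgn]
    simp only [map_mul, map_pow, map_neg, map_one]
    push_cast
    rw [← Complex.mul_conj']
    linear_combination (vand a * (starRingEnd ℂ) (vand a) * (∏ j, (z - a j)) *
      (starRingEnd ℂ) (∏ j, (w - a j))) * hone
  · refine integral_congr_ae (Filter.Eventually.of_forall fun t => ?_)
    simp only [vandDensity, szegoProd_cons, map_mul]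
    push_cast
    rw [← Complex.mul_conj' (szegoProd a t)]
    ring

/-- The covariance kernel conditioned on `X(a_1) = ⋯ = X(a_n) = 0`. -/
def condKernel (a : Fin n → ℂ) (z w : ℂ) : ℂ :=
  covKernel F z w - ∑ l, ∑ m, covKernel F z (a l) * (covMatrix F a a)⁻¹ l m * covKernel F (a m) w

/-- The Schur complement is the bordered determinant divided by the inner one; the factor |V(a)|²
cancels and the zeros at the a_j become explicit. -/
lemma condKernel_eq {a : Fin n → ℂ} (ha : ∀ i, a i ∈ disk) (hdet : (covMatrix F a a).det ≠ 0)
    {z w : ℂ} (hz : z ∈ disk) (hw : w ∈ disk) :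
    condKernel F a z w = (∏ j, (z - a j)) * (starRingEnd ℂ) (∏ j, (w - a j)) *
      ((((vandMeasure F a (n + 1)).real Set.univ / (vandMeasure F a n).real Set.univ : ℝ) : ℂ) *
        tiltedKernel F a (n + 1) z w) := by
  have h1 := det_bordered (covKernel F) a z w hdet
  have h2 := det_covMatrix_cons F ha hz hw
  have h3 := det_covMatrix_self F ha
  rw [h3] at hdet
  change _ = (covMatrix F a a).det * condKernel F a z w at h1
  change (covMatrix F (Fin.cons z a : Fin (n + 1) → ℂ) (Fin.cons w a)).det = _ at h1
  rw [h1, h3] at h2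
  push_cast at h2 hdet ⊢
  obtain ⟨hv, hμ⟩ := mul_ne_zero_iff.1 hdet
  rw [← mul_right_inj' hdet, h2]
  field_simp

end Szego

/-! ### Modification of a Gaussian analytic function -/

section Modification

variable {Ω : Type*} [MeasurableSpace Ω] {P : Measure Ω}

/-- A process with almost surely analytic paths has a version all of whose paths are analytic and
all of whose values are measurable. -/
lemma exists_analytic_version {X : ℂ → Ω → ℂ}
    (ha : ∀ᵐ ω ∂P, DifferentiableOn ℂ (fun z => X z ω) disk)
    (hm : ∀ z ∈ disk, AEMeasurable (X z) P) :
    ∃ Y : ℂ → Ω → ℂ, (∀ z ∈ disk, Measurable (Y z)) ∧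
      (∀ ω, DifferentiableOn ℂ (fun z => Y z ω) disk) ∧ ∀ᵐ ω ∂P, ∀ z, Y z ω = X z ω := by
  classical
  obtain ⟨D, hDc, hD⟩ := TopologicalSpace.exists_countable_dense disk
  have hgood : ∀ᵐ ω ∂P, DifferentiableOn ℂ (fun z => X z ω) disk ∧
      ∀ z ∈ D, X z ω = (hm z z.2).mk (X z) ω :=
    ha.and ((ae_ball_iff hDc).2 fun z _ => (hm z z.2).ae_eq_mk)
  -- Off the measurable null set `N` the path is analytic and agrees with measurable versions on a
  -- countable dense set. Setting the path to 0 on `N` makes every value a limit of measurable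
  -- functions.
  obtain ⟨N, hN, hNm, hPN⟩ := exists_measurable_superset_of_null (ae_iff.1 hgood)
  have hA : ∀ ω ∉ N, DifferentiableOn ℂ (fun z => X z ω) disk ∧
      ∀ z ∈ D, X z ω = (hm z z.2).mk (X z) ω := fun ω hω => by
    by_contra h
    exact hω (hN h)
  refine ⟨fun z ω => if ω ∈ N then 0 else X z ω, fun z hz => ?_, fun ω => ?_, ?_⟩
  · obtain ⟨u, huD, hu⟩ := mem_closure_iff_seq_limit.1 (hD ⟨z, hz⟩)
    have hu' : Filter.Tendsto (fun k => (u k : ℂ)) Filter.atTop (nhds z) :=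
      (continuous_subtype_val.tendsto _).comp hu
    refine measurable_of_tendsto_metrizable
      (f := fun k ω => if ω ∈ N then 0 else (hm (u k) (u k).2).mk (X (u k)) ω)
      (fun k => Measurable.ite hNm measurable_const (hm (u k) (u k).2).measurable_mk) ?_
    refine tendsto_pi_nhds.2 fun ω => ?_
    by_cases hω : ω ∈ N
    · simp [hω]
    · simp only [hω, if_false]
      have hc := ((hA ω hω).1.continuousOn.continuousAt (isOpen_disk.mem_nhds hz)).tendsto.comp hu'
      refine hc.congr fun k => ?_
      exact (hA ω hω).2 (u k) (huD k)
  · by_cases hω : ω ∈ N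
    · simp [hω]
    · simpa [hω] using (hA ω hω).1
  · filter_upwards [(measure_eq_zero_iff_ae_notMem).1 hPN] with ω hω z
    simp [hω]

lemma IsGAF.congr {X Y : ℂ → Ω → ℂ} {K : ℂ → ℂ → ℂ} (hX : IsGAF P X K)
    (h : ∀ᵐ ω ∂P, ∀ z, Y z ω = X z ω) : IsGAF P Y K where
  analytic := by
    filter_upwards [hX.analytic, h] with ω h1 h2
    simpa only [h2] using h1
  gaussian := by
    refine ⟨fun I => (hX.gaussian.hasGaussianLaw I).congr ?_⟩
    filter_upwards [h] with ω h2
    ext z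
    exact (h2 _).symm
  mean_zero z hz := by
    rw [← hX.mean_zero z hz]
    exact integral_congr_ae (h.mono fun ω h2 => h2 z)
  covariance z hz w hw := by
    rw [← hX.covariance z hz w hw]
    exact integral_congr_ae (h.mono fun ω h2 => by simp only [h2])
  pseudoCovariance z hz w hw := by
    rw [← hX.pseudoCovariance z hz w hw]
    exact integral_congr_ae (h.mono fun ω h2 => by simp only [h2])

end Modification

lemma zeroCount_congr {Ω : Type*} {X Y : ℂ → Ω → ℂ} {ω : Ω} (h : ∀ z, Y z ω = X z ω) (B : Set ℂ) :
    zeroCount Y B ω = zeroCount X B ω := by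
  simp only [zeroCount, h]

/-! ### Finite linear combinations of a Gaussian process -/

section Regression

variable {Ω : Type*} [MeasurableSpace Ω] {P : Measure Ω}

lemma isGaussianProcess_of_linear_combination {S T : Type*} {X : T → Ω → ℂ} {Y : S → Ω → ℂ}
    {ι : Type*} [Fintype ι]
    (hX : IsGaussianProcess X P) (v : S → ι → T) (c : S → ι → ℂ)
    (h : ∀ s ω, Y s ω = ∑ i, c s i * X (v s i) ω) : IsGaussianProcess Y P := by
  classical
  refine hX.of_isGaussianProcess fun s => ⟨Finset.univ.image (v s),
    ∑ i, (c s i) • ContinuousLinearMap.proj (R := ℝ)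
      (φ := fun _ : (Finset.univ.image (v s) : Finset T) => ℂ)
        ⟨v s i, Finset.mem_image_of_mem _ (Finset.mem_univ i)⟩, fun ω => ?_⟩
  rw [h, sum_apply]
  rfl

/-- The real covariances are combinations of E[AB] and E[A conj B]. This is the form of
uncorrelatedness from which joint Gaussianity yields independence. -/
lemma covariance_inner_eq_zero [IsProbabilityMeasure P] {A B : Ω → ℂ} (hA : MemLp A 2 P)
    (hB : MemLp B 2 P) (hA0 : ∫ ω, A ω ∂P = 0)
    (h1 : ∫ ω, A ω * B ω ∂P = 0) (h2 : ∫ ω, A ω * (starRingEnd ℂ) (B ω) ∂P = 0) (x y : ℂ) :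
    cov[fun ω => inner ℝ x (A ω), fun ω => inner ℝ y (B ω); P] = 0 := by
  have hxA : MemLp (fun ω => inner ℝ x (A ω)) 2 P := hA.const_inner x
  have hyB : MemLp (fun ω => inner ℝ y (B ω)) 2 P := hB.const_inner y
  have hmean : ∫ ω, inner ℝ x (A ω) ∂P = 0 := by
    rw [integral_inner (hA.integrable (by norm_num)) x, hA0, inner_zero_right]
  rw [covariance_eq_sub hxA hyB, hmean, zero_mul, sub_zero]
  have key : ∀ ω, ((fun ω => inner ℝ x (A ω)) * fun ω => inner ℝ y (B ω)) ω =
      ((starRingEnd ℂ x * starRingEnd ℂ y / 2) * (A ω * B ω) +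
        (starRingEnd ℂ x * y / 2) * (A ω * (starRingEnd ℂ) (B ω))).re := fun ω => by
    simp only [Pi.mul_apply, Complex.inner, Complex.mul_re, Complex.mul_im, Complex.add_re,
      Complex.conj_re, Complex.conj_im, Complex.div_re, Complex.div_im, Complex.normSq_apply]
    norm_num
    ring
  have i1 : Integrable (fun ω => A ω * B ω) P := hA.integrable_mul hB
  have i2 : Integrable (fun ω => A ω * (starRingEnd ℂ) (B ω)) P := hA.integrable_mul hB.star
  have := integral_re ((i1.const_mul (starRingEnd ℂ x * starRingEnd ℂ y / 2)).add
    (i2.const_mul (starRingEnd ℂ x * y / 2)))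
  simp only [RCLike.re_eq_complex_re, Pi.add_apply] at this
  simp only [key]
  rw [this, integral_add (i1.const_mul _) (i2.const_mul _), integral_const_mul, integral_const_mul,
    h1, h2]
  simp

namespace IsGAF

variable {X : ℂ → Ω → ℂ} {K : ℂ → ℂ → ℂ}

lemma hasGaussianLaw_pi (hX : IsGAF P X K) {n : ℕ} {w : Fin n → ℂ} (hw : ∀ i, w i ∈ disk) :
    HasGaussianLaw (fun ω i => X (w i) ω) P := by
  have h := (hX.gaussian.comp_right fun i : Fin n => (⟨w i, hw i⟩ : disk)).hasGaussianLaw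
    Finset.univ
  exact h.map_fun (ContinuousLinearMap.pi fun i : Fin n => ContinuousLinearMap.proj (R := ℝ)
    (φ := fun _ : (Finset.univ : Finset (Fin n)) => ℂ) ⟨i, Finset.mem_univ i⟩)

lemma isCircularGaussian (hX : IsGAF P X K) {n : ℕ} {w : Fin n → ℂ} (hw : ∀ i, w i ∈ disk) :
    IsCircularGaussian P (fun i => X (w i)) (Matrix.of fun i j => K (w i) (w j)) where
  gaussian := hX.hasGaussianLaw_pi hw
  mean_zero i := hX.mean_zero _ (hw i)
  covariance i j := hX.covariance _ (hw i) _ (hw j)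
  pseudoCovariance i j := hX.pseudoCovariance _ (hw i) _ (hw j)

lemma memLp (hX : IsGAF P X K) {z : ℂ} (hz : z ∈ disk) : MemLp (X z) 2 P :=
  (hX.isCircularGaussian (w := fun _ : Fin 1 => z) fun _ => hz).memLp 0

lemma integrable (hX : IsGAF P X K) {z : ℂ} (hz : z ∈ disk) : Integrable (X z) P :=
  (hX.isCircularGaussian (w := fun _ : Fin 1 => z) fun _ => hz).integrable 0

end IsGAF

end Regression

/-! ### Regression on finitely many values -/

section Regression

variable {Ω : Type*} [MeasurableSpace Ω] {P : Measure Ω}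

lemma integral_sub_sum_mul {n : ℕ} {A C : Ω → ℂ} {B : Fin n → Ω → ℂ} (hA : MemLp A 2 P)
    (hB : ∀ l, MemLp (B l) 2 P) (hC : MemLp C 2 P) (c : Fin n → ℂ) :
    ∫ ω, (A ω - ∑ l, c l * B l ω) * C ω ∂P =
      ∫ ω, A ω * C ω ∂P - ∑ l, c l * ∫ ω, B l ω * C ω ∂P := by
  have hi : ∀ l, Integrable (fun ω => B l ω * C ω) P := fun l => (hB l).integrable_mul hC
  have hAC : Integrable (fun ω => A ω * C ω) P := hA.integrable_mul hC
  have h : ∀ ω, (A ω - ∑ l, c l * B l ω) * C ω = A ω * C ω - ∑ l, c l * (B l ω * C ω) :=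
    fun ω => by
      rw [sub_mul, Finset.sum_mul]
      simp only [mul_assoc]
  simp only [h]
  rw [integral_sub hAC (integrable_finsetSum _ fun l _ => (hi l).const_mul _),
    integral_finsetSum _ fun l _ => (hi l).const_mul _]
  simp only [integral_const_mul]

lemma integral_mul_conj_sub_sum {n : ℕ} {A C : Ω → ℂ} {B : Fin n → Ω → ℂ} (hA : MemLp A 2 P)
    (hB : ∀ l, MemLp (B l) 2 P) (hC : MemLp C 2 P) (c : Fin n → ℂ) :
    ∫ ω, C ω * (starRingEnd ℂ) (A ω - ∑ l, c l * B l ω) ∂P =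
      ∫ ω, C ω * (starRingEnd ℂ) (A ω) ∂P -
        ∑ l, (starRingEnd ℂ) (c l) * ∫ ω, C ω * (starRingEnd ℂ) (B l ω) ∂P := by
  have := integral_sub_sum_mul hA.star (fun l => (hB l).star) hC fun l => (starRingEnd ℂ) (c l)
  simp only [mul_comm (C _)]
  rw [← sub_eq_zero] at this ⊢
  rw [← this]
  simp only [map_sub, map_sum, map_mul, Pi.star_apply, starRingEnd_apply]

/-- A Gaussian analytic function is an affine function, in independent standard complex Gaussian
variables, of its values at `n` points, the remainder being an independent Gaussian analytic
function that vanishes at these points. -/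
theorem IsGAF.exists_regression [IsProbabilityMeasure P] {X : ℂ → Ω → ℂ} {K : ℂ → ℂ → ℂ}
    (hX : IsGAF P X K)
    (hm : ∀ z ∈ disk, Measurable (X z)) (ha : ∀ ω, DifferentiableOn ℂ (fun z => X z ω) disk)
    {n : ℕ} {w : Fin n → ℂ} (hw : ∀ i, w i ∈ disk)
    (hK : ∀ i, DifferentiableOn ℂ (fun z => K z (w i)) disk)
    (hdet : (Matrix.of fun i j => K (w i) (w j)).det ≠ 0) :
    ∃ (h : Fin n → ℂ → ℂ) (Y : ℂ → Ω → ℂ) (η : Ω → Fin n → ℂ),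
      (∀ j, DifferentiableOn ℂ (h j) disk) ∧ (∀ z ∈ disk, Measurable (Y z)) ∧
      (∀ ω, DifferentiableOn ℂ (fun z => Y z ω) disk) ∧ Measurable η ∧
      P.map η = stdComplexGaussianPi n ∧
      IndepFun (fun ω (z : disk) => Y z ω) η P ∧
      (∀ ω z, X z ω = Y z ω + ∑ j, η ω j * h j z) ∧ (∀ i ω, Y (w i) ω = 0) ∧
      (((‖(evalMatrix h w).det‖ ^ 2 : ℝ)) : ℂ) = (Matrix.of fun i j => K (w i) (w j)).det ∧
      IsGAF P Y fun z v => K z v - ∑ l, ∑ m, K z (w l) *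
        (Matrix.of fun i j => K (w i) (w j))⁻¹ l m * K (w m) v := by
  classical
  set Γ : Matrix (Fin n) (Fin n) ℂ := Matrix.of fun i j => K (w i) (w j) with hΓ
  have hG := hX.isCircularGaussian hw
  rw [← hΓ] at hG
  obtain ⟨L, hL⟩ := hG.exists_eq_mul_conjTranspose
  have hΓu : IsUnit Γ.det := isUnit_iff_ne_zero.2 hdet
  have hLu : IsUnit L.det := by
    rw [hL, Matrix.det_mul] at hΓu
    exact isUnit_of_mul_isUnit_left hΓu
  -- The coefficients of the orthogonal projection of X(z) onto the span of the X(w_l). They are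
  -- analytic in z, and at w_i the projection is X(w_i) itself.
  set c : Fin n → ℂ → ℂ := fun l z => ∑ m, K z (w m) * Γ⁻¹ m l with hc
  have hcd : ∀ l, DifferentiableOn ℂ (c l) disk := fun l =>
    DifferentiableOn.fun_sum fun m _ => (hK m).mul_const _
  have hcΓ : ∀ z j, ∑ l, c l z * Γ l j = K z (w j) := fun z j => by
    have h1 : ∑ l, c l z * Γ l j = ∑ m, K z (w m) * (Γ⁻¹ * Γ) m j := by
      simp only [hc, Matrix.mul_apply, Finset.sum_mul, Finset.mul_sum]
      rw [Finset.sum_comm]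
      simp only [mul_assoc]
    rw [h1, Matrix.nonsing_inv_mul _ hΓu]
    simp [Matrix.one_apply]
  have hcw : ∀ i l, c l (w i) = if i = l then 1 else 0 := fun i l => by
    have h1 : c l (w i) = (Γ * Γ⁻¹) i l := by
      simp only [hc, Matrix.mul_apply, hΓ, Matrix.of_apply]
    rw [h1, Matrix.mul_nonsing_inv _ hΓu, Matrix.one_apply]
  set V : Fin n → Ω → ℂ := fun l => X (w l) with hV
  have hV2 : ∀ l, MemLp (V l) 2 P := fun l => hX.memLp (hw l)
  set Y : ℂ → Ω → ℂ := fun z ω => X z ω - ∑ l, c l z * V l ω with hY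
  -- Whitening: since Γ = L Lᴴ, the vector L⁻¹V has covariance 1.
  set η : Ω → Fin n → ℂ := fun ω => L⁻¹.mulVec fun l => V l ω with hη
  have hYm : ∀ z ∈ disk, Measurable (Y z) := fun z hz =>
    (hm z hz).sub (Finset.measurable_fun_sum _ fun l _ => (hm _ (hw l)).const_mul _)
  have hY2 : ∀ z ∈ disk, MemLp (Y z) 2 P := fun z hz =>
    (hX.memLp hz).sub (memLp_finsetSum _ fun l _ => (hV2 l).const_mul _)
  have hY0 : ∀ z ∈ disk, ∫ ω, Y z ω ∂P = 0 := fun z hz => by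
    simp only [hY]
    rw [integral_sub (hX.integrable hz)
      (integrable_finsetSum _ fun l _ => (hX.integrable (hw l)).const_mul _),
      integral_finsetSum _ fun l _ => (hX.integrable (hw l)).const_mul _, hX.mean_zero z hz]
    simp only [integral_const_mul, hX.mean_zero _ (hw _)]
    simp
  have hYX : ∀ z ∈ disk, ∀ v ∈ disk, ∫ ω, Y z ω * (starRingEnd ℂ) (X v ω) ∂P =
      K z v - ∑ l, c l z * K (w l) v := fun z hz v hv => by
    simp only [hY]
    have := integral_sub_sum_mul (hX.memLp hz) hV2 (hX.memLp hv).star fun l => c l z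
    simp only [Pi.star_apply, ← starRingEnd_apply] at this
    rw [this, hX.covariance z hz v hv]
    simp only [hV, hX.covariance _ (hw _) v hv]
  have hYX' : ∀ z ∈ disk, ∀ v ∈ disk, ∫ ω, Y z ω * X v ω ∂P = 0 := fun z hz v hv => by
    simp only [hY]
    rw [integral_sub_sum_mul (hX.memLp hz) hV2 (hX.memLp hv) fun l => c l z,
      hX.pseudoCovariance z hz v hv]
    simp only [hV, hX.pseudoCovariance _ (hw _) v hv]
    simp
  have hYV : ∀ z ∈ disk, ∀ j, ∫ ω, Y z ω * (starRingEnd ℂ) (V j ω) ∂P = 0 := fun z hz j => by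
    rw [hYX z hz _ (hw j)]
    have := hcΓ z j
    simp only [hΓ, Matrix.of_apply] at this
    rw [this, sub_self]
  -- Remainder and values must be jointly Gaussian for vanishing covariances to give independence.
  have hgp : IsGaussianProcess (Sum.elim (fun (z : disk) => Y z) V) P :=
    isGaussianProcess_of_linear_combination (ι := Option (Fin n)) hX.gaussian
      (Sum.elim (fun z o => o.elim z fun l => ⟨w l, hw l⟩) fun j _ => ⟨w j, hw j⟩)
      (Sum.elim (fun z o => o.elim 1 fun l => -c l z) fun j o => o.elim 1 fun _ => 0) (by
        rintro (z | j) ω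
        · simp [Fintype.sum_option, hY, hV, sub_eq_add_neg]
        · simp [Fintype.sum_option, hV])
  have hηm : Measurable η :=
    measurable_pi_iff.2 fun j => by
      simp only [hη, Matrix.mulVec, dotProduct]
      exact Finset.measurable_fun_sum _ fun l _ => (hm _ (hw l)).const_mul _
  refine ⟨fun j z => ∑ l, c l z * L l j, Y, η, fun j => ?_, hYm, fun ω => ?_, hηm, ?_, ?_, ?_, ?_,
    ?_, ?_⟩
  · exact DifferentiableOn.fun_sum fun l _ => (hcd l).mul_const _
  · exact (ha ω).sub (DifferentiableOn.fun_sum fun l _ => (hcd l).mul_const _)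
  · have h1 := hG.mulVec L⁻¹
    have h2 : L⁻¹ * Γ * L⁻¹.conjTranspose = 1 := by
      rw [hL, ← Matrix.mul_assoc, Matrix.nonsing_inv_mul _ hLu, Matrix.one_mul,
        ← Matrix.conjTranspose_mul, Matrix.nonsing_inv_mul _ hLu, Matrix.conjTranspose_one]
    rw [h2] at h1
    have h3 := h1.map_eq (isCircularGaussian_stdComplexGaussianPi n)
    rw [show (fun (x : Fin n → ℂ) i => x i) = id from rfl, Measure.map_id] at h3
    exact h3
  · have h1 : IndepFun (fun ω (z : disk) => Y z ω) (fun ω l => V l ω) P :=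
      hgp.indepFun_of_covariance_inner (fun z => (hYm z z.2).aemeasurable)
        (fun l => (hm _ (hw l)).aemeasurable) fun z l x y =>
          covariance_inner_eq_zero (hY2 z z.2) (hV2 l) (hY0 z z.2)
            (hYX' z z.2 _ (hw l)) (hYV z z.2 l) x y
    exact h1.comp measurable_id
      (ψ := fun x => L⁻¹.mulVec x) (Continuous.measurable (by fun_prop))
  · intro ω z
    have h1 : ∑ j, η ω j * ∑ l, c l z * L l j = ∑ l, c l z * (L.mulVec (η ω)) l := by
      simp only [Matrix.mulVec, dotProduct, Finset.mul_sum]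
      rw [Finset.sum_comm]
      exact Finset.sum_congr rfl fun l _ => Finset.sum_congr rfl fun j _ => by ring
    have h2 : L.mulVec (η ω) = fun l => V l ω := by
      rw [hη, Matrix.mulVec_mulVec, Matrix.mul_nonsing_inv _ hLu, Matrix.one_mulVec]
    rw [h1, h2]
    simp [hY]
  · intro i ω
    simp [hY, hcw, hV]
  · have h1 : evalMatrix (fun j z => ∑ l, c l z * L l j) w = L := by
      ext i j
      simp [evalMatrix, hcw]
    rw [h1, hL, Matrix.det_mul, Matrix.det_conjTranspose, ← starRingEnd_apply, Complex.mul_conj,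
      Complex.normSq_eq_norm_sq]
  · have hsum : ∀ z v, ∑ l, ∑ m, K z (w l) * Γ⁻¹ l m * K (w m) v =
        ∑ l, c l z * K (w l) v := fun z v => by
      rw [Finset.sum_comm]
      simp only [hc, Finset.sum_mul]
    refine ⟨Filter.Eventually.of_forall fun ω =>
      (ha ω).sub (DifferentiableOn.fun_sum fun l _ => (hcd l).mul_const _), ?_, hY0, ?_, ?_⟩
    · exact hgp.comp_right Sum.inl
    · intro z hz v hv
      -- The remainder is orthogonal to all the X(w_l), so E[Y(z) conj Y(v)] = E[Y(z) conj X(v)].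
      have := integral_mul_conj_sub_sum (hX.memLp hv) hV2 (hY2 z hz) fun l => c l v
      rw [hsum, ← hYX z hz v hv]
      simp only [hYV z hz, mul_zero, Finset.sum_const_zero, sub_zero] at this
      exact this
    · intro z hz v hv
      have := integral_sub_sum_mul (hX.memLp hv) hV2 (hY2 z hz) fun l => c l v
      simp only [mul_comm _ (Y z _)] at this
      rw [hYX' z hz v hv] at this
      simp only [hV, hYX' z hz _ (hw _), mul_zero, Finset.sum_const_zero, sub_zero] at this
      exact this

end Regression

/-! ### The space of analytic paths -/

/-- The extension by zero of a function on the disk. -/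
def diskExtend (f : disk → ℂ) (z : ℂ) : ℂ :=
  open scoped Classical in if h : z ∈ disk then f ⟨z, h⟩ else 0

lemma diskExtend_of_mem (f : disk → ℂ) {z : ℂ} (h : z ∈ disk) : diskExtend f z = f ⟨z, h⟩ := by
  rw [diskExtend, dif_pos h]

lemma differentiableOn_diskExtend {f : ℂ → ℂ} (hf : DifferentiableOn ℂ f disk) :
    DifferentiableOn ℂ (diskExtend fun z => f z) disk :=
  hf.congr fun _ hz => diskExtend_of_mem _ hz

/-- The space of analytic functions on the disk, with the sigma-algebra generated by the
evaluations. -/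
abbrev AnalyticPath : Type := {f : disk → ℂ // DifferentiableOn ℂ (diskExtend f) disk}

section Conditioning

variable {Ω : Type*} [MeasurableSpace Ω] {P : Measure Ω} {n : ℕ}

/-- Zero counts are measurable on the space of analytic paths, not on all functions, so Fubini is
applied there. Its sigma-algebra is induced from the product, hence independence transfers. -/
lemma indepFun_analyticPath {Y : ℂ → Ω → ℂ} {η : Ω → Fin n → ℂ}
    (ha : ∀ ω, DifferentiableOn ℂ (fun z => Y z ω) disk)
    (hind : IndepFun (fun ω (z : disk) => Y z ω) η P) :
    IndepFun (fun ω => (⟨fun z => Y z ω, differentiableOn_diskExtend (ha ω)⟩ : AnalyticPath)) η P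
    := by
  rw [indepFun_iff_measure_inter_preimage_eq_mul] at hind ⊢
  rintro s t ⟨s', hs', rfl⟩ ht
  exact hind s' t hs' ht

/-- The moments of the zero counts of a process `Y + ∑ η_j h_j` with `η` standard and independent
of `Y` are given by the Kac-Rice density conditionally on `Y`. -/
theorem lintegral_prod_zeroCount_eq_lintegral_kacRiceDensity [IsProbabilityMeasure P]
    {X Y : ℂ → Ω → ℂ} {η : Ω → Fin n → ℂ} {h : Fin n → ℂ → ℂ}
    (hh : ∀ j, DifferentiableOn ℂ (h j) disk) (hYm : ∀ z ∈ disk, Measurable (Y z))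
    (hYa : ∀ ω, DifferentiableOn ℂ (fun z => Y z ω) disk) (hηm : Measurable η)
    (hη : P.map η = stdComplexGaussianPi n)
    (hind : IndepFun (fun ω (z : disk) => Y z ω) η P)
    (hX : ∀ ω z, X z ω = Y z ω + ∑ j, η ω j * h j z)
    {B : Fin n → Set ℂ} (hB : ∀ i, MeasurableSet (B i)) (hBd : ∀ i, B i ⊆ disk)
    (hdet : ∀ z ∈ Set.univ.pi B, (evalMatrix h z).det ≠ 0) :
    ∫⁻ ω, ∏ i, zeroCount X (B i) ω ∂P =
      ∫⁻ ω, (∫⁻ z in Set.univ.pi B,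
        ENNReal.ofReal (kacRiceDensity h stdDensityPi (fun z => Y z ω) z)) ∂P := by
  set Yp : Ω → AnalyticPath := fun ω => ⟨fun z => Y z ω, differentiableOn_diskExtend (hYa ω)⟩
    with hYp
  have hYpm : Measurable Yp :=
    Measurable.subtype_mk (measurable_pi_iff.2 fun z : disk => hYm (z : ℂ) z.2)
  set Z : ℂ → AnalyticPath × (Fin n → ℂ) → ℂ :=
    fun z p => diskExtend p.1.1 z + ∑ j, p.2 j * h j z with hZ
  have hZm : ∀ z ∈ disk, Measurable (Z z) := fun z hz => by
    simp only [hZ, diskExtend_of_mem _ hz]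
    have h1 : Measurable fun p : AnalyticPath × (Fin n → ℂ) => p.1.1 ⟨z, hz⟩ :=
      (measurable_pi_apply _).comp (measurable_subtype_coe.comp measurable_fst)
    exact h1.add (Finset.measurable_fun_sum _ fun j _ =>
      ((measurable_pi_apply j).comp measurable_snd).mul_const _)
  have hZa : ∀ p, DifferentiableOn ℂ (fun z => Z z p) disk := fun p =>
    p.1.2.add (DifferentiableOn.fun_sum fun j _ => (hh j).const_mul _)
  have hG : Measurable fun p => ∏ i, zeroCount Z (B i) p :=
    Finset.measurable_fun_prod _ fun i _ => measurable_zeroCount hZm hZa (hB i)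
  have hmap := (indepFun_iff_map_prod_eq_prod_map_map hYpm.aemeasurable hηm.aemeasurable).1
    (indepFun_analyticPath hYa hind)
  have hc : ∀ ω i, zeroCount X (B i) ω = zeroCount Z (B i) (Yp ω, η ω) := fun ω i => by
    have : {z ∈ B i ∩ disk | X z ω = 0} = {z ∈ B i ∩ disk | Z z (Yp ω, η ω) = 0} := by
      refine Set.ext fun z => and_congr_right fun hz => ?_
      simp only [hZ, hYp, diskExtend_of_mem _ hz.2, hX]
    simp only [zeroCount, this]
  calc ∫⁻ ω, ∏ i, zeroCount X (B i) ω ∂P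
      = ∫⁻ ω, ∏ i, zeroCount Z (B i) (Yp ω, η ω) ∂P := by simp only [hc]
    _ = ∫⁻ p, ∏ i, zeroCount Z (B i) p ∂(P.map fun ω => (Yp ω, η ω)) :=
        (lintegral_map hG (hYpm.prodMk hηm)).symm
    _ = ∫⁻ f, ∫⁻ u, ∏ i, zeroCount Z (B i) (f, u) ∂(stdComplexGaussianPi n) ∂(P.map Yp) := by
        rw [hmap, hη, lintegral_prod _ hG.aemeasurable]
    _ = ∫⁻ ω, ∫⁻ u, ∏ i, zeroCount Z (B i) (Yp ω, u) ∂(stdComplexGaussianPi n) ∂P :=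
        lintegral_map hG.lintegral_prod_right' hYpm
    _ = _ := by
        refine lintegral_congr fun ω => ?_
        rw [← lintegral_prod_encard_zeros (hYa ω) hh continuous_stdDensityPi.measurable hB hBd hdet,
          stdComplexGaussianPi_eq_withDensity]
        refine (lintegral_withDensity_eq_lintegral_mul _
          continuous_stdDensityPi.measurable.ennreal_ofReal
          (hG.comp (measurable_prodMk_left (x := Yp ω)))).trans ?_
        refine lintegral_congr fun u => ?_
        simp only [Pi.mul_apply, zeroCount]
        congr 1
        refine Finset.prod_congr rfl fun i _ => ?_
        have : {z ∈ B i ∩ disk | Z z (Yp ω, u) = 0} =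
            {z ∈ B i ∩ disk | Y z ω + ∑ j, u j * h j z = 0} := by
          refine Set.ext fun z => and_congr_right fun hz => ?_
          simp only [hZ, hYp, diskExtend_of_mem _ hz.2]
        rw [this]

end Conditioning

/-! ### Analyticity of the covariance kernel -/

/-- Differentiation under the integral, with a uniform bound on a smaller disk of radius r < 1. It
makes the regression functions analytic. -/
lemma differentiableOn_covKernel (F : Measure Torus) [IsProbabilityMeasure F] {w : ℂ}
    (hw : w ∈ disk) : DifferentiableOn ℂ (fun z => covKernel F z w) disk := by
  intro z₀ hz₀
  refine DifferentiableAt.differentiableWithinAt ?_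
  obtain ⟨r, hr0, hr⟩ := exists_between (show ‖z₀‖ < 1 from hz₀)
  have hU : Metric.ball (0 : ℂ) r ∈ nhds z₀ :=
    Metric.isOpen_ball.mem_nhds (mem_ball_zero_iff.2 hr0)
  have hb : ∀ z ∈ Metric.ball (0 : ℂ) r, z ∈ disk := fun z hz =>
    (mem_ball_zero_iff.1 hz).trans hr
  have hderiv : ∀ t, ∀ z ∈ Metric.ball (0 : ℂ) r,
      HasDerivAt (fun z => szego z t * (starRingEnd ℂ) (szego w t))
        (expNeg t * szego z t ^ 2 * (starRingEnd ℂ) (szego w t)) z := fun t z hz => by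
    have h0 := one_sub_mul_expNeg_ne_zero (hb z hz) t
    have h1 : HasDerivAt (fun z => 1 - z * expNeg t) (-(1 * expNeg t)) z :=
      ((hasDerivAt_id z).mul_const (expNeg t)).const_sub 1
    have h2 := (h1.inv h0).mul_const ((starRingEnd ℂ) (szego w t))
    simp only [szego, one_div] at h2 ⊢
    have h3 : expNeg t * (1 - z * expNeg t)⁻¹ ^ 2 * (starRingEnd ℂ) (1 - w * expNeg t)⁻¹ =
        - -(1 * expNeg t) / (1 - z * expNeg t) ^ 2 * (starRingEnd ℂ) (1 - w * expNeg t)⁻¹ := by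
      rw [neg_neg, one_mul, inv_pow, div_eq_mul_inv]
    rw [h3]
    exact h2
  have key := hasDerivAt_integral_of_dominated_loc_of_deriv_le (μ := F)
    (F := fun z t => szego z t * (starRingEnd ℂ) (szego w t))
    (F' := fun z t => expNeg t * szego z t ^ 2 * (starRingEnd ℂ) (szego w t))
    (bound := fun _ => (1 - r)⁻¹ ^ 2 * (1 - ‖w‖)⁻¹) hU
    (Filter.eventually_of_mem hU fun z hz =>
      (integrable_szego_mul_conj F (hb z hz) hw).aestronglyMeasurable)
    (integrable_szego_mul_conj F hz₀ hw)
    (((continuous_expNeg.mul ((continuous_szego hz₀).pow 2)).mul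
      (Complex.continuous_conj.comp (continuous_szego hw))).aestronglyMeasurable)
    (Filter.Eventually.of_forall fun t z hz => by
      rw [norm_mul, norm_mul, norm_expNeg, one_mul, norm_pow, RCLike.norm_conj]
      have h1 := norm_szego_le (hb z hz) t
      have h2 := norm_szego_le hw t
      have h3 : (1 - ‖z‖)⁻¹ ≤ (1 - r)⁻¹ :=
        inv_anti₀ (by linarith) (by linarith [mem_ball_zero_iff.1 hz])
      gcongr
      exact h1.trans h3)
    (integrable_const _)
    (Filter.Eventually.of_forall fun t z hz => hderiv t z hz)
  exact key.2.differentiableAt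

/-! ### Local suprema of Gaussian analytic functions -/

/-- A power of an analytic function is dominated inside the disk by its mean on a circle. -/
lemma norm_pow_le_integral_circle {f : ℂ → ℂ} (hf : DifferentiableOn ℂ f disk) {r R : ℝ}
    (hr : 0 ≤ r) (hrR : r < R) (hR : R < 1) (N : ℕ) {z : ℂ} (hz : ‖z‖ ≤ r) :
    ‖f z‖ ^ N ≤ R / (R - r) * ∫ θ in (0 : ℝ)..2 * Real.pi, ‖f (circleMap 0 R θ)‖ ^ N := by
  have hR0 : 0 < R := hr.trans_lt hrR
  have hd : DifferentiableOn ℂ (fun z => f z ^ N) (Metric.closedBall 0 R) :=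
    (hf.mono (closedBall_subset_disk hR)).pow N
  have hcirc : ∀ θ, circleMap 0 R θ ∈ disk := fun θ => by
    change ‖circleMap 0 R θ‖ < 1
    rwa [norm_circleMap_zero, abs_of_pos hR0]
  have hcont : Continuous fun θ : ℝ => f (circleMap 0 R θ) :=
    hf.continuousOn.comp_continuous (continuous_circleMap 0 R) hcirc
  have h := hd.circleIntegral_sub_inv_smul (w := z)
    (mem_ball_zero_iff.2 (hz.trans_lt hrR))
  -- Cauchy's formula for f^N: R is the modulus of dζ/dθ, and R - r bounds |ζ - z| from below. The
  -- factor 2π on the other side is discarded at the end.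
  have h2 : ‖∮ ζ in C(0, R), (ζ - z)⁻¹ • f ζ ^ N‖ ≤
      ∫ θ in (0 : ℝ)..2 * Real.pi, R / (R - r) * ‖f (circleMap 0 R θ)‖ ^ N := by
    rw [circleIntegral]
    refine intervalIntegral.norm_integral_le_of_norm_le (by positivity)
      (Filter.Eventually.of_forall fun θ _ => ?_)
      ((continuous_const.mul (hcont.norm.pow N)).intervalIntegrable _ _)
    rw [norm_smul, norm_smul, deriv_circleMap, norm_mul, norm_circleMap_zero, Complex.norm_I,
      mul_one, abs_of_pos hR0, norm_inv, norm_pow, ← mul_assoc, ← div_eq_mul_inv]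
    have : R - r ≤ ‖circleMap 0 R θ - z‖ := by
      have := norm_sub_norm_le (circleMap 0 R θ) z
      rw [norm_circleMap_zero, abs_of_pos hR0] at this
      linarith
    have h0 : 0 < R - r := by linarith
    gcongr
  rw [h, norm_smul, intervalIntegral.integral_const_mul] at h2
  have h3 : ‖(2 * Real.pi * Complex.I : ℂ)‖ = 2 * Real.pi := by
    simp [abs_of_pos Real.pi_pos]
  rw [h3, norm_pow] at h2
  refine le_trans ?_ h2
  have : 1 ≤ 2 * Real.pi := by linarith [Real.pi_gt_three]
  exact le_mul_of_one_le_left (by positivity) this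

lemma norm_permanent_le {n : ℕ} {A : Matrix (Fin n) (Fin n) ℂ} {M : ℝ}
    (hA : ∀ i j, ‖A i j‖ ≤ M) : ‖A.permanent‖ ≤ n.factorial * M ^ n := by
  rw [Matrix.permanent]
  refine (norm_sum_le _ _).trans ?_
  have : ∀ σ : Equiv.Perm (Fin n), ‖∏ i, A (σ i) i‖ ≤ M ^ n := fun σ => by
    rw [norm_prod]
    refine (Finset.prod_le_prod (fun _ _ => norm_nonneg _) fun i _ => hA (σ i) i).trans ?_
    simp
  refine (Finset.sum_le_sum fun σ _ => this σ).trans ?_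
  simp [Fintype.card_perm]

section Domination

variable {Ω : Type*} [MeasurableSpace Ω] {P : Measure Ω}
  {Y : ℂ → Ω → ℂ} {K : ℂ → ℂ → ℂ}

lemma IsGAF.integrable_norm_pow [IsProbabilityMeasure P] (hY : IsGAF P Y K) {z : ℂ}
    (hz : z ∈ disk) (N : ℕ) : Integrable (fun ω => ‖Y z ω‖ ^ N) P := by
  have h := ((hY.isCircularGaussian (w := fun _ : Fin 1 => z) fun _ => hz).gaussian.eval 0).memLp
    (p := N) (by simp)
  exact h.integrable_norm_pow'

/-- Wick's formula for N copies of the same point. -/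
lemma IsGAF.integral_norm_pow_le (hY : IsGAF P Y K) {z : ℂ} (hz : z ∈ disk) (N : ℕ) :
    ∫ ω, ‖Y z ω‖ ^ (2 * N) ∂P ≤ N.factorial * ‖K z z‖ ^ N := by
  have h := (hY.isCircularGaussian (w := fun _ : Fin N => z) fun _ => hz).integral_prod_norm_sq
  simp only [Finset.prod_const, Finset.card_univ, Fintype.card_fin, ← pow_mul] at h
  have h0 : 0 ≤ ∫ ω, ‖Y z ω‖ ^ (2 * N) ∂P := integral_nonneg fun ω => by positivity
  rw [← Real.norm_of_nonneg h0, ← Complex.norm_real, h]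
  exact norm_permanent_le fun i j => le_rfl

lemma IsGAF.integrable_integral_circle [IsProbabilityMeasure P] (hY : IsGAF P Y K)
    (hm : ∀ z ∈ disk, Measurable (Y z))
    (ha : ∀ ω, DifferentiableOn ℂ (fun z => Y z ω) disk) {R M : ℝ} (hR0 : 0 < R) (hR : R < 1)
    (hK : ∀ z, ‖z‖ = R → ‖K z z‖ ≤ M) (N : ℕ) :
    Integrable (fun ω => ∫ θ in (0 : ℝ)..2 * Real.pi, ‖Y (circleMap 0 R θ) ω‖ ^ (2 * N)) P := by
  have hnorm : ∀ θ, ‖circleMap 0 R θ‖ = R := fun θ => by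
    rw [norm_circleMap_zero, abs_of_pos hR0]
  have hcirc : ∀ θ, circleMap 0 R θ ∈ disk := fun θ => (hnorm θ).trans_lt hR
  have hmeas : Measurable (Function.uncurry fun θ ω => Y (circleMap 0 R θ) ω) :=
    measurable_uncurry_of_continuous_of_measurable
      (fun ω => (ha ω).continuousOn.comp_continuous (continuous_circleMap 0 R) hcirc)
      fun θ => hm _ (hcirc θ)
  have hmeas2 : Measurable fun p : Ω × ℝ => ‖Y (circleMap 0 R p.2) p.1‖ ^ (2 * N) :=
    ((hmeas.comp measurable_swap).norm).pow_const _
  have hint : Integrable (fun p : Ω × ℝ => ‖Y (circleMap 0 R p.2) p.1‖ ^ (2 * N))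
      (P.prod (volume.restrict (Set.Ioc 0 (2 * Real.pi)))) := by
    rw [integrable_prod_iff' hmeas2.aestronglyMeasurable]
    refine ⟨Filter.Eventually.of_forall fun θ => hY.integrable_norm_pow (hcirc θ) _, ?_⟩
    refine Integrable.of_bound (C := N.factorial * M ^ N)
      (StronglyMeasurable.integral_prod_left (f := fun ω θ => ‖‖Y (circleMap 0 R θ) ω‖ ^ (2 * N)‖)
        hmeas2.norm.stronglyMeasurable).aestronglyMeasurable
      (Filter.Eventually.of_forall fun θ => ?_)
    simp only [norm_pow, norm_norm]
    rw [Real.norm_of_nonneg (integral_nonneg fun ω => by positivity)]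
    refine (hY.integral_norm_pow_le (hcirc θ) N).trans ?_
    have := hK _ (hnorm θ)
    gcongr
  have := hint.integral_prod_left
  refine this.congr (Filter.Eventually.of_forall fun ω => ?_)
  simp only
  rw [intervalIntegral.integral_of_le (by positivity)]

/-- The supremum of a Gaussian analytic function and of its derivative on a compact disk has
moments. -/
theorem IsGAF.exists_dominating [IsProbabilityMeasure P] (hY : IsGAF P Y K)
    (hm : ∀ z ∈ disk, Measurable (Y z))
    (ha : ∀ ω, DifferentiableOn ℂ (fun z => Y z ω) disk)
    (hK : ∀ R < 1, ∃ M, ∀ z, ‖z‖ = R → ‖K z z‖ ≤ M) {r : ℝ} (hr0 : 0 ≤ r) (hr : r < 1) (n : ℕ) :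
    ∃ S : Ω → ℝ, (∀ ω, 0 ≤ S ω) ∧ Integrable (fun ω => S ω ^ (2 * n)) P ∧
      ∀ ω z, ‖z‖ ≤ r → ‖Y z ω‖ ≤ S ω ∧ ‖deriv (fun z => Y z ω) z‖ ≤ S ω := by
  suffices H : ∀ N : ℕ, N ≠ 0 → ∃ S : Ω → ℝ, (∀ ω, 0 ≤ S ω) ∧
      Integrable (fun ω => S ω ^ (2 * N)) P ∧
      ∀ ω z, ‖z‖ ≤ r → ‖Y z ω‖ ≤ S ω ∧ ‖deriv (fun z => Y z ω) z‖ ≤ S ω by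
    rcases eq_or_ne n 0 with rfl | hn
    · obtain ⟨S, h1, -, h3⟩ := H 1 one_ne_zero
      exact ⟨S, h1, by simp, h3⟩
    · exact H n hn
  intro N hN
  obtain ⟨r', hrr', hr'⟩ := exists_between hr
  obtain ⟨R, hr'R, hR⟩ := exists_between hr'
  have hr'0 : 0 ≤ r' := hr0.trans hrr'.le
  have hR0 : 0 < R := hr'0.trans_lt hr'R
  obtain ⟨M, hM⟩ := hK R hR
  have hT := hY.integrable_integral_circle hm ha hR0 hR hM N
  set T : Ω → ℝ := fun ω => ∫ θ in (0 : ℝ)..2 * Real.pi, ‖Y (circleMap 0 R θ) ω‖ ^ (2 * N)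
  have hT0 : ∀ ω, 0 ≤ T ω := fun ω =>
    intervalIntegral.integral_nonneg (by positivity) fun θ _ => by positivity
  have hC : 0 ≤ R / (R - r') := div_nonneg hR0.le (by linarith)
  -- A root of the circle mean, so that its 2N-th power is integrable. It bounds Y up to radius r';
  -- Cauchy's estimate on disks of radius r' - r then bounds the derivative up to radius r, whence
  -- the factor 1 + 1/(r' - r) below.
  set S₀ : Ω → ℝ := fun ω => (R / (R - r') * T ω) ^ ((2 * N : ℕ) : ℝ)⁻¹ with hS₀
  have hS₀0 : ∀ ω, 0 ≤ S₀ ω := fun ω => Real.rpow_nonneg (mul_nonneg hC (hT0 ω)) _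
  have hS₀pow : ∀ ω, S₀ ω ^ (2 * N) = R / (R - r') * T ω := fun ω =>
    Real.rpow_inv_natCast_pow (mul_nonneg hC (hT0 ω)) (by omega)
  have hS₀Y : ∀ ω z, ‖z‖ ≤ r' → ‖Y z ω‖ ≤ S₀ ω := fun ω z hz => by
    refine le_of_pow_le_pow_left₀ (n := 2 * N) (by omega) (hS₀0 ω) ?_
    rw [hS₀pow]
    exact norm_pow_le_integral_circle (ha ω) hr'0 hr'R hR _ hz
  have hd : 0 < r' - r := by linarith
  refine ⟨fun ω => (1 + 1 / (r' - r)) * S₀ ω, fun ω => mul_nonneg (by positivity) (hS₀0 ω), ?_,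
    fun ω z hz => ⟨?_, ?_⟩⟩
  · simp only [mul_pow, hS₀pow]
    exact (hT.const_mul _).const_mul _
  · refine (hS₀Y ω z (hz.trans hrr'.le)).trans (le_mul_of_one_le_left (hS₀0 ω) ?_)
    have : 0 ≤ 1 / (r' - r) := by positivity
    linarith
  · have hsub : Metric.closedBall z (r' - r) ⊆ Metric.closedBall 0 r' := by
      refine Metric.closedBall_subset_closedBall' ?_
      rw [dist_zero_right]
      linarith
    have hdc : DiffContOnCl ℂ (fun z => Y z ω) (Metric.ball z (r' - r)) := by
      refine DifferentiableOn.diffContOnCl ((ha ω).mono ?_)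
      rw [closure_ball _ hd.ne']
      exact hsub.trans (closedBall_subset_disk hr')
    have := Complex.norm_deriv_le_of_forall_mem_sphere_norm_le hd hdc (C := S₀ ω) fun v hv =>
      hS₀Y ω v (by simpa using hsub (Metric.sphere_subset_closedBall hv))
    refine this.trans ?_
    have h1 := hS₀0 ω
    rw [div_eq_mul_one_div, mul_comm]
    dsimp only
    linarith

end Domination

/-! ### The expected Kac-Rice density -/

/-- The configurations at which the Kac-Rice density of `y + ∑ u_j h_j` is regular. -/
def regularTuples {n : ℕ} (h : Fin n → ℂ → ℂ) : Set (Fin n → ℂ) :=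
  {z | (∀ i, z i ∈ disk) ∧ (evalMatrix h z).det ≠ 0}

section Regular

variable {n : ℕ} {h : Fin n → ℂ → ℂ}

lemma contDiffAt_evalMatrix (hh : ∀ j, DifferentiableOn ℂ (h j) disk) {z : Fin n → ℂ}
    (hz : ∀ i, z i ∈ disk) (i j : Fin n) : ContDiffAt ℂ 1 (fun z => evalMatrix h z i j) z :=
  contDiffAt_comp_apply i ((hh j).analyticOnNhd isOpen_disk _ (hz i))

lemma continuousAt_det_evalMatrix (hh : ∀ j, DifferentiableOn ℂ (h j) disk) {z : Fin n → ℂ}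
    (hz : ∀ i, z i ∈ disk) : ContinuousAt (fun z => (evalMatrix h z).det) z :=
  (contDiffAt_det (contDiffAt_evalMatrix hh hz)).continuousAt

lemma isOpen_forall_mem_disk : IsOpen {z : Fin n → ℂ | ∀ i, z i ∈ disk} := by
  simp only [Set.ofPred_forall]
  exact isOpen_iInter_of_finite fun i => isOpen_disk.preimage (continuous_apply i)

lemma isOpen_regularTuples (hh : ∀ j, DifferentiableOn ℂ (h j) disk) :
    IsOpen (regularTuples h) := by
  rw [isOpen_iff_mem_nhds]
  intro z hz
  exact Filter.inter_mem (isOpen_forall_mem_disk.mem_nhds hz.1)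
    ((continuousAt_det_evalMatrix hh hz.1).eventually_ne hz.2)

lemma continuousAt_inv_evalMatrix (hh : ∀ j, DifferentiableOn ℂ (h j) disk) {z : Fin n → ℂ}
    (hz : z ∈ regularTuples h) (i j : Fin n) :
    ContinuousAt (fun z => (evalMatrix h z)⁻¹ i j) z := by
  have hM : ContinuousAt (fun z => evalMatrix h z) z :=
    continuousAt_pi.2 fun i => continuousAt_pi.2 fun j =>
      (contDiffAt_evalMatrix hh hz.1 i j).continuousAt
  have hadj : ContinuousAt (fun z => (evalMatrix h z).adjugate i j) z :=
    (((continuous_id (X := Matrix (Fin n) (Fin n) ℂ)).matrix_adjugate.matrix_elem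
      i j).continuousAt.comp hM :)
  simp only [Matrix.inv_def, Matrix.smul_apply, Ring.inverse_eq_inv', smul_eq_mul]
  exact ((continuousAt_det_evalMatrix hh hz.1).inv₀ hz.2).mul hadj

lemma continuousAt_deriv_apply {f : ℂ → ℂ} (hf : DifferentiableOn ℂ f disk) {z : Fin n → ℂ}
    {i : Fin n} (hz : z i ∈ disk) : ContinuousAt (fun z : Fin n → ℂ => deriv f (z i)) z :=
  ContinuousAt.comp (g := deriv f) (f := fun z : Fin n → ℂ => z i)
    ((hf.deriv isOpen_disk).continuousOn.continuousAt (isOpen_disk.mem_nhds hz))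
    (continuous_apply i).continuousAt

lemma continuousAt_kacRiceDensity (hh : ∀ j, DifferentiableOn ℂ (h j) disk) {y : ℂ → ℂ}
    (hy : DifferentiableOn ℂ y disk) {z : Fin n → ℂ} (hz : z ∈ regularTuples h) :
    ContinuousAt (kacRiceDensity h stdDensityPi y) z := by
  have hΦ : ContinuousAt (zeroCoeff h y) z := (contDiffAt_zeroCoeff hz.2
    (fun i => hy.analyticOnNhd isOpen_disk _ (hz.1 i))
    fun i j => (hh j).analyticOnNhd isOpen_disk _ (hz.1 i)).continuousAt
  have hΦj : ∀ j, ContinuousAt (fun z => zeroCoeff h y z j) z := continuousAt_pi.1 hΦ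
  unfold kacRiceDensity
  refine ((continuous_stdDensityPi.continuousAt).comp hΦ).mul (ContinuousAt.div ?_
    ((continuousAt_det_evalMatrix hh hz.1).norm.pow 2) (by simpa using hz.2))
  exact tendsto_finsetProd _ fun i _ => ((continuousAt_deriv_apply hy (hz.1 i)).add
    (tendsto_finsetSum _ fun j _ => (continuousAt_deriv_apply (hh j) (hz.1 i)).mul
      (hΦj j))).norm.pow 2

lemma stdDensityPi_le_one (u : Fin n → ℂ) : stdDensityPi u ≤ 1 := by
  refine Finset.prod_le_one (fun _ _ => stdDensity_nonneg _) fun j _ => ?_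
  rw [stdDensity, div_le_one Real.pi_pos]
  have : Real.exp (-‖u j‖ ^ 2) ≤ 1 := Real.exp_le_one_iff.2 (by simp)
  linarith [Real.pi_gt_three]

lemma kacRiceDensity_nonneg (y : ℂ → ℂ) (z : Fin n → ℂ) :
    0 ≤ kacRiceDensity h stdDensityPi y z :=
  mul_nonneg (stdDensityPi_nonneg _) (by positivity)

/-- On a compact set of regular configurations the Kac-Rice density is bounded in terms of the
suprema of the random function and of its derivative. -/
lemma exists_kacRiceDensity_le (hh : ∀ j, DifferentiableOn ℂ (h j) disk) {C : Set (Fin n → ℂ)}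
    (hC : IsCompact C) (hCr : C ⊆ regularTuples h) :
    ∃ A : ℝ, ∀ (y : ℂ → ℂ) (S : ℝ), 0 ≤ S → ∀ z ∈ C,
      (∀ i, ‖y (z i)‖ ≤ S ∧ ‖deriv y (z i)‖ ≤ S) →
        kacRiceDensity h stdDensityPi y z ≤ A * S ^ (2 * n) := by
  have hg : ContinuousOn (fun z : Fin n → ℂ => (∑ i, ∑ j, ‖(evalMatrix h z)⁻¹ i j‖) +
      (∑ i, ∑ j, ‖deriv (h j) (z i)‖) + (‖(evalMatrix h z).det‖ ^ 2)⁻¹) C := fun z hz => by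
    have hz' := hCr hz
    refine ContinuousAt.continuousWithinAt (ContinuousAt.add (ContinuousAt.add
      (tendsto_finsetSum _ fun i _ => tendsto_finsetSum _ fun j _ =>
        (continuousAt_inv_evalMatrix hh hz' i j).norm)
      (tendsto_finsetSum _ fun i _ => tendsto_finsetSum _ fun j _ =>
        (continuousAt_deriv_apply (hh j) (hz'.1 i)).norm))
      (((continuousAt_det_evalMatrix hh hz'.1).norm.pow 2).inv₀ (by simpa using hz'.2)))
  obtain ⟨A, hA⟩ := hC.exists_bound_of_continuousOn hg
  -- `A` bounds the inverse matrix and the derivatives of the h_j (row sums), and also 1/|det|². The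
  -- solution u is then at most A·S, each derivative factor at most (1 + A²)S, and n squared factors
  -- give the exponent 2n.
  refine ⟨((1 + A * A) ^ (2 * n)) * A, fun y S hS z hz hy => ?_⟩
  have hb := (Real.le_norm_self _).trans (hA z hz)
  have h1 : 0 ≤ ∑ i, ∑ j, ‖(evalMatrix h z)⁻¹ i j‖ :=
    Finset.sum_nonneg fun _ _ => Finset.sum_nonneg fun _ _ => norm_nonneg _
  have h2 : 0 ≤ ∑ i, ∑ j, ‖deriv (h j) (z i)‖ :=
    Finset.sum_nonneg fun _ _ => Finset.sum_nonneg fun _ _ => norm_nonneg _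
  have h3 : 0 ≤ (‖(evalMatrix h z).det‖ ^ 2)⁻¹ := by positivity
  have hA0 : 0 ≤ A := by linarith
  have b1 : ∀ i, ∑ j, ‖(evalMatrix h z)⁻¹ i j‖ ≤ A := fun i => by
    have := Finset.single_le_sum (f := fun i => ∑ j, ‖(evalMatrix h z)⁻¹ i j‖)
      (fun _ _ => Finset.sum_nonneg fun _ _ => norm_nonneg _) (Finset.mem_univ i)
    linarith
  have b2 : ∀ i, ∑ j, ‖deriv (h j) (z i)‖ ≤ A := fun i => by
    have := Finset.single_le_sum (f := fun i => ∑ j, ‖deriv (h j) (z i)‖)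
      (fun _ _ => Finset.sum_nonneg fun _ _ => norm_nonneg _) (Finset.mem_univ i)
    linarith
  have hΦ : ∀ j, ‖zeroCoeff h y z j‖ ≤ A * S := fun j => by
    rw [zeroCoeff, Pi.neg_apply, norm_neg, Matrix.mulVec, dotProduct]
    refine (norm_sum_le _ _).trans ?_
    refine (Finset.sum_le_sum fun i _ => ?_).trans
      ((Finset.sum_mul _ _ S).symm.le.trans (mul_le_mul_of_nonneg_right (b1 j) hS))
    rw [norm_mul]
    exact mul_le_mul_of_nonneg_left (hy i).1 (norm_nonneg _)
  have hc : ∀ i, ‖deriv y (z i) + ∑ j, deriv (h j) (z i) * zeroCoeff h y z j‖ ≤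
      (1 + A * A) * S := fun i => by
    have : ‖∑ j, deriv (h j) (z i) * zeroCoeff h y z j‖ ≤ A * (A * S) := by
      refine (norm_sum_le _ _).trans ((Finset.sum_le_sum fun j _ => ?_).trans
        ((Finset.sum_mul _ _ (A * S)).symm.le.trans
          (mul_le_mul_of_nonneg_right (b2 i) (mul_nonneg hA0 hS))))
      rw [norm_mul]
      exact mul_le_mul_of_nonneg_left (hΦ j) (norm_nonneg _)
    have := (norm_add_le (deriv y (z i)) (∑ j, deriv (h j) (z i) * zeroCoeff h y z j)).trans
      (add_le_add (hy i).2 this)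
    linarith
  have hprod : ∏ i, ‖deriv y (z i) + ∑ j, deriv (h j) (z i) * zeroCoeff h y z j‖ ^ 2 ≤
      ((1 + A * A) * S) ^ (2 * n) := by
    refine (Finset.prod_le_prod (fun _ _ => by positivity) fun i _ =>
      pow_le_pow_left₀ (norm_nonneg _) (hc i) 2).trans ?_
    rw [Finset.prod_const, Finset.card_univ, Fintype.card_fin, ← pow_mul]
  calc kacRiceDensity h stdDensityPi y z ≤ 1 * (((1 + A * A) * S) ^ (2 * n) * A) := by
        rw [kacRiceDensity, div_eq_mul_inv]
        refine mul_le_mul (stdDensityPi_le_one _) (mul_le_mul hprod (by linarith) h3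
          (by positivity)) (by positivity) zero_le_one
    _ = _ := by rw [mul_pow]; ring

end Regular

section Expectation

variable {Ω : Type*} [MeasurableSpace Ω] {P : Measure Ω} {Y : ℂ → Ω → ℂ} {K : ℂ → ℂ → ℂ}
  {n : ℕ} {h : Fin n → ℂ → ℂ}

lemma measurable_deriv_apply (hm : ∀ z ∈ disk, Measurable (Y z))
    (ha : ∀ ω, DifferentiableOn ℂ (fun z => Y z ω) disk) {z : ℂ} (hz : z ∈ disk) :
    Measurable fun ω => deriv (fun z => Y z ω) z := by
  classical
  refine measurable_of_tendsto_metrizable' (nhdsWithin z {z}ᶜ)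
    (f := fun v ω => if v ∈ disk then slope (fun z => Y z ω) z v else 0) (fun v => ?_)
    (tendsto_pi_nhds.2 fun ω => ?_)
  · by_cases hv : v ∈ disk
    · simp only [hv, if_true, slope_def_field]
      exact ((hm v hv).sub (hm z hz)).div_const _
    · simp only [hv, if_false]
      exact measurable_const
  · have := hasDerivAt_iff_tendsto_slope.1
      ((ha ω).differentiableAt (isOpen_disk.mem_nhds hz)).hasDerivAt
    refine this.congr' ?_
    filter_upwards [mem_nhdsWithin_of_mem_nhds (isOpen_disk.mem_nhds hz)] with v hv
    rw [if_pos hv]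

lemma measurable_kacRiceDensity (hm : ∀ z ∈ disk, Measurable (Y z))
    (ha : ∀ ω, DifferentiableOn ℂ (fun z => Y z ω) disk) {z : Fin n → ℂ} (hz : ∀ i, z i ∈ disk) :
    Measurable fun ω => kacRiceDensity h stdDensityPi (fun z => Y z ω) z := by
  have hΦ : ∀ j, Measurable fun ω => zeroCoeff h (fun z => Y z ω) z j := fun j => by
    simp only [zeroCoeff, Pi.neg_apply, Matrix.mulVec, dotProduct]
    exact (Finset.measurable_fun_sum _ fun i _ => (hm _ (hz i)).const_mul _).neg
  unfold kacRiceDensity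
  refine (continuous_stdDensityPi.measurable.comp (measurable_pi_iff.2 hΦ)).mul
    (Measurable.div_const (Finset.measurable_fun_prod _ fun i _ => Measurable.pow_const
      (Measurable.norm ((measurable_deriv_apply hm ha (hz i)).add
        (Finset.measurable_fun_sum _ fun j _ => (hΦ j).const_mul _))) _) _)

/-- Near a regular configuration the expected Kac-Rice density is continuous, and expectations can
be exchanged with integrals. -/
theorem IsGAF.exists_expected_kacRiceDensity [IsProbabilityMeasure P] (hY : IsGAF P Y K)
    (hm : ∀ z ∈ disk, Measurable (Y z))
    (ha : ∀ ω, DifferentiableOn ℂ (fun z => Y z ω) disk)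
    (hK : ∀ R < 1, ∃ M, ∀ z, ‖z‖ = R → ‖K z z‖ ≤ M)
    (hh : ∀ j, DifferentiableOn ℂ (h j) disk) {w : Fin n → ℂ} (hw : w ∈ regularTuples h) :
    ∃ δ > 0, Metric.ball w δ ⊆ regularTuples h ∧
      ContinuousOn (fun z => ∫ ω, kacRiceDensity h stdDensityPi (fun z => Y z ω) z ∂P)
        (Metric.ball w δ) ∧
      ∀ B ⊆ Metric.ball w δ, MeasurableSet B →
        ∫⁻ ω, (∫⁻ z in B, ENNReal.ofReal (kacRiceDensity h stdDensityPi (fun z => Y z ω) z)) ∂P =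
          ∫⁻ z in B,
            ENNReal.ofReal (∫ ω, kacRiceDensity h stdDensityPi (fun z => Y z ω) z ∂P) := by
  classical
  obtain ⟨δ, hδ, hsub⟩ := Metric.nhds_basis_closedBall.mem_iff.1
    ((isOpen_regularTuples hh).mem_nhds hw)
  have hcomp : IsCompact (Metric.closedBall w δ) := isCompact_closedBall w δ
  obtain ⟨r, hr0, hr1, hr⟩ : ∃ r : ℝ, 0 ≤ r ∧ r < 1 ∧
      ∀ z ∈ Metric.closedBall w δ, ∀ i, ‖z i‖ ≤ r := by
    obtain ⟨z₀, hz₀, hmax⟩ := hcomp.exists_isMaxOn ⟨w, Metric.mem_closedBall_self hδ.le⟩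
      continuous_norm.continuousOn
    refine ⟨‖z₀‖, norm_nonneg _, (pi_norm_lt_iff one_pos).2 (hsub hz₀).1, fun z hz i => ?_⟩
    exact (norm_le_pi_norm z i).trans (hmax hz)
  obtain ⟨S, hS0, hSint, hS⟩ := hY.exists_dominating hm ha hK hr0 hr1 n
  obtain ⟨A, hA⟩ := exists_kacRiceDensity_le hh hcomp hsub
  set J : (Fin n → ℂ) → Ω → ℝ := fun z ω => kacRiceDensity h stdDensityPi (fun z => Y z ω) z
    with hJ
  have hball : Metric.ball w δ ⊆ Metric.closedBall w δ := Metric.ball_subset_closedBall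
  have hJ0 : ∀ z ω, 0 ≤ J z ω := fun z ω => kacRiceDensity_nonneg _ _
  have hJle : ∀ z ∈ Metric.ball w δ, ∀ ω, J z ω ≤ A * S ω ^ (2 * n) := fun z hz ω =>
    hA _ _ (hS0 ω) z (hball hz) fun i => hS ω _ (hr z (hball hz) i)
  have hJm : ∀ z ∈ Metric.ball w δ, Measurable (J z) := fun z hz =>
    measurable_kacRiceDensity hm ha (hsub (hball hz)).1
  have hJnorm : ∀ z ∈ Metric.ball w δ, ∀ᵐ ω ∂P, ‖J z ω‖ ≤ A * S ω ^ (2 * n) := fun z hz =>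
    Filter.Eventually.of_forall fun ω => by
      rw [Real.norm_of_nonneg (hJ0 z ω)]
      exact hJle z hz ω
  have hJint : ∀ z ∈ Metric.ball w δ, Integrable (J z) P := fun z hz =>
    (hSint.const_mul A).mono' (hJm z hz).aestronglyMeasurable (hJnorm z hz)
  have hJc : ∀ ω, ContinuousOn (fun z => J z ω) (Metric.ball w δ) := fun ω z hz =>
    (continuousAt_kacRiceDensity hh (ha ω) (hsub (hball hz))).continuousWithinAt
  refine ⟨δ, hδ, hball.trans hsub, continuousOn_of_dominated
    (fun z hz => (hJm z hz).aestronglyMeasurable) hJnorm (hSint.const_mul A)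
    (Filter.Eventually.of_forall hJc), fun B hB hBm => ?_⟩
  -- Tonelli needs joint measurability. The density is continuous in z and measurable in ω on the
  -- ball, hence jointly measurable there, and is extended by 0.
  set g : (Fin n → ℂ) × Ω → ℝ := fun p =>
    if hp : p ∈ {p : (Fin n → ℂ) × Ω | p.1 ∈ Metric.ball w δ} then J p.1 p.2 else 0 with hg
  have hgm : Measurable g := by
    have hu : Measurable (Function.uncurry fun (z : Metric.ball w δ) ω => J z ω) :=
      measurable_uncurry_of_continuous_of_measurable
        (fun ω => continuousOn_iff_continuous_domRestrict.1 (hJc ω)) fun z => hJm z z.2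
    refine Measurable.dite (s := {p : (Fin n → ℂ) × Ω | p.1 ∈ Metric.ball w δ})
      (f := fun q => J q.1.1 q.1.2) ?_ (g := fun _ => 0) measurable_const
      (measurable_fst Metric.isOpen_ball.measurableSet)
    exact hu.comp (g := Function.uncurry fun (z : Metric.ball w δ) ω => J z ω)
      (f := fun q : {p : (Fin n → ℂ) × Ω | p.1 ∈ Metric.ball w δ} =>
        ((⟨q.1.1, q.2⟩ : Metric.ball w δ), q.1.2))
      (((measurable_fst.comp measurable_subtype_coe).subtype_mk).prodMk
        (measurable_snd.comp measurable_subtype_coe))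
  have hgJ : ∀ z ∈ B, ∀ ω, g (z, ω) = J z ω := fun z hz ω => dif_pos (hB hz)
  calc ∫⁻ ω, (∫⁻ z in B, ENNReal.ofReal (J z ω)) ∂P
      = ∫⁻ ω, (∫⁻ z in B, ENNReal.ofReal (g (z, ω))) ∂P :=
        lintegral_congr fun ω => setLIntegral_congr_fun hBm fun z hz => by rw [hgJ z hz]
    _ = ∫⁻ z in B, (∫⁻ ω, ENNReal.ofReal (g (z, ω)) ∂P) :=
        lintegral_lintegral_swap (hgm.comp measurable_swap).ennreal_ofReal.aemeasurable
    _ = _ := by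
        refine setLIntegral_congr_fun hBm fun z hz => ?_
        simp only [hgJ z hz]
        exact (ofReal_integral_eq_lintegral_ofReal (hJint z (hB hz))
          (Filter.Eventually.of_forall (hJ0 z))).symm

end Expectation

/-! ### The formula for the correlation function -/

section Products

variable {n : ℕ}

/-- Each unordered pair contributes twice, once from either end. -/
lemma norm_prod_prod_erase_sub (w : Fin n → ℂ) :
    ‖∏ i, ∏ l ∈ Finset.univ.erase i, (w i - w l)‖ = ‖vand w‖ ^ 2 := by
  have h1 : ∀ i, ∏ l ∈ Finset.univ.erase i, ‖w i - w l‖ =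
      (∏ l ∈ Finset.Iio i, ‖w i - w l‖) * ∏ l ∈ Finset.Ioi i, ‖w l - w i‖ := fun i => by
    have : Finset.univ.erase i = Finset.Iio i ∪ Finset.Ioi i := by
      ext l
      simp only [Finset.mem_erase, Finset.mem_univ, and_true, Finset.mem_union, Finset.mem_Iio,
        Finset.mem_Ioi]
      exact ne_iff_lt_or_gt
    rw [this, Finset.prod_union (Finset.disjoint_left.2 fun l h1 h2 =>
      lt_asymm (Finset.mem_Iio.1 h1) (Finset.mem_Ioi.1 h2))]
    simp only [norm_sub_rev]
  have h2 : ∏ i, ∏ l ∈ Finset.Iio i, ‖w i - w l‖ = ∏ i, ∏ l ∈ Finset.Ioi i, ‖w l - w i‖ :=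
    Finset.prod_comm' fun i l => by simp
  simp only [norm_prod, h1, Finset.prod_mul_distrib]
  rw [h2, vand, Matrix.det_vandermonde]
  simp only [norm_prod]
  ring

/-- Every term of a permanent uses each row and each column exactly once. -/
lemma permanent_mul_mul_conj (c : Fin n → ℂ) (k : Fin n → Fin n → ℂ) :
    (Matrix.of fun i j => c i * (starRingEnd ℂ) (c j) * k i j).permanent =
      ((‖∏ i, c i‖ ^ 2 : ℝ) : ℂ) * (Matrix.of k).permanent := by
  simp only [Matrix.permanent, Finset.mul_sum, Matrix.of_apply]
  refine Finset.sum_congr rfl fun σ _ => ?_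
  rw [Finset.prod_mul_distrib, Finset.prod_mul_distrib, Equiv.prod_comp σ c, ← map_prod]
  push_cast
  rw [Complex.mul_conj']

end Products

section Formula

variable (F : Measure Torus) {n m : ℕ}

/-- The kernel `K_a^{(m)}` before normalization. -/
def weightedKernel (a : Fin n → ℂ) (m : ℕ) (z w : ℂ) : ℂ :=
  ∫ t, ((vandDensity a t : ℝ) : ℂ) * ((∏ k, szego z (t k)) *
    (starRingEnd ℂ) (∏ k, szego w (t k))) ∂(Measure.pi fun _ : Fin m => F)

/-- The asserted formula for the `n`-point correlation function. -/
def zeroDensity (a : Fin n → ℂ) : ℂ :=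
  1 / (Real.pi : ℂ) ^ n * ((‖vand a‖ ^ 2 : ℝ) : ℂ) /
    (((vandMeasure F a n).real Set.univ : ℝ) : ℂ) ^ (n + 1) *
    (Matrix.of fun p q => weightedKernel F a (n + 1) (a p) (a q)).permanent

variable [IsProbabilityMeasure F]

/-- The permanent is homogeneous of degree n, so the n-th power of the mass of μ̃_a is absorbed into
the kernel. The unnormalized form needs no division by that mass, which suits continuity and the
case μ̃_a = 0. -/
lemma zeroDensity_eq {a : Fin n → ℂ} (ha : ∀ i, a i ∈ disk) :
    zeroDensity F a = 1 / (Real.pi : ℂ) ^ n * ((‖vand a‖ ^ 2 : ℝ) : ℂ) *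
      ((((vandMeasure F a (n + 1)).real Set.univ ^ n /
        (vandMeasure F a n).real Set.univ ^ (n + 1) : ℝ)) : ℂ) *
      Matrix.permanent
        (Matrix.of fun p q : Fin n => tiltedKernel F a (n + 1) (a p) (a q)) := by
  have h : (Matrix.of fun p q => weightedKernel F a (n + 1) (a p) (a q)) =
      (((vandMeasure F a (n + 1)).real Set.univ : ℝ) : ℂ) •
        (Matrix.of fun p q : Fin n => tiltedKernel F a (n + 1) (a p) (a q)) := by
    ext p q
    rw [Matrix.smul_apply, Matrix.of_apply, Matrix.of_apply, smul_eq_mul, mul_tiltedKernel F ha,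
      weightedKernel]
  rw [zeroDensity, h, Matrix.permanent_smul, Fintype.card_fin]
  push_cast
  ring

lemma szego_zero_left (t : Torus) : szego 0 t = 1 := by simp [szego]

/-- Since s(0,t) = 1, continuity of the mass in a is a special case of continuity of the kernel. -/
lemma vandMeasure_real_univ_eq_weightedKernel {a : Fin n → ℂ} (ha : ∀ i, a i ∈ disk) :
    (((vandMeasure F a m).real Set.univ : ℝ) : ℂ) = weightedKernel F a m 0 0 := by
  rw [vandMeasure_real_univ F ha, ← integral_complex_ofReal, weightedKernel]
  simp [szego_zero_left]

lemma continuousAt_szego {z : ℂ} (hz : z ∈ disk) (t : Torus) :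
    ContinuousAt (fun z => szego z t) z := by
  unfold szego
  exact continuousAt_const.div (by fun_prop) (one_sub_mul_expNeg_ne_zero hz t)

lemma continuousAt_weightedKernel {a : Fin n → ℂ} (ha : ∀ i, a i ∈ disk) {z w : ℂ}
    (hz : z ∈ disk) (hw : w ∈ disk) :
    ContinuousAt (fun p : (Fin n → ℂ) × ℂ × ℂ => weightedKernel F p.1 m p.2.1 p.2.2)
      (a, z, w) := by
  set b : (Fin n → ℂ) × ℂ × ℂ → ℝ := fun p =>
    (1 / (m.factorial : ℝ) * (m.factorial : ℝ) ^ 2 * (∏ j, (1 - ‖p.1 j‖)⁻¹ ^ m) ^ 2) *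
      ((1 - ‖p.2.1‖)⁻¹ ^ m * (1 - ‖p.2.2‖)⁻¹ ^ m) with hb
  have hpos : ∀ {v : ℂ}, v ∈ disk → 1 - ‖v‖ ≠ 0 := fun {v} hv => by
    have : ‖v‖ < 1 := hv
    linarith
  have hbc : ContinuousAt b (a, z, w) := by
    refine ContinuousAt.mul (continuousAt_const.mul (ContinuousAt.pow
      (tendsto_finsetProd _ fun j _ => ?_) 2)) (ContinuousAt.mul ?_ ?_)
    · exact ((by fun_prop : ContinuousAt (fun p : (Fin n → ℂ) × ℂ × ℂ => 1 - ‖p.1 j‖)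
        (a, z, w)).inv₀ (hpos (ha j))).pow m
    · exact ((by fun_prop : ContinuousAt (fun p : (Fin n → ℂ) × ℂ × ℂ => 1 - ‖p.2.1‖)
        (a, z, w)).inv₀ (hpos hz)).pow m
    · exact ((by fun_prop : ContinuousAt (fun p : (Fin n → ℂ) × ℂ × ℂ => 1 - ‖p.2.2‖)
        (a, z, w)).inv₀ (hpos hw)).pow m
  have hU : ∀ᶠ p : (Fin n → ℂ) × ℂ × ℂ in nhds (a, z, w),
      (∀ i, p.1 i ∈ disk) ∧ p.2.1 ∈ disk ∧ p.2.2 ∈ disk := by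
    have h1 : ContinuousAt (fun p : (Fin n → ℂ) × ℂ × ℂ => p.1) (a, z, w) := by fun_prop
    have h2 : ContinuousAt (fun p : (Fin n → ℂ) × ℂ × ℂ => p.2.1) (a, z, w) := by fun_prop
    have h3 : ContinuousAt (fun p : (Fin n → ℂ) × ℂ × ℂ => p.2.2) (a, z, w) := by fun_prop
    exact (h1.eventually (isOpen_forall_mem_disk.mem_nhds ha)).and
      ((h2.eventually (isOpen_disk.mem_nhds hz)).and
      (h3.eventually (isOpen_disk.mem_nhds hw)))
  -- The pointwise bound `b` is uniform in t and continuous in the parameters, so near the base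
  -- point it stays below its value there plus 1.
  refine continuousAt_of_dominated (bound := fun _ => b (a, z, w) + 1) ?_ ?_ (integrable_const _) ?_
  · filter_upwards [hU] with p hp
    refine Continuous.aestronglyMeasurable ?_
    refine (Complex.continuous_ofReal.comp (continuous_vandDensity hp.1)).mul
      ((continuous_finsetProd _ fun k _ => (continuous_szego hp.2.1).comp (continuous_apply k)).mul
      (Complex.continuous_conj.comp
        (continuous_finsetProd _ fun k _ => (continuous_szego hp.2.2).comp (continuous_apply k))))
  · filter_upwards [hU, hbc.eventually (gt_mem_nhds (lt_add_one (b (a, z, w))))] with p hp hlt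
    refine Filter.Eventually.of_forall fun t => le_trans ?_ hlt.le
    rw [norm_mul, norm_mul, RCLike.norm_conj, Complex.norm_real,
      Real.norm_of_nonneg (vandDensity_nonneg _ _)]
    have h1 := vandDensity_le hp.1 t
    have h2 := norm_prod_szego_le hp.2.1 t
    have h3 := norm_prod_szego_le hp.2.2 t
    have h0 := vandDensity_nonneg p.1 t
    have h4 : 0 ≤ (1 - ‖p.2.1‖)⁻¹ ^ m := (norm_nonneg _).trans h2
    exact mul_le_mul h1 (mul_le_mul h2 h3 (norm_nonneg _) h4)
      (mul_nonneg (norm_nonneg _) (norm_nonneg _)) (h0.trans h1)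
  · refine Filter.Eventually.of_forall fun t => ?_
    have hS : ContinuousAt (fun p : (Fin n → ℂ) × ℂ × ℂ => szegoProd p.1 t) (a, z, w) :=
      tendsto_finsetProd _ fun j _ => tendsto_finsetProd _ fun k _ =>
        ContinuousAt.comp (g := fun z => szego z (t k))
          (f := fun p : (Fin n → ℂ) × ℂ × ℂ => p.1 j) (continuousAt_szego (ha j) _) (by fun_prop)
    have h1 : ContinuousAt (fun p : (Fin n → ℂ) × ℂ × ℂ => ∏ k, szego p.2.1 (t k)) (a, z, w) :=
      tendsto_finsetProd _ fun k _ => ContinuousAt.comp (g := fun z => szego z (t k))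
          (f := fun p : (Fin n → ℂ) × ℂ × ℂ => p.2.1) (continuousAt_szego hz _) (by fun_prop)
    have h2 : ContinuousAt (fun p : (Fin n → ℂ) × ℂ × ℂ => ∏ k, szego p.2.2 (t k)) (a, z, w) :=
      tendsto_finsetProd _ fun k _ => ContinuousAt.comp (g := fun z => szego z (t k))
          (f := fun p : (Fin n → ℂ) × ℂ × ℂ => p.2.2) (continuousAt_szego hw _) (by fun_prop)
    unfold vandDensity
    exact (Complex.continuous_ofReal.continuousAt.comp (continuousAt_const.mul (hS.norm.pow 2))).mul
      (h1.mul (Complex.continuous_conj.continuousAt.comp h2))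

lemma continuousAt_vand (a : Fin n → ℂ) : ContinuousAt (vand : (Fin n → ℂ) → ℂ) a := by
  refine Continuous.continuousAt ?_
  unfold vand
  refine Continuous.matrix_det (continuous_matrix fun i j => ?_)
  simp only [Matrix.vandermonde_apply]
  exact (continuous_apply i).pow _

lemma continuousAt_permanent {E : Type*} [TopologicalSpace E] {x : E}
    {A : E → Matrix (Fin n) (Fin n) ℂ} (hA : ∀ i j, ContinuousAt (fun y => A y i j) x) :
    ContinuousAt (fun y => (A y).permanent) x :=
  tendsto_finsetSum _ fun _ _ => tendsto_finsetProd _ fun _ _ => hA _ _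

lemma continuousAt_zeroDensity {a : Fin n → ℂ} (ha : ∀ i, a i ∈ disk)
    (hμ : (vandMeasure F a n).real Set.univ ≠ 0) :
    ContinuousAt (zeroDensity F : (Fin n → ℂ) → ℂ) a := by
  have hW : ∀ (m : ℕ) (f g : (Fin n → ℂ) → ℂ), Continuous f → Continuous g → f a ∈ disk →
      g a ∈ disk → ContinuousAt (fun b : Fin n → ℂ => weightedKernel F b m (f b) (g b)) a :=
    fun m f g hf hg hfa hga => ContinuousAt.comp
      (g := fun p : (Fin n → ℂ) × ℂ × ℂ => weightedKernel F p.1 m p.2.1 p.2.2)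
      (f := fun b => (b, f b, g b)) (continuousAt_weightedKernel F ha hfa hga) (by fun_prop)
  have h0 : (0 : ℂ) ∈ disk := by simp [disk]
  have hμc : ContinuousAt (fun b => (((vandMeasure F b n).real Set.univ : ℝ) : ℂ)) a := by
    refine (hW n (fun _ => 0) (fun _ => 0) continuous_const continuous_const h0 h0).congr ?_
    filter_upwards [isOpen_forall_mem_disk.mem_nhds ha] with b hb
    exact (vandMeasure_real_univ_eq_weightedKernel F hb).symm
  unfold zeroDensity
  refine ContinuousAt.mul (ContinuousAt.div (continuousAt_const.mul
    (Complex.continuous_ofReal.continuousAt.comp ((continuousAt_vand a).norm.pow 2)))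
    (hμc.pow _) (pow_ne_zero _ (by exact_mod_cast hμ))) (continuousAt_permanent fun i j => ?_)
  exact hW (n + 1) (fun b => b i) (fun b => b j) (continuous_apply i) (continuous_apply j)
    (ha i) (ha j)

end Formula

/-! ### The local correlation density -/

section Value

variable {Ω : Type*} [MeasurableSpace Ω] {P : Measure Ω} [IsProbabilityMeasure P]
  (F : Measure Torus) [IsProbabilityMeasure F] {n : ℕ}

lemma condKernel_eq_weightedKernel {a : Fin n → ℂ} (ha : ∀ i, a i ∈ disk)
    (hdet : (covMatrix F a a).det ≠ 0) {z w : ℂ} (hz : z ∈ disk) (hw : w ∈ disk) :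
    condKernel F a z w = (∏ j, (z - a j)) * (starRingEnd ℂ) (∏ j, (w - a j)) *
      (((((vandMeasure F a n).real Set.univ : ℝ) : ℂ))⁻¹ * weightedKernel F a (n + 1) z w) := by
  rw [condKernel_eq F ha hdet hz hw, weightedKernel, ← mul_tiltedKernel F ha]
  push_cast
  ring

lemma exists_norm_condKernel_le {a : Fin n → ℂ} (ha : ∀ i, a i ∈ disk) (R : ℝ) (hR : R < 1) :
    ∃ M, ∀ z, ‖z‖ = R → ‖condKernel F a z z‖ ≤ M := by
  refine ⟨(1 - R)⁻¹ * (1 - R)⁻¹ + ∑ l, ∑ m, (1 - R)⁻¹ * (1 - ‖a l‖)⁻¹ *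
    ‖(covMatrix F a a)⁻¹ l m‖ * ((1 - ‖a m‖)⁻¹ * (1 - R)⁻¹), fun z hz => ?_⟩
  have hzd : z ∈ disk := hz.trans_lt hR
  subst hz
  refine (norm_sub_le _ _).trans (add_le_add (norm_covKernel_le F hzd hzd) ?_)
  refine (norm_sum_le _ _).trans (Finset.sum_le_sum fun l _ => (norm_sum_le _ _).trans
    (Finset.sum_le_sum fun m _ => ?_))
  rw [norm_mul, norm_mul]
  have h0 : ∀ v ∈ disk, 0 ≤ (1 - ‖v‖)⁻¹ := fun v hv => by
    have : ‖v‖ < 1 := hv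
    exact inv_nonneg.2 (by linarith)
  have h1 := norm_covKernel_le F hzd (ha l)
  have h2 := norm_covKernel_le F (ha m) hzd
  have h3 := h0 z hzd
  have h4 := h0 _ (ha l)
  gcongr

/-- The mixed second moment of the derivatives at `a_1, …, a_n` of a Gaussian analytic function
conditioned to vanish there. -/
lemma integral_prod_norm_deriv_sq {Y : ℂ → Ω → ℂ} {w : Fin n → ℂ} (hw : ∀ i, w i ∈ disk)
    (hdet : (covMatrix F w w).det ≠ 0) (hY : IsGAF P Y (condKernel F w))
    (hm : ∀ z ∈ disk, Measurable (Y z)) (ha : ∀ ω, DifferentiableOn ℂ (fun z => Y z ω) disk)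
    (hY0 : ∀ i ω, Y (w i) ω = 0) :
    ((∫ ω, ∏ i, ‖deriv (fun z => Y z ω) (w i)‖ ^ 2 ∂P : ℝ) : ℂ) =
      ((‖vand w‖ ^ 4 : ℝ) : ℂ) * ((((vandMeasure F w n).real Set.univ : ℝ) : ℂ)⁻¹ ^ n *
        (Matrix.of fun p q => weightedKernel F w (n + 1) (w p) (w q)).permanent) := by
  set c : ℂ := (((vandMeasure F w n).real Set.univ : ℝ) : ℂ)⁻¹ with hc
  have hwn : ‖w‖ < 1 := (pi_norm_lt_iff one_pos).2 hw
  obtain ⟨r, hr1, hr⟩ := exists_between hwn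
  have hr0 : 0 ≤ r := (norm_nonneg w).trans hr1.le
  have hwr : ∀ i, ‖w i‖ < r := fun i => (norm_le_pi_norm w i).trans_lt hr1
  obtain ⟨S, hS0, hSint, hS⟩ :=
    hY.exists_dominating hm ha (exists_norm_condKernel_le F hw) hr0 hr n
  have hev : ∀ᶠ t : ℂ in nhdsWithin 0 {0}ᶜ, t ≠ 0 ∧ ∀ i, ‖w i + t‖ < r := by
    refine (eventually_mem_nhdsWithin).and (mem_nhdsWithin_of_mem_nhds ?_)
    refine Filter.eventually_all.2 fun i => ?_
    have : ContinuousAt (fun t : ℂ => ‖w i + t‖) 0 := by fun_prop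
    exact this.eventually (gt_mem_nhds (by simpa using hwr i))
  -- As Y vanishes at the w_i, the derivatives are limits of t⁻¹Y(w_i + t). Wick's formula is thus
  -- needed only for values of Y; the mean value inequality supplies the dominating function.
  have hlim1 : Filter.Tendsto (fun t : ℂ => ∫ ω, ∏ i, ‖t⁻¹ * Y (w i + t) ω‖ ^ 2 ∂P)
      (nhdsWithin 0 {0}ᶜ) (nhds (∫ ω, ∏ i, ‖deriv (fun z => Y z ω) (w i)‖ ^ 2 ∂P)) := by
    refine tendsto_integral_filter_of_dominated_convergence (fun ω => S ω ^ (2 * n)) ?_ ?_ hSint ?_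
    · filter_upwards [hev] with t ht
      exact (Finset.measurable_fun_prod _ fun i _ =>
        (((hm _ ((ht.2 i).trans hr)).const_mul _).norm.pow_const 2)).aestronglyMeasurable
    · filter_upwards [hev] with t ht
      refine Filter.Eventually.of_forall fun ω => ?_
      rw [Real.norm_of_nonneg (Finset.prod_nonneg fun _ _ => by positivity)]
      have hle : ∀ i, ‖t⁻¹ * Y (w i + t) ω‖ ≤ S ω := fun i => by
        have := (convex_closedBall (0 : ℂ) r).norm_image_sub_le_of_norm_deriv_le
          (f := fun z => Y z ω) (C := S ω) (x := w i) (y := w i + t)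
          (fun z hz => (ha ω).differentiableAt
            (isOpen_disk.mem_nhds (closedBall_subset_disk hr hz)))
          (fun z hz => (hS ω z (by simpa using hz)).2) (by simpa using (hwr i).le)
          (by simpa using (ht.2 i).le)
        rw [hY0, sub_zero, add_sub_cancel_left] at this
        rw [norm_mul, norm_inv, inv_mul_le_iff₀ (norm_pos_iff.2 ht.1), mul_comm]
        exact this
      refine (Finset.prod_le_prod (fun _ _ => by positivity) fun i _ =>
        pow_le_pow_left₀ (norm_nonneg _) (hle i) 2).trans ?_
      rw [Finset.prod_const, Finset.card_univ, Fintype.card_fin, ← pow_mul]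
    · refine Filter.Eventually.of_forall fun ω => tendsto_finsetProd _ fun i _ => ?_
      have := ((ha ω).differentiableAt (isOpen_disk.mem_nhds (hw i))).hasDerivAt
      have := (hasDerivAt_iff_tendsto_slope_zero.1 this).norm.pow 2
      simpa only [hY0, sub_zero, smul_eq_mul] using this
  -- What remains of the vanishing factors of the conditional kernel after t⁻¹ cancels the factor l
  -- = i. At t = 0 it has modulus |V(w)|².
  set Q : ℂ → ℂ := fun t => ∏ i, ∏ l ∈ Finset.univ.erase i, (w i + t - w l) with hQ
  have hval : ∀ᶠ t : ℂ in nhdsWithin 0 {0}ᶜ,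
      ((∫ ω, ∏ i, ‖t⁻¹ * Y (w i + t) ω‖ ^ 2 ∂P : ℝ) : ℂ) =
      ((‖Q t‖ ^ 2 : ℝ) : ℂ) * (c ^ n *
        (Matrix.of fun p q => weightedKernel F w (n + 1) (w p + t) (w q + t)).permanent) := by
    filter_upwards [hev] with t ht
    have hd : ∀ i, w i + t ∈ disk := fun i => (ht.2 i).trans hr
    have hG := hY.isCircularGaussian hd
    have hG2 := (hG.mulVec (t⁻¹ • (1 : Matrix (Fin n) (Fin n) ℂ))).integral_prod_norm_sq
    simp only [Matrix.smul_mulVec, Matrix.one_mulVec, Pi.smul_apply, smul_eq_mul] at hG2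
    rw [hG2]
    have hprod : ∀ i, ∏ l, (w i + t - w l) = t * ∏ l ∈ Finset.univ.erase i, (w i + t - w l) :=
      fun i => by
        rw [← Finset.mul_prod_erase _ _ (Finset.mem_univ i), add_sub_cancel_left]
    have hmat : (t⁻¹ • (1 : Matrix (Fin n) (Fin n) ℂ)) *
        (Matrix.of fun i j => condKernel F w (w i + t) (w j + t)) *
        (t⁻¹ • (1 : Matrix (Fin n) (Fin n) ℂ)).conjTranspose =
        Matrix.of fun i j => (∏ l ∈ Finset.univ.erase i, (w i + t - w l)) *
          (starRingEnd ℂ) (∏ l ∈ Finset.univ.erase j, (w j + t - w l)) *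
          (c * weightedKernel F w (n + 1) (w i + t) (w j + t)) := by
      ext i j
      rw [Matrix.conjTranspose_smul, Matrix.conjTranspose_one, Matrix.smul_mul, Matrix.one_mul,
        Matrix.mul_smul, Matrix.mul_one, Matrix.smul_apply, Matrix.smul_apply, Matrix.of_apply,
        Matrix.of_apply, condKernel_eq_weightedKernel F hw hdet (hd i) (hd j), ← hc, hprod, hprod,
        map_mul, ← starRingEnd_apply, map_inv₀, smul_eq_mul, smul_eq_mul]
      have h1 := ht.1
      have h2 : (starRingEnd ℂ) t ≠ 0 := by simpa using h1
      field_simp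
    rw [hmat, permanent_mul_mul_conj]
    congr 1
    rw [show (Matrix.of fun i j => c * weightedKernel F w (n + 1) (w i + t) (w j + t)) =
      c • Matrix.of fun i j => weightedKernel F w (n + 1) (w i + t) (w j + t) from rfl,
      Matrix.permanent_smul, Fintype.card_fin]
  have hlim2 : Filter.Tendsto (fun t : ℂ => ((‖Q t‖ ^ 2 : ℝ) : ℂ) * (c ^ n *
        (Matrix.of fun p q => weightedKernel F w (n + 1) (w p + t) (w q + t)).permanent))
      (nhdsWithin 0 {0}ᶜ) (nhds (((‖vand w‖ ^ 4 : ℝ) : ℂ) * (c ^ n *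
        (Matrix.of fun p q => weightedKernel F w (n + 1) (w p) (w q)).permanent))) := by
    have hQ0 : ‖Q 0‖ ^ 2 = ‖vand w‖ ^ 4 := by
      simp only [hQ, add_zero]
      rw [norm_prod_prod_erase_sub, ← pow_mul]
    have hc1 : ContinuousAt (fun t : ℂ => ((‖Q t‖ ^ 2 : ℝ) : ℂ) * (c ^ n *
        (Matrix.of fun p q => weightedKernel F w (n + 1) (w p + t) (w q + t)).permanent)) 0 := by
      refine ContinuousAt.mul (Continuous.continuousAt ?_)
        (continuousAt_const.mul (continuousAt_permanent fun i j => ?_))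
      · simp only [hQ]
        exact Complex.continuous_ofReal.comp ((continuous_finsetProd _ fun i _ =>
          continuous_finsetProd _ fun l _ => by fun_prop).norm.pow 2)
      · exact ContinuousAt.comp
          (g := fun p : (Fin n → ℂ) × ℂ × ℂ => weightedKernel F p.1 (n + 1) p.2.1 p.2.2)
          (f := fun t => (w, w i + t, w j + t))
          (continuousAt_weightedKernel F hw (by simpa using hw i) (by simpa using hw j))
          (by fun_prop)
    have := hc1.tendsto
    rw [hQ0] at this
    simp only [add_zero] at this
    exact this.mono_left nhdsWithin_le_nhds
  exact tendsto_nhds_unique ((Complex.continuous_ofReal.tendsto _).comp hlim1)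
    (hlim2.congr' (hval.mono fun t ht => ht.symm))

/-- The expected Kac-Rice density at the points of the regression. -/
lemma integral_kacRiceDensity_eq_zeroDensity {Y : ℂ → Ω → ℂ} {h : Fin n → ℂ → ℂ} {w : Fin n → ℂ}
    (hw : ∀ i, w i ∈ disk) (hdet : (covMatrix F w w).det ≠ 0) (hY : IsGAF P Y (condKernel F w))
    (hm : ∀ z ∈ disk, Measurable (Y z)) (ha : ∀ ω, DifferentiableOn ℂ (fun z => Y z ω) disk)
    (hY0 : ∀ i ω, Y (w i) ω = 0)
    (hh : (((‖(evalMatrix h w).det‖ ^ 2 : ℝ)) : ℂ) = (covMatrix F w w).det) :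
    ((∫ ω, kacRiceDensity h stdDensityPi (fun z => Y z ω) w ∂P : ℝ) : ℂ) = zeroDensity F w := by
  have hJ : ∀ ω, kacRiceDensity h stdDensityPi (fun z => Y z ω) w =
      (Real.pi⁻¹ ^ n / ‖(evalMatrix h w).det‖ ^ 2) *
        ∏ i, ‖deriv (fun z => Y z ω) (w i)‖ ^ 2 := fun ω => by
    -- At the regression points u(w) = 0, so the Gaussian density is its value π^{-n} at the origin
    -- and the correction terms in the derivatives disappear.
    have h0 : zeroCoeff h (fun z => Y z ω) w = 0 := by
      rw [zeroCoeff]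
      simp only [hY0]
      rw [show (fun _ : Fin n => (0 : ℂ)) = 0 from rfl, Matrix.mulVec_zero, neg_zero]
    rw [kacRiceDensity, h0]
    simp only [Pi.zero_apply, mul_zero, Finset.sum_const_zero, add_zero, stdDensityPi, stdDensity,
      norm_zero]
    simp
    ring
  simp only [hJ]
  rw [integral_const_mul]
  push_cast
  have h1 := integral_prod_norm_deriv_sq F hw hdet hY hm ha hY0
  push_cast at h1 hh
  rw [h1, hh, zeroDensity]
  rw [det_covMatrix_self F hw] at hdet ⊢
  push_cast at hdet ⊢
  obtain ⟨hv, hμ⟩ := mul_ne_zero_iff.1 hdet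
  have hpi : (Real.pi : ℂ) ≠ 0 := by exact_mod_cast Real.pi_ne_zero
  have hv' : (‖vand w‖ : ℂ) ≠ 0 := fun h => hv (by rw [h]; simp)
  simp only [inv_pow]
  field_simp
  ring

end Value

/-! ### The correlation function when the conditioning is nondegenerate -/

section Nondegenerate

variable {Ω : Type*} [MeasurableSpace Ω] {P : Measure Ω} [IsProbabilityMeasure P]
  (F : Measure Torus) [IsProbabilityMeasure F] {X : ℂ → Ω → ℂ} {n : ℕ}

lemma det_covMatrix_ne_zero {w : Fin n → ℂ} (hw : w ∈ distinctTuples n)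
    (hμ : (vandMeasure F w n).real Set.univ ≠ 0) : (covMatrix F w w).det ≠ 0 := by
  rw [det_covMatrix_self F hw.1]
  have : ‖vand w‖ ≠ 0 := norm_ne_zero_iff.2 (vand_ne_zero_iff.2 hw.2)
  exact_mod_cast mul_ne_zero (pow_ne_zero 2 this) hμ

/-- Near a configuration `w` of distinct points the zeros have a continuous correlation density,
whose value at `w` is explicit. -/
lemma IsGAF.exists_local_density (hX : IsGAF P X (covKernel F)) (hm : ∀ z ∈ disk, Measurable (X z))
    (ha : ∀ ω, DifferentiableOn ℂ (fun z => X z ω) disk) {w : Fin n → ℂ}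
    (hw : w ∈ distinctTuples n) (hμ : (vandMeasure F w n).real Set.univ ≠ 0) :
    ∃ (δ : ℝ) (ρ : (Fin n → ℂ) → ℝ), 0 < δ ∧ Metric.ball w δ ⊆ distinctTuples n ∧
      ContinuousOn ρ (Metric.ball w δ) ∧ 0 ≤ ρ w ∧ ((ρ w : ℝ) : ℂ) = zeroDensity F w ∧
      ∀ B : Fin n → Set ℂ, (∀ i, MeasurableSet (B i)) → (∀ i, B i ⊆ Metric.ball (w i) δ) →
        ∫⁻ ω, ∏ i, zeroCount X (B i) ω ∂P =
          ∫⁻ z in Set.univ.pi B, ENNReal.ofReal (ρ z) := by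
  have hdet := det_covMatrix_ne_zero F hw hμ
  obtain ⟨h, Y, η, hh, hYm, hYa, hηm, hη, hind, hXY, hY0, hhdet, hY⟩ :=
    hX.exists_regression hm ha hw.1 (fun i => differentiableOn_covKernel F (hw.1 i)) hdet
  change _ = (covMatrix F w w).det at hhdet
  change IsGAF P Y (condKernel F w) at hY
  have hreg : w ∈ regularTuples h := by
    refine ⟨hw.1, fun h0 => hdet ?_⟩
    rw [← hhdet, h0]
    simp
  obtain ⟨δ₁, hδ₁, hsub, hcont, hswap⟩ :=
    hY.exists_expected_kacRiceDensity hYm hYa (exists_norm_condKernel_le F hw.1) hh hreg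
  obtain ⟨δ₂, hδ₂, hsub₂, hball⟩ := exists_ball_subset_distinctTuples hw
  have hδ : 0 < min δ₁ δ₂ := lt_min hδ₁ hδ₂
  refine ⟨min δ₁ δ₂, fun z => ∫ ω, kacRiceDensity h stdDensityPi (fun z => Y z ω) z ∂P, hδ,
    (Metric.ball_subset_ball (min_le_right _ _)).trans hsub₂,
    hcont.mono (Metric.ball_subset_ball (min_le_left _ _)),
    integral_nonneg fun ω => kacRiceDensity_nonneg _ _,
    integral_kacRiceDensity_eq_zeroDensity F hw.1 hdet hY hYm hYa hY0 hhdet, fun B hB hBw => ?_⟩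
  have hBd : ∀ i, B i ⊆ disk := fun i =>
    (hBw i).trans ((hball _ hδ (min_le_right _ _)).1 i)
  have hpi : Set.univ.pi B ⊆ Metric.ball w δ₁ := by
    refine Set.Subset.trans ?_ (Metric.ball_subset_ball (min_le_left δ₁ δ₂))
    rw [ball_pi_eq hδ]
    exact Set.pi_mono fun i _ => hBw i
  rw [lintegral_prod_zeroCount_eq_lintegral_kacRiceDensity hh hYm hYa hηm hη hind hXY hB hBd
    fun z hz => (hsub (hpi hz)).2]
  exact hswap _ hpi (MeasurableSet.univ_pi hB)

lemma pi_subset_distinctTuples {B : Fin n → Set ℂ} (hBd : ∀ i, B i ⊆ disk)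
    (hdisj : Pairwise fun i j => Disjoint (B i) (B j)) : Set.univ.pi B ⊆ distinctTuples n :=
  fun a ha => ⟨fun i => hBd i (ha i trivial), fun i j hij => by
    by_contra hne
    exact Set.disjoint_left.1 (hdisj hne) (ha i trivial) (hij ▸ ha j trivial)⟩

/-- A local density is explicit only at its own centre. At another point b of the ball it is
compared with the local density centred at b: both are continuous and have the same integrals over
small boxes around b, so they agree there. -/
theorem IsGAF.isCorrelationFunction_zeroDensity (hX : IsGAF P X (covKernel F))
    (hm : ∀ z ∈ disk, Measurable (X z)) (ha : ∀ ω, DifferentiableOn ℂ (fun z => X z ω) disk)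
    (hμ : ∀ a ∈ distinctTuples n, (vandMeasure F a n).real Set.univ ≠ 0) :
    IsCorrelationFunction P X n (fun a => (zeroDensity F a).re.toNNReal) ∧
      ∀ a ∈ distinctTuples n, (((zeroDensity F a).re.toNNReal : ℝ) : ℂ) = zeroDensity F a := by
  have hN : ∀ B : Set ℂ, MeasurableSet B → Measurable (zeroCount X B) := fun B hB =>
    measurable_zeroCount hm ha hB
  have hcont : ∀ a ∈ distinctTuples n,
      ContinuousAt (fun a => (zeroDensity F a).re.toNNReal) a := fun a h =>
    (continuous_real_toNNReal.comp Complex.continuous_re).continuousAt.comp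
      (continuousAt_zeroDensity F h.1 (hμ a h))
  have hval : ∀ a ∈ distinctTuples n, ∀ x : ℝ, (x : ℂ) = zeroDensity F a →
      ((zeroDensity F a).re.toNNReal : ℝ≥0∞) = ENNReal.ofReal x := fun a _ x hx => by
    rw [← hx, Complex.ofReal_re, ENNReal.ofReal]
  refine ⟨⟨fun B hB _ => (hN B hB).aemeasurable, fun B hB hBd hdisj => ?_,
    fun a h => (hcont a h).continuousWithinAt⟩, fun a h => ?_⟩
  · refine lintegral_prod_zeroCount_of_local P hN
      (fun a => ((zeroDensity F a).re.toNNReal : ℝ≥0∞)) (U := distinctTuples n) (fun w hw => ?_) B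
      hB (pi_subset_distinctTuples hBd hdisj)
    obtain ⟨δ, ρ, hδ, hsub, hρc, -, -, hρ⟩ := hX.exists_local_density F hm ha hw (hμ w hw)
    refine ⟨δ, hδ, fun B hB hBw => ?_⟩
    rw [hρ B hB hBw]
    refine setLIntegral_congr_fun (MeasurableSet.univ_pi hB) fun b hb => ?_
    have hbw : b ∈ Metric.ball w δ := by
      rw [ball_pi_eq hδ]
      exact Set.pi_mono (fun i _ => hBw i) hb
    have hbU := hsub hbw
    obtain ⟨δ', ρ', hδ', -, hρc', -, hρb, hρ'⟩ :=
      hX.exists_local_density F hm ha hbU (hμ b hbU)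
    obtain ⟨ε, hε, hεsub⟩ := Metric.isOpen_iff.1 Metric.isOpen_ball b hbw
    change _ = ((zeroDensity F b).re.toNNReal : ℝ≥0∞)
    rw [hval b hbU _ hρb]
    refine density_eq_of_setLIntegral_ball_eq (ρ₁ := fun z => ENNReal.ofReal (ρ z))
      (ρ₂ := fun z => ENNReal.ofReal (ρ' z))
      (ENNReal.continuous_ofReal.continuousAt.comp
        (hρc.continuousAt (Metric.isOpen_ball.mem_nhds hbw)))
      (ENNReal.continuous_ofReal.continuousAt.comp
        (hρc'.continuousAt (Metric.ball_mem_nhds b hδ'))) (lt_min hε hδ') fun r hr hrδ => ?_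
    rw [ball_pi_eq hr, ← hρ' _ (fun i => measurableSet_ball)
      (fun i => Metric.ball_subset_ball (hrδ.le.trans (min_le_right _ _)))]
    refine (hρ _ (fun i => measurableSet_ball) fun i => ?_).symm
    intro x hx
    have hupd : Function.update b i x ∈ Metric.ball b ε := by
      rw [ball_pi_eq hε]
      intro j _
      rcases eq_or_ne j i with rfl | hj
      · simpa using Metric.ball_subset_ball (hrδ.le.trans (min_le_left _ _)) hx
      · simpa [Function.update_of_ne hj] using hε
    have := hεsub hupd
    rw [ball_pi_eq hδ] at this
    simpa using this i trivial
  · obtain ⟨δ, ρ, -, -, -, hρ0, hρa, -⟩ := hX.exists_local_density F hm ha h (hμ a h)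
    rw [← hρa, Complex.ofReal_re, Real.coe_toNNReal _ hρ0]

end Nondegenerate

/-! ### The degenerate case -/

section Degenerate

/-- Szegő factors never vanish, so degeneracy of the measures is a property of F and of the number
of points, independent of a. -/
lemma vandDensity_eq_zero_iff {n m : ℕ} {a : Fin n → ℂ} (ha : ∀ i, a i ∈ disk) (t : Fin m → Torus) :
    vandDensity a t = 0 ↔ (vand fun k => expNeg (t k)) = 0 := by
  have h1 : szegoProd a t ≠ 0 := Finset.prod_ne_zero_iff.2 fun j _ =>
    Finset.prod_ne_zero_iff.2 fun k _ => szego_ne_zero (ha j) _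
  have h2 : (m.factorial : ℝ) ≠ 0 := by positivity
  simp [vandDensity, h1, h2]

variable {Ω : Type*} [MeasurableSpace Ω] {P : Measure Ω} [IsProbabilityMeasure P]
  (F : Measure Torus) [IsProbabilityMeasure F] {X : ℂ → Ω → ℂ} {n m : ℕ}

/-- Almost every sample of `m` points from `F` has a coincidence. -/
def IsVandDegenerate (m : ℕ) : Prop :=
  ∀ᵐ t ∂(Measure.pi fun _ : Fin m => F), (vand fun k => expNeg (t k)) = 0

lemma vandMeasure_real_univ_eq_zero_iff {a : Fin n → ℂ} (ha : ∀ i, a i ∈ disk) :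
    (vandMeasure F a m).real Set.univ = 0 ↔ IsVandDegenerate F m := by
  rw [vandMeasure_real_univ F ha, integral_eq_zero_iff_of_nonneg
    (fun t => vandDensity_nonneg a t) (integrable_vandDensity F ha)]
  exact Filter.eventually_congr (Filter.Eventually.of_forall fun t => vandDensity_eq_zero_iff ha t)

lemma not_isVandDegenerate_of_le_one (hm : m ≤ 1) : ¬ IsVandDegenerate F m := by
  intro h
  have : ∀ t : Fin m → Torus, (vand fun k => expNeg (t k)) ≠ 0 := fun t => by
    have : Subsingleton (Fin m) := Fin.subsingleton_iff_le_one.2 hm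
    exact vand_ne_zero_iff.2 (Function.injective_of_subsingleton _)
  obtain ⟨t, ht⟩ := h.exists
  exact this t ht

lemma zeroDensity_eq_zero_of_isVandDegenerate (ν : Measure Torus) (hn : n ≠ 0)
    (h : IsVandDegenerate ν (n + 1)) {a : Fin n → ℂ} (ha : ∀ i, a i ∈ disk) : zeroDensity ν a = 0 := by
  have hW : ∀ p q, weightedKernel ν a (n + 1) (a p) (a q) = 0 := fun p q => by
    rw [weightedKernel]
    refine integral_eq_zero_of_ae ?_
    filter_upwards [h] with t ht
    rw [(vandDensity_eq_zero_iff ha t).2 ht]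
    simp
  -- For n = 0 the permanent would be 1, whatever the measure.
  have : Nonempty (Fin n) := ⟨⟨0, Nat.pos_of_ne_zero hn⟩⟩
  have h0 : (Matrix.of fun p q => weightedKernel ν a (n + 1) (a p) (a q)) = 0 := by
    ext p q
    exact hW p q
  rw [zeroDensity, h0, Matrix.permanent_zero, mul_zero]

/-- With k + 1 the least degenerate order, order k is covered by the nondegenerate case, and its
density vanishes because μ̃_a = 0. So the product of the first k counts is almost surely zero, and
with it the product of all n. -/
theorem IsGAF.isCorrelationFunction_zero (hX : IsGAF P X (covKernel F))
    (hm : ∀ z ∈ disk, Measurable (X z)) (ha : ∀ ω, DifferentiableOn ℂ (fun z => X z ω) disk)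
    (hn : IsVandDegenerate F n) : IsCorrelationFunction P X n 0 := by
  classical
  have hN : ∀ B : Set ℂ, MeasurableSet B → Measurable (zeroCount X B) := fun B hB =>
    measurable_zeroCount hm ha hB
  obtain ⟨k, hk1, hkn, hk, hk'⟩ : ∃ k, 1 ≤ k ∧ k < n ∧ ¬ IsVandDegenerate F k ∧
      IsVandDegenerate F (k + 1) := by
    have hex : ∃ m, IsVandDegenerate F m := ⟨n, hn⟩
    -- Up to one point no coincidence is possible, so k ≥ 1; this is needed because the density of
    -- order 0 does not vanish.
    have h1 : 1 < Nat.find hex := by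
      by_contra hle
      exact not_isVandDegenerate_of_le_one F (not_lt.1 hle) (Nat.find_spec hex)
    have h2 := Nat.find_min' hex hn
    refine ⟨Nat.find hex - 1, by omega, by omega, Nat.find_min hex (by omega), ?_⟩
    rw [Nat.sub_add_cancel h1.le]
    exact Nat.find_spec hex
  obtain ⟨hcorr, -⟩ := hX.isCorrelationFunction_zeroDensity F (n := k) hm ha fun a h =>
    fun h0 => hk ((vandMeasure_real_univ_eq_zero_iff F h.1).1 h0)
  refine ⟨fun B hB _ => (hN B hB).aemeasurable, fun B hB hBd hdisj => ?_, continuousOn_const⟩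
  simp only [Pi.zero_apply, ENNReal.coe_zero, lintegral_zero]
  let ι : Fin k → Fin n := Fin.castLE hkn.le
  have hι : Function.Injective ι := Fin.castLE_injective hkn.le
  have h0 : ∫⁻ ω, ∏ i, zeroCount X (B (ι i)) ω ∂P = 0 := by
    rw [hcorr.lintegral_prod_zeroCount (fun i => B (ι i)) (fun i => hB _) (fun i => hBd _)
      fun i j hij => hdisj (hι.ne hij)]
    refine (setLIntegral_congr_fun (MeasurableSet.univ_pi fun i => hB _) fun a h => ?_).trans
      lintegral_zero
    rw [zeroDensity_eq_zero_of_isVandDegenerate F (by omega) hk' fun i => hBd _ (h i trivial)]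
    simp
  rw [lintegral_eq_zero_iff (Finset.measurable_fun_prod _ fun i _ => hN _ (hB _))] at h0
  rw [lintegral_eq_zero_iff (Finset.measurable_fun_prod _ fun i _ => hN _ (hB _))]
  filter_upwards [h0] with ω hω
  obtain ⟨i, -, hi⟩ := Finset.prod_eq_zero_iff.1 hω
  exact Finset.prod_eq_zero (Finset.mem_univ (ι i)) hi

end Degenerate

/-! ### Existence and value of the correlation functions in both cases -/

section Main

lemma IsCorrelationFunction.congr {Ω : Type*} [MeasurableSpace Ω] {P : Measure Ω}
    {X Y : ℂ → Ω → ℂ} {n : ℕ} {ρ : (Fin n → ℂ) → ℝ≥0}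
    (hY : IsCorrelationFunction P Y n ρ) (h : ∀ᵐ ω ∂P, ∀ z, Y z ω = X z ω) :
    IsCorrelationFunction P X n ρ where
  aemeasurable_zeroCount B hB hBd := (hY.aemeasurable_zeroCount B hB hBd).congr
    (h.mono fun _ hω => zeroCount_congr hω B)
  lintegral_prod_zeroCount B hB hBd hdisj := by
    rw [← hY.lintegral_prod_zeroCount B hB hBd hdisj]
    refine lintegral_congr_ae (h.mono fun ω hω => ?_)
    simp only [zeroCount_congr hω]
  continuousOn := hY.continuousOn

variable {Ω : Type*} [MeasurableSpace Ω] {P : Measure Ω} [IsProbabilityMeasure P]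
  (F : Measure Torus) [IsProbabilityMeasure F] {X : ℂ → Ω → ℂ}

/-- The zeros of the Gaussian analytic function have correlation functions of every order, given by
the formula. -/
theorem IsGAF.exists_isCorrelationFunction (hX : IsGAF P X (covKernel F)) (n : ℕ) :
    ∃ ρ : (Fin n → ℂ) → ℝ≥0, IsCorrelationFunction P X n ρ ∧
      ∀ a ∈ distinctTuples n, ((ρ a : ℝ) : ℂ) = zeroDensity F a := by
  obtain ⟨Y, hYm, hYa, hYX⟩ := exists_analytic_version hX.analytic fun z hz =>
    (hX.integrable hz).aemeasurable
  have hY := hX.congr hYX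
  by_cases hn : IsVandDegenerate F n
  · refine ⟨0, (hY.isCorrelationFunction_zero F hYm hYa hn).congr hYX, fun a ha => ?_⟩
    -- Here μ_a = 0, and division by 0 ^ (n + 1) gives 0, the convention under which the formula is
    -- read.
    rw [zeroDensity, (vandMeasure_real_univ_eq_zero_iff F ha.1).2 hn]
    simp
  · obtain ⟨h1, h2⟩ := hY.isCorrelationFunction_zeroDensity F hYm hYa (n := n) fun a ha h0 =>
      hn ((vandMeasure_real_univ_eq_zero_iff F ha.1).1 h0)
    exact ⟨_, h1.congr hYX, h2⟩

end Main

end SpectralGAF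

end

theorem theorem4 {Ω : Type*} [MeasurableSpace Ω] (P : Measure Ω) [IsProbabilityMeasure P]
    (F : Measure Torus) [IsProbabilityMeasure F] (X : ℂ → Ω → ℂ)
    (hX : IsGAF P X (covKernel F)) (n : ℕ) :
    (∃ ρ : (Fin n → ℂ) → ℝ≥0, IsCorrelationFunction P X n ρ) ∧
    ∀ ρ : (Fin n → ℂ) → ℝ≥0, IsCorrelationFunction P X n ρ →
      ∀ a : Fin n → ℂ, (∀ i, a i ∈ disk) → Function.Injective a →
        (((ρ a : ℝ≥0) : ℝ) : ℂ) =
          1 / (Real.pi : ℂ) ^ n * ((‖vand a‖ ^ 2 : ℝ) : ℂ) *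
            ((((vandMeasure F a (n + 1)).real Set.univ ^ n /
              (vandMeasure F a n).real Set.univ ^ (n + 1) : ℝ)) : ℂ) *
            Matrix.permanent
              (Matrix.of fun p q : Fin n => tiltedKernel F a (n + 1) (a p) (a q)) := by
  obtain ⟨ρ₀, hρ₀, hval⟩ := hX.exists_isCorrelationFunction F n
  refine ⟨⟨ρ₀, hρ₀⟩, fun ρ hρ a ha hinj => ?_⟩
  rw [hρ.eqOn hρ₀ ⟨ha, hinj⟩, hval a ⟨ha, hinj⟩, zeroDensity_eq F ha]
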